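/- Let $p$ be a prime. **Witt vectors with coefficients.** For a ring $R$, an $R$-bimodule $M$ and $L\ge 1$ let $M^{\otimes_R L}$ be the $L$-fold tensor power over $R$, and let $M^{\circledcirc_R L}=M^{\otimes_R L}/[R,M^{\otimes_R L}]$ be the cyclic tensor power, with its action of the cyclic group $C_L$. For $0\le j<n$ the ghost map $w_j\colon \prod_{i=0}^{n-1}M^{\otimes_R p^i}\to M^{\circledcirc_R p^j}$ is $$w_j(a_0,\dots,a_{n-1})=\sum_{i=0}^{j}\ \sum_{\sigma\in C_{p^j}/C_{p^{j-i}}}\sigma\big(a_i^{\otimes p^{j-i}}\big).$$ Let $F(X,Y)$ be the free bimodule on a pair of sets (the free ring $\mathbb Z\{X\}$ and the free $\mathbb Z\{X\}$-bimodule on $Y$), $U$ the forgetful functor from pairs $(R;M)$ to pairs of sets, and $f,g\colon FUFU(R;M)\rightrightarrows FU(R;M)\xrightarrow{\ \epsilon\ }(R;M)$ the canonical free resolution. The set $W_{n,p}(R;M)$ is the quotient of $\prod_{i=0}^{n-1}M^{\otimes_R p^i}$ by the equivalence relation generated by: $a\sim b$ if there are $q,u$ over $FU(R;M)$ and $z$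 over $FUFU(R;M)$ with $\epsilon_*q=a$, $\epsilon_*u=b$, and $w_j(q)=w_j(f_*z)$, $w_j(u)=w_j(g_*z)$ for all $0\le j<n$. It is functorial in $(R;M)$. Its addition is the one that is natural in $(R;M)$ and makes the ghost maps additive: $x+y$ is the class of $\epsilon_*c$ for any $a,b,c$ over $FU(R;M)$ such that $\epsilon_*a,\epsilon_*b$ represent $x,y$ and $w_j(c)=w_j(a)+w_j(b)$ for $0\le j<n$. If $R$ is commutative and $M$ is an $R$-module, $W_{n,p}(R;M)$ is a module over the ring $W_{n,p}(R)$ of $n$-truncated $p$-typical Witt vectors; this structure is the one that is natural in $(R;M)$ and satisfies $w_j(ax)=w_j(a)w_j(x)$, where $w_j(a)=\sum_{i\le j}p^ia_i^{p^{j-i}}$. It is computed by lifting $a$ and $x$ to the polynomial ring $\mathbb Z[R]$ on the set $R$ and the free $\mathbb Z[R]$-module on the set $M$. **Polynomial Witt vectors.** For a commutative ring $\Lambda$ and a $\Lambda$-module $E$ let $Q_{p^n}(\Lambda;E)$ be the cokernel of the transfer $\sum_{\sigma\in C_{p^n}}\sigma\colon (E^{\otimes_\Lambda p^n})_{C_{p^n}}\to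 (E^{\otimes_\Lambda p^n})^{C_{p^n}}$. Suppose that $\Lambda/p=k$ is a field. On free $\Lambda$-modules $E$ the functor $E\mapsto Q_{p^n}(\Lambda;E)$ factors through $E\mapsto E/p$. It therefore determines a functor $\overline W_n$ on $k$-vector spaces with $\overline W_n(E/p)=Q_{p^n}(\Lambda;E)$, naturally in free $\Lambda$-modules $E$. Its values are modules over $W_{n,p}(k)$ through the ring homomorphism $$W_{n,p}(k)\to \Lambda/p^n,\qquad (a_0,\dots,a_{n-1})\mapsto\sum_{i<n}p^i\tilde a_i^{\,p^{n-i}},$$ where $\tilde a_i\in\Lambda$ are arbitrary lifts of the $a_i$. **Statement.** Let $m\ge n\ge 1$. 1. Let $k$ be a perfect field of characteristic $p$, and let $\overline W_n$ be the functor above for $\Lambda=W_{m,p}(k)$, $\Lambda/p=k$ (Kaledin's polynomial Witt vectors). The operations described above make $W_{n,p}(k;V)$ a $W_{n,p}(k)$-module for every $k$-vector space $V$, and there is an isomorphism of $W_{n,p}(k)$-modules $$W_{n,p}(k;V)\cong\overline W_n(V),$$ natural in the $k$-vector space $V$. 2. In particular, for $k=\mathbb F_p$, let $\overline W_n$ be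 the functor above for $\Lambda=\mathbb Z$, so that $\overline W_n(A/p)=Q_{p^n}(\mathbb Z;A)$ for free abelian groups $A$. There is an isomorphism of abelian groups $\overline W_n(V)\cong W_{n,p}(\mathbb F_p;V)$, natural in the $\mathbb F_p$-vector space $V$. -/

import Mathlib

open scoped TensorProduct
open PiTensorProduct

noncomputable section

/-! ### Bimodules over (not necessarily commutative) rings -/

set_option linter.checkUnivs false in
/-- An object `(R; M)` of the category of bimodules: a ring `R` with an `R`-bimodule `M`.
The right action is written as an action of the opposite ring. -/
structure RBimod.{u, v} where
  R : Type u
  M : Type v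
  [ring : Ring R]
  [addCommGroup : AddCommGroup M]
  [left : Module R M]
  [right : Module Rᵐᵒᵖ M]
  [comm : SMulCommClass R Rᵐᵒᵖ M]

namespace RBimod

universe u v u₁ v₁ u₂ v₂ u₃ v₃

attribute [instance] RBimod.ring RBimod.addCommGroup RBimod.left RBimod.right RBimod.comm

/-- A morphism `(R; M) ⟶ (R'; M')`: a ring homomorphism `α` together with a map of
`R`-bimodules `M → α^* M'`. -/
structure Hom (B : RBimod.{u, v}) (B' : RBimod.{u₁, v₁}) where
  onRing : B.R →+* B'.R
  onMod : B.M →+ B'.M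
  map_smul (r : B.R) (m : B.M) : onMod (r • m) = onRing r • onMod m
  map_op_smul (r : B.R) (m : B.M) :
    onMod (MulOpposite.op r • m) = MulOpposite.op (onRing r) • onMod m

namespace Hom

theorem ext' {B : RBimod.{u, v}} {B' : RBimod.{u₁, v₁}} {f g : Hom B B'}
    (h₁ : f.onRing = g.onRing) (h₂ : f.onMod = g.onMod) : f = g := by
  cases f; cases g; cases h₁; cases h₂; rfl

/-- Composition of morphisms (`f` first). -/
def comp {B : RBimod.{u, v}} {B' : RBimod.{u₁, v₁}} {B'' : RBimod.{u₂, v₂}}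
    (g : Hom B' B'') (f : Hom B B') : Hom B B'' where
  onRing := g.onRing.comp f.onRing
  onMod := g.onMod.comp f.onMod
  map_smul r m := by simp [f.map_smul, g.map_smul]
  map_op_smul r m := by simp [f.map_op_smul, g.map_op_smul]

end Hom

/-- A module `M` over a commutative ring `R`, regarded as a bimodule with both actions equal. -/
abbrev ofModule (R : Type u) (M : Type v) [CommRing R] [AddCommGroup M] [Module R M] :
    RBimod.{u, v} :=
  letI : Module Rᵐᵒᵖ M :=
    Module.compHom M ((RingHom.id R).fromOpposite fun x y => mul_comm x y)
  { R := R
    M := M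
    comm := ⟨fun r s m => smul_comm r s.unop m⟩ }

/-- An `R`-linear map is a morphism of symmetric bimodules. -/
def ofLinearMap {R : Type u} {M : Type v} {M' : Type v₁} [CommRing R] [AddCommGroup M]
    [Module R M] [AddCommGroup M'] [Module R M'] (f : M →ₗ[R] M') :
    Hom (ofModule R M) (ofModule R M') where
  onRing := RingHom.id R
  onMod := f.toAddMonoidHom
  map_smul r m := f.map_smul r m
  map_op_smul r m := f.map_smul r m

/-! ### Free bimodules and the canonical free resolution -/

/-- The free `S`-bimodule `(S ⊗ S^op)(Y)` on a set `Y`. -/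
def FreeBimodule (S : Type u) [Ring S] (Y : Type v) : Type (max u v) := Y →₀ S ⊗[ℤ] Sᵐᵒᵖ

namespace FreeBimodule

variable {S : Type u₁} [Ring S] {Y : Type v₁}

instance : AddCommGroup (FreeBimodule S Y) :=
  inferInstanceAs (AddCommGroup (Y →₀ S ⊗[ℤ] Sᵐᵒᵖ))

instance : Module (S ⊗[ℤ] Sᵐᵒᵖ) (FreeBimodule S Y) :=
  inferInstanceAs (Module (S ⊗[ℤ] Sᵐᵒᵖ) (Y →₀ S ⊗[ℤ] Sᵐᵒᵖ))

/-- `s · m = (s ⊗ 1) m`. -/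
instance : Module S (FreeBimodule S Y) :=
  Module.compHom _ (Algebra.TensorProduct.includeLeftRingHom : S →+* S ⊗[ℤ] Sᵐᵒᵖ)

/-- `m · s = (1 ⊗ s) m`. -/
instance : Module Sᵐᵒᵖ (FreeBimodule S Y) :=
  Module.compHom _
    (Algebra.TensorProduct.includeRight : Sᵐᵒᵖ →ₐ[ℤ] S ⊗[ℤ] Sᵐᵒᵖ).toRingHom

theorem smul_def (s : S) (m : FreeBimodule S Y) : s • m = (s ⊗ₜ[ℤ] (1 : Sᵐᵒᵖ)) • m := rfl

theorem op_smul_def (s : Sᵐᵒᵖ) (m : FreeBimodule S Y) : s • m = ((1 : S) ⊗ₜ[ℤ] s) • m := rfl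

instance : SMulCommClass S Sᵐᵒᵖ (FreeBimodule S Y) := ⟨fun r s m => by
  rw [smul_def, smul_def, op_smul_def, op_smul_def, smul_smul, smul_smul,
    Algebra.TensorProduct.tmul_mul_tmul, Algebra.TensorProduct.tmul_mul_tmul, one_mul, mul_one,
    one_mul, mul_one]⟩

/-- The element `x · y` for `x ∈ S ⊗ S^op` and a basis element `y ∈ Y`. -/
def single (y : Y) (x : S ⊗[ℤ] Sᵐᵒᵖ) : FreeBimodule S Y := Finsupp.single y x

/-- The basis element `y`. -/
def of (y : Y) : FreeBimodule S Y := single y 1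

theorem single_zero (y : Y) : (single y 0 : FreeBimodule S Y) = 0 := Finsupp.single_zero y

theorem single_add (y : Y) (a b : S ⊗[ℤ] Sᵐᵒᵖ) :
    (single y (a + b) : FreeBimodule S Y) = single y a + single y b := Finsupp.single_add y a b

theorem smul_single (c : S ⊗[ℤ] Sᵐᵒᵖ) (y : Y) (x : S ⊗[ℤ] Sᵐᵒᵖ) :
    c • (single y x : FreeBimodule S Y) = single y (c * x) := Finsupp.smul_single c y x

theorem single_tmul (y : Y) (s : S) (t : Sᵐᵒᵖ) :
    (single y (s ⊗ₜ t) : FreeBimodule S Y) = s • t • of y := by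
  rw [smul_def, op_smul_def, of, smul_single, smul_single, mul_one,
    Algebra.TensorProduct.tmul_mul_tmul, one_mul, mul_one]

@[elab_as_elim]
theorem induction {motive : FreeBimodule S Y → Prop} (x : FreeBimodule S Y)
    (zero : motive 0) (add : ∀ a b, motive a → motive b → motive (a + b))
    (tmul : ∀ y s t, motive (single y (s ⊗ₜ t))) : motive x := by
  refine Finsupp.induction_linear (motive := motive) x zero (fun a b => add a b) fun y x => ?_
  change motive (single y x)
  induction x using TensorProduct.induction_on with
  | zero => rw [single_zero]; exact zero
  | add a b ha hb => rw [single_add]; exact add _ _ ha hb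
  | tmul s t => exact tmul y s t

/-- The additive map `S ⊗ S^op → M`, `s ⊗ t ↦ s m t`, for `S` acting on a bimodule `(R; M)`
through a ring homomorphism `S → R`. -/
def sandwich (B : RBimod.{u, v}) (α : S →+* B.R) (m : B.M) :
    S ⊗[ℤ] Sᵐᵒᵖ →+ B.M :=
  TensorProduct.liftAddHom
    (AddMonoidHom.mk' (fun s => AddMonoidHom.mk'
      (fun t : Sᵐᵒᵖ => α s • MulOpposite.op (α t.unop) • m)
      (fun t t' => by simp [add_smul])) (fun s s' => by ext t; simp [add_smul]))
    (fun r s t => by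
      simp only [AddMonoidHom.mk'_apply, map_zsmul]
      rfl)

/-- The additive extension of a map `Y → M`. -/
def lift (B : RBimod.{u, v}) (α : S →+* B.R) (g : Y → B.M) : FreeBimodule S Y →+ B.M :=
  (Finsupp.liftAddHom fun y => sandwich B α (g y) : (Y →₀ S ⊗[ℤ] Sᵐᵒᵖ) →+ B.M)

theorem lift_single (B : RBimod.{u, v}) (α : S →+* B.R) (g : Y → B.M) (y : Y) (s : S)
    (t : Sᵐᵒᵖ) : lift B α g (single y (s ⊗ₜ t)) = α s • MulOpposite.op (α t.unop) • g y :=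
  (Finsupp.liftAddHom_apply_single _ _ _).trans rfl

theorem lift_of (B : RBimod.{u, v}) (α : S →+* B.R) (g : Y → B.M) (y : Y) :
    lift B α g (of y) = g y := by
  rw [of, Algebra.TensorProduct.one_def, lift_single]
  simp

theorem lift_smul (B : RBimod.{u, v}) (α : S →+* B.R) (g : Y → B.M) (r : S)
    (m : FreeBimodule S Y) : lift B α g (r • m) = α r • lift B α g m := by
  induction m using induction with
  | zero => simp
  | add a b ha hb => simp only [smul_add, map_add, ha, hb]
  | tmul y s t =>
    rw [smul_def, smul_single, Algebra.TensorProduct.tmul_mul_tmul, one_mul, lift_single,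
      lift_single, map_mul, mul_smul]

theorem lift_op_smul (B : RBimod.{u, v}) (α : S →+* B.R) (g : Y → B.M) (r : S)
    (m : FreeBimodule S Y) :
    lift B α g (MulOpposite.op r • m) = MulOpposite.op (α r) • lift B α g m := by
  induction m using induction with
  | zero => simp
  | add a b ha hb => simp only [smul_add, map_add, ha, hb]
  | tmul y s t =>
    rw [op_smul_def, smul_single, Algebra.TensorProduct.tmul_mul_tmul, one_mul, lift_single,
      lift_single, MulOpposite.unop_mul, MulOpposite.unop_op, map_mul, MulOpposite.op_mul,
      mul_smul, smul_comm]

end FreeBimodule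

/-- The free `S`-bimodule on `Y` as an object of the category of bimodules. -/
abbrev freeOver (S : Type u) [Ring S] (Y : Type v) : RBimod.{u, max u v} where
  R := S
  M := FreeBimodule S Y

/-- The morphism `(S; (S ⊗ S^op)(Y)) ⟶ (R; M)` determined by `S → R` and `Y → M`. -/
def freeOverLift {S : Type u₁} [Ring S] {Y : Type v₁} (B : RBimod.{u, v}) (α : S →+* B.R)
    (g : Y → B.M) : Hom (freeOver S Y) B where
  onRing := α
  onMod := FreeBimodule.lift B α g
  map_smul := FreeBimodule.lift_smul B α g
  map_op_smul := FreeBimodule.lift_op_smul B α g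

theorem freeOver_hom_ext {S : Type u₁} [Ring S] {Y : Type v₁} {B : RBimod.{u, v}}
    {f g : Hom (freeOver S Y) B} (h₁ : f.onRing = g.onRing)
    (h₂ : ∀ y, f.onMod (FreeBimodule.of y) = g.onMod (FreeBimodule.of y)) : f = g := by
  refine Hom.ext' h₁ (AddMonoidHom.ext fun x => ?_)
  induction x using FreeBimodule.induction with
  | zero => rw [map_zero, map_zero]
  | add a b ha hb => rw [map_add, map_add, ha, hb]
  | tmul y s t =>
    have key : ∀ e : Hom (freeOver S Y) B, e.onMod (FreeBimodule.single y (s ⊗ₜ[ℤ] t)) =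
        e.onRing s • MulOpposite.op (e.onRing t.unop) • e.onMod (FreeBimodule.of y) := by
      intro e
      rw [FreeBimodule.single_tmul]
      exact (e.map_smul s _).trans (congrArg _ (e.map_op_smul t.unop _))
    rw [key, key, h₁, h₂]

/-- The free bimodule `F(X, Y)` on a pair of sets: the free ring `ℤ{X}` together with the free
`ℤ{X}`-bimodule on `Y`. -/
abbrev free (X : Type u) (Y : Type v) : RBimod.{u, max u v} := freeOver (FreeAlgebra ℤ X) Y

/-- The morphism `F(X, Y) ⟶ (R; M)` adjoint to a pair of maps of sets. -/
def freeLift {X : Type u₁} {Y : Type v₁} (B : RBimod.{u, v}) (a : X → B.R) (g : Y → B.M) :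
    Hom (free X Y) B :=
  freeOverLift B (FreeAlgebra.lift ℤ a).toRingHom g

theorem freeLift_ι {X : Type u₁} {Y : Type v₁} (B : RBimod.{u, v}) (a : X → B.R) (g : Y → B.M)
    (x : X) : (freeLift B a g).onRing (FreeAlgebra.ι ℤ x) = a x :=
  FreeAlgebra.lift_ι_apply a x

theorem freeLift_of {X : Type u₁} {Y : Type v₁} (B : RBimod.{u, v}) (a : X → B.R)
    (g : Y → B.M) (y : Y) : (freeLift B a g).onMod (FreeBimodule.of y) = g y :=
  FreeBimodule.lift_of B _ g y

theorem free_hom_ext {X : Type u₁} {Y : Type v₁} {B : RBimod.{u, v}} {f g : Hom (free X Y) B}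
    (h₁ : ∀ x, f.onRing (FreeAlgebra.ι ℤ x) = g.onRing (FreeAlgebra.ι ℤ x))
    (h₂ : ∀ y, f.onMod (FreeBimodule.of y) = g.onMod (FreeBimodule.of y)) : f = g := by
  refine freeOver_hom_ext ?_ h₂
  have : (f.onRing : FreeAlgebra ℤ X →+* B.R).toIntAlgHom =
      (g.onRing : FreeAlgebra ℤ X →+* B.R).toIntAlgHom := FreeAlgebra.hom_ext (funext h₁)
  exact RingHom.ext fun x => DFunLike.congr_fun this x

/-- The free bimodule `FU(R; M)` on the underlying pair of sets. -/
abbrev cover (B : RBimod.{u, v}) : RBimod.{u, max u v} := free B.R B.M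

/-- The counit `ε : FU(R; M) ⟶ (R; M)`. -/
def counit (B : RBimod.{u, v}) : Hom (cover B) B := freeLift B (fun r => r) (fun m => m)

/-- Functoriality of `FU`. -/
def coverMap {B : RBimod.{u, v}} {B' : RBimod.{u₁, v₁}} (f : Hom B B') :
    Hom (cover B) (cover B') :=
  freeLift (cover B') (fun r => FreeAlgebra.ι ℤ (f.onRing r))
    (fun m => FreeBimodule.of (f.onMod m))

theorem counit_comp_coverMap {B : RBimod.{u, v}} {B' : RBimod.{u₁, v₁}} (f : Hom B B') :
    (counit B').comp (coverMap f) = f.comp (counit B) := by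
  apply free_hom_ext
  · intro x
    exact (congrArg (counit B').onRing (freeLift_ι _ _ _ x)).trans
      ((freeLift_ι _ _ _ _).trans (congrArg f.onRing (freeLift_ι B (fun r => r) _ x)).symm)
  · intro y
    exact (congrArg (counit B').onMod (freeLift_of _ _ _ y)).trans
      ((freeLift_of _ _ _ _).trans (congrArg f.onMod (freeLift_of B _ (fun m => m) y)).symm)

theorem coverMap_comp {B : RBimod.{u, v}} {B' : RBimod.{u₁, v₁}} {B'' : RBimod.{u₂, v₂}}
    (g : Hom B' B'') (f : Hom B B') :
    coverMap (g.comp f) = (coverMap g).comp (coverMap f) := by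
  apply free_hom_ext
  · intro x
    exact (freeLift_ι _ _ _ x).trans (((congrArg (coverMap g).onRing
      (freeLift_ι (cover B') _ _ x)).trans (freeLift_ι (cover B'') _ _ _)).symm)
  · intro y
    exact (freeLift_of _ _ _ y).trans (((congrArg (coverMap g).onMod
      (freeLift_of (cover B') _ _ y)).trans (freeLift_of (cover B'') _ _ _)).symm)

/-! ### Tensor powers and cyclic tensor powers of a bimodule -/

/-- The subgroup of the tensor power over `ℤ` generated by the elements
`… ⊗ m_i r ⊗ … - … ⊗ r m_{i'} ⊗ …` for the pairs of positions `(i, i')` in a relation `adj`. -/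
def balanced (B : RBimod.{u, v}) (L : ℕ) (adj : Fin L → Fin L → Prop) :
    Submodule ℤ (TensorPower ℤ L B.M) :=
  Submodule.span ℤ {t | ∃ (m : Fin L → B.M) (i i' : Fin L) (r : B.R), adj i i' ∧
    t = tprod ℤ (Function.update m i (MulOpposite.op r • m i)) -
      tprod ℤ (Function.update m i' (r • m i'))}

/-- Consecutive positions on a line. -/
def lineAdj (L : ℕ) (i i' : Fin L) : Prop := (i' : ℕ) = i + 1

/-- Consecutive positions on a circle. -/
def circleAdj (L : ℕ) (i i' : Fin L) : Prop := (i' : ℕ) = (i + 1) % L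

/-- The tensor power `M ⊗_R ⋯ ⊗_R M` with `L ≥ 1` factors (underlying abelian group). -/
abbrev Tens (B : RBimod.{u, v}) (L : ℕ) : Type v :=
  TensorPower ℤ L B.M ⧸ balanced B L (lineAdj L)

/-- The cyclic tensor power `M^{⊗_R L} / [R, M^{⊗_R L}]` with `L ≥ 1` factors. -/
abbrev Cyc (B : RBimod.{u, v}) (L : ℕ) : Type v :=
  TensorPower ℤ L B.M ⧸ balanced B L (circleAdj L)

/-- The map induced by a morphism of bimodules on tensor powers over `ℤ`. -/
def tensZMap {B : RBimod.{u, v}} {B' : RBimod.{u₁, v₁}} (f : Hom B B') (L : ℕ) :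
    TensorPower ℤ L B.M →ₗ[ℤ] TensorPower ℤ L B'.M :=
  PiTensorProduct.map fun _ => f.onMod.toIntLinearMap

theorem balanced_le_comap {B : RBimod.{u, v}} {B' : RBimod.{u₁, v₁}} (f : Hom B B') (L : ℕ)
    (adj : Fin L → Fin L → Prop) :
    balanced B L adj ≤ (balanced B' L adj).comap (tensZMap f L) := by
  refine Submodule.span_le.2 ?_
  rintro _ ⟨m, i, i', r, h, rfl⟩
  refine Submodule.subset_span ⟨fun j => f.onMod (m j), i, i', f.onRing r, h, ?_⟩
  simp only [tensZMap, map_sub, PiTensorProduct.map_tprod]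
  congr 2 <;> funext j <;> simp only [Function.update_apply] <;> split_ifs <;>
    simp_all [f.map_smul, f.map_op_smul]

/-- Functoriality of tensor powers. -/
def Tens.map {B : RBimod.{u, v}} {B' : RBimod.{u₁, v₁}} (f : Hom B B') (L : ℕ) :
    Tens B L →ₗ[ℤ] Tens B' L :=
  Submodule.mapQ _ _ (tensZMap f L) (balanced_le_comap f L _)

/-- Functoriality of cyclic tensor powers. -/
def Cyc.map {B : RBimod.{u, v}} {B' : RBimod.{u₁, v₁}} (f : Hom B B') (L : ℕ) :
    Cyc B L →ₗ[ℤ] Cyc B' L :=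
  Submodule.mapQ _ _ (tensZMap f L) (balanced_le_comap f L _)

theorem tensZMap_comp {B : RBimod.{u, v}} {B' : RBimod.{u₁, v₁}} {B'' : RBimod.{u₂, v₂}}
    (g : Hom B' B'') (f : Hom B B') (L : ℕ) (x : TensorPower ℤ L B.M) :
    tensZMap (g.comp f) L x = tensZMap g L (tensZMap f L x) := by
  have : tensZMap (g.comp f) L = (tensZMap g L).comp (tensZMap f L) := by
    ext m
    simp [tensZMap, Hom.comp]
  rw [this]; rfl

theorem Tens.map_comp {B : RBimod.{u, v}} {B' : RBimod.{u₁, v₁}} {B'' : RBimod.{u₂, v₂}}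
    (g : Hom B' B'') (f : Hom B B') (L : ℕ) (x : Tens B L) :
    Tens.map (g.comp f) L x = Tens.map g L (Tens.map f L x) := by
  obtain ⟨x, rfl⟩ := Submodule.Quotient.mk_surjective _ x
  exact congrArg (Submodule.Quotient.mk) (tensZMap_comp g f L x)

/-- The permutation of the factors shifting all positions cyclically by `c`. -/
def rotZ (A : Type v) [AddCommGroup A] (L : ℕ) [NeZero L] (c : Fin L) :
    TensorPower ℤ L A ≃ₗ[ℤ] TensorPower ℤ L A :=
  reindex ℤ (fun _ => A) (Equiv.addRight c)

theorem circleAdj_add {L : ℕ} [NeZero L] {i i' : Fin L} (h : circleAdj L i i') (c : Fin L) :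
    circleAdj L (i + c) (i' + c) := by
  simp only [circleAdj, Fin.val_add] at *
  rw [h]
  simp only [Nat.mod_add_mod]
  congr 1
  omega

theorem balanced_le_comap_rotZ (B : RBimod.{u, v}) (L : ℕ) [NeZero L] (c : Fin L) :
    balanced B L (circleAdj L) ≤
      (balanced B L (circleAdj L)).comap (rotZ B.M L c).toLinearMap := by
  refine Submodule.span_le.2 ?_
  rintro _ ⟨m, i, i', r, h, rfl⟩
  refine Submodule.subset_span ⟨fun j => m (j - c), i + c, i' + c, r, circleAdj_add h c, ?_⟩
  simp only [rotZ, map_sub, LinearEquiv.coe_coe, reindex_tprod]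
  congr 2 <;> funext j <;>
    simp [Function.update_apply, sub_eq_iff_eq_add, ← sub_eq_add_neg]

/-- The action of the cyclic group `C_L = ℤ/L` on the cyclic tensor power. -/
def Cyc.rot (B : RBimod.{u, v}) (L : ℕ) [NeZero L] (c : Fin L) : Cyc B L →ₗ[ℤ] Cyc B L :=
  Submodule.mapQ _ _ (rotZ B.M L c).toLinearMap (balanced_le_comap_rotZ B L c)

/-- The tensor power `x^{⊗ N}` of an element of a tensor power. -/
def powZ (A : Type v) [AddCommGroup A] {L : ℕ} (x : TensorPower ℤ L A) :
    (N : ℕ) → TensorPower ℤ (N * L) A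
  | 0 => TensorPower.cast ℤ A (Nat.zero_mul L).symm (tprod ℤ Fin.elim0)
  | N + 1 => TensorPower.cast ℤ A (Nat.succ_mul N L).symm
      (TensorPower.mulEquiv (powZ A x N ⊗ₜ x))

theorem mulEquiv_tprod {A : Type v} [AddCommGroup A] {K L : ℕ} (a : Fin K → A)
    (b : Fin L → A) :
    TensorPower.mulEquiv (tprod ℤ a ⊗ₜ[ℤ] tprod ℤ b) = tprod ℤ (Fin.append a b) :=
  TensorPower.tprod_mul_tprod ℤ a b

theorem append_update_left {A : Type v} {K L : ℕ} (a : Fin K → A) (b : Fin L → A) (i : Fin K)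
    (x : A) : Fin.append (Function.update a i x) b =
      Function.update (Fin.append a b) (Fin.castAdd L i) x := by
  funext j
  refine Fin.addCases (fun j => ?_) (fun j => ?_) j
  · by_cases h : j = i
    · subst h; simp
    · rw [Fin.append_left, Function.update_of_ne h, Function.update_of_ne, Fin.append_left]
      exact fun h' => h (Fin.castAdd_injective _ _ h')
  · rw [Fin.append_right, Function.update_of_ne, Fin.append_right]
    intro h'
    have := congrArg Fin.val h'
    simp at this
    omega

theorem append_update_right {A : Type v} {K L : ℕ} (a : Fin K → A) (b : Fin L → A) (i : Fin L)
    (x : A) : Fin.append a (Function.update b i x) =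
      Function.update (Fin.append a b) (Fin.natAdd K i) x := by
  funext j
  refine Fin.addCases (fun j => ?_) (fun j => ?_) j
  · rw [Fin.append_left, Function.update_of_ne, Fin.append_left]
    intro h'
    have := congrArg Fin.val h'
    simp at this
    omega
  · by_cases h : j = i
    · subst h; simp
    · rw [Fin.append_right, Function.update_of_ne h, Function.update_of_ne, Fin.append_right]
      exact fun h' => h (Fin.natAdd_injective _ _ h')

theorem mul_mem_left (B : RBimod.{u, v}) {K L : ℕ} {x : TensorPower ℤ K B.M}
    (hx : x ∈ balanced B K (lineAdj K)) (y : TensorPower ℤ L B.M) :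
    TensorPower.mulEquiv (x ⊗ₜ[ℤ] y) ∈ balanced B (K + L) (lineAdj (K + L)) := by
  induction hx using Submodule.span_induction with
  | zero => rw [TensorProduct.zero_tmul, map_zero]; exact Submodule.zero_mem _
  | add a b _ _ ha hb => rw [TensorProduct.add_tmul, map_add]; exact Submodule.add_mem _ ha hb
  | smul c a _ ha =>
    rw [← TensorProduct.smul_tmul', map_smul]; exact Submodule.smul_mem _ c ha
  | mem a ha =>
    obtain ⟨m, i, i', r, h, rfl⟩ := ha
    induction y using PiTensorProduct.induction_on with
    | add a b ha hb => rw [TensorProduct.tmul_add, map_add]; exact Submodule.add_mem _ ha hb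
    | smul_tprod c b =>
      rw [TensorProduct.tmul_smul, map_smul]
      refine Submodule.smul_mem _ c (Submodule.subset_span
        ⟨Fin.append m b, Fin.castAdd L i, Fin.castAdd L i', r, ?_, ?_⟩)
      · simpa [lineAdj] using h
      · rw [TensorProduct.sub_tmul, map_sub, mulEquiv_tprod, mulEquiv_tprod,
          append_update_left, append_update_left, Fin.append_left, Fin.append_left]

theorem mul_mem_right (B : RBimod.{u, v}) {K L : ℕ} (x : TensorPower ℤ K B.M)
    {y : TensorPower ℤ L B.M} (hy : y ∈ balanced B L (lineAdj L)) :
    TensorPower.mulEquiv (x ⊗ₜ[ℤ] y) ∈ balanced B (K + L) (lineAdj (K + L)) := by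
  induction hy using Submodule.span_induction with
  | zero => rw [TensorProduct.tmul_zero, map_zero]; exact Submodule.zero_mem _
  | add a b _ _ ha hb => rw [TensorProduct.tmul_add, map_add]; exact Submodule.add_mem _ ha hb
  | smul c a _ ha => rw [TensorProduct.tmul_smul, map_smul]; exact Submodule.smul_mem _ c ha
  | mem a ha =>
    obtain ⟨m, i, i', r, h, rfl⟩ := ha
    induction x using PiTensorProduct.induction_on with
    | add a b ha hb => rw [TensorProduct.add_tmul, map_add]; exact Submodule.add_mem _ ha hb
    | smul_tprod c b =>
      rw [← TensorProduct.smul_tmul', map_smul]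
      refine Submodule.smul_mem _ c (Submodule.subset_span
        ⟨Fin.append b m, Fin.natAdd K i, Fin.natAdd K i', r, ?_, ?_⟩)
      · simp only [lineAdj, Fin.val_natAdd] at h ⊢; omega
      · rw [TensorProduct.tmul_sub, map_sub, mulEquiv_tprod, mulEquiv_tprod,
          append_update_right, append_update_right, Fin.append_right, Fin.append_right]

theorem cast_mem (B : RBimod.{u, v}) {K L : ℕ} (h : K = L) {x : TensorPower ℤ K B.M}
    (hx : x ∈ balanced B K (lineAdj K)) :
    TensorPower.cast ℤ B.M h x ∈ balanced B L (lineAdj L) := by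
  subst h
  simpa using hx

theorem powZ_sub_mem (B : RBimod.{u, v}) {L : ℕ} {x x' : TensorPower ℤ L B.M}
    (h : x - x' ∈ balanced B L (lineAdj L)) (N : ℕ) :
    powZ B.M x N - powZ B.M x' N ∈ balanced B (N * L) (lineAdj (N * L)) := by
  induction N with
  | zero => simp [powZ]
  | succ N ih =>
    rw [powZ, powZ, ← map_sub]
    refine cast_mem B _ ?_
    rw [← map_sub]
    have : powZ B.M x N ⊗ₜ[ℤ] x - powZ B.M x' N ⊗ₜ[ℤ] x' =
        (powZ B.M x N - powZ B.M x' N) ⊗ₜ[ℤ] x + powZ B.M x' N ⊗ₜ[ℤ] (x - x') := by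
      rw [TensorProduct.sub_tmul, TensorProduct.tmul_sub]; abel
    rw [this, map_add]
    exact Submodule.add_mem _ (mul_mem_left B ih x) (mul_mem_right B _ h)

theorem line_le_circle (B : RBimod.{u, v}) (L : ℕ) :
    balanced B L (lineAdj L) ≤ balanced B L (circleAdj L) := by
  refine Submodule.span_mono ?_
  rintro _ ⟨m, i, i', r, h, rfl⟩
  refine ⟨m, i, i', r, ?_, rfl⟩
  simp only [lineAdj, circleAdj] at h ⊢
  rw [Nat.mod_eq_of_lt (by omega), h]

/-- The map `x ↦ x^{⊗ N}` from the tensor power with `L` factors to the cyclic tensor power with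
`L' = N L` factors. -/
def cycPow (B : RBimod.{u, v}) {L : ℕ} (N : ℕ) {L' : ℕ} (h : N * L = L') :
    Tens B L → Cyc B L' :=
  Quotient.lift
    (fun x : TensorPower ℤ L B.M =>
      (Submodule.Quotient.mk (TensorPower.cast ℤ B.M h (powZ B.M x N)) : Cyc B L'))
    (fun x x' hx => by
      refine (Submodule.Quotient.eq _).2 ?_
      rw [← map_sub]
      exact line_le_circle B L' (cast_mem B h
        (powZ_sub_mem B ((Submodule.quotientRel_def _).1 hx) N)))

/-! ### Ghost maps and Witt vectors with coefficients -/

section Ghost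

variable (p n : ℕ)

/-- The product `∏_{i < n} M^{⊗_R p^i}`. -/
abbrev Coords (B : RBimod.{u, v}) : Type v := (i : Fin n) → Tens B (p ^ (i : ℕ))

/-- Functoriality of `∏_{i < n} M^{⊗_R p^i}`. -/
def Coords.map {B : RBimod.{u, v}} {B' : RBimod.{u₁, v₁}} (f : Hom B B') (a : Coords p n B) :
    Coords p n B' :=
  fun i => Tens.map f _ (a i)

theorem Coords.map_comp {B : RBimod.{u, v}} {B' : RBimod.{u₁, v₁}} {B'' : RBimod.{u₂, v₂}}
    (g : Hom B' B'') (f : Hom B B') (a : Coords p n B) :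
    Coords.map p n (g.comp f) a = Coords.map p n g (Coords.map p n f a) :=
  funext fun _ => Tens.map_comp g f _ _

variable [Fact p.Prime]

/-- The ghost map
`w_j(a) = ∑_{i ≤ j} tr_{C_{p^{j-i}}}^{C_{p^j}} (a_i^{⊗ p^{j-i}})`. The subgroup `C_{p^{j-i}}` of
`C_{p^j} = ℤ/p^j` is generated by `p^i`, so `0, 1, …, p^i - 1` represent its cosets. -/
def ghost {B : RBimod.{u, v}} (a : Coords p n B) (j : ℕ) : Cyc B (p ^ j) :=
  ∑ i : Fin n, if h : (i : ℕ) ≤ j then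
    ∑ s ∈ Finset.range (p ^ (i : ℕ)), Cyc.rot B (p ^ j) (Fin.ofNat (p ^ j) s)
      (cycPow B (p ^ (j - i)) (by rw [← pow_add, Nat.sub_add_cancel h]) (a i))
  else 0

/-- The generating relation on `∏_{i < n} M^{⊗_R p^i}`, formed with the canonical free resolution
`FUFU(R; M) ⇉ FU(R; M) ⟶ (R; M)`. -/
def Rel (B : RBimod.{u, v}) (a b : Coords p n B) : Prop :=
  ∃ (q u : Coords p n (cover B)) (z : Coords p n (cover (cover B))),
    Coords.map p n (counit B) q = a ∧ Coords.map p n (counit B) u = b ∧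
    ∀ j < n, ghost p n q j = ghost p n (Coords.map p n (counit (cover B)) z) j ∧
      ghost p n u j = ghost p n (Coords.map p n (coverMap (counit B)) z) j

/-- The set of `p`-typical `n`-truncated Witt vectors `W_{n,p}(R; M)`: the quotient of
`∏_{i < n} M^{⊗_R p^i}` by the equivalence relation generated by `Rel`. -/
def Witt (B : RBimod.{u, v}) : Type v := Quot (Rel p n B)

/-- The class of a sequence. -/
def Witt.mk {B : RBimod.{u, v}} (a : Coords p n B) : Witt p n B := Quot.mk _ a

theorem tensZMap_cast {B : RBimod.{u, v}} {B' : RBimod.{u₁, v₁}} (f : Hom B B') {K L : ℕ}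
    (h : K = L) (x : TensorPower ℤ K B.M) :
    tensZMap f L (TensorPower.cast ℤ B.M h x) =
      TensorPower.cast ℤ B'.M h (tensZMap f K x) := by
  subst h
  simp

theorem tensZMap_mul {B : RBimod.{u, v}} {B' : RBimod.{u₁, v₁}} (f : Hom B B') {K L : ℕ}
    (x : TensorPower ℤ K B.M) (y : TensorPower ℤ L B.M) :
    tensZMap f (K + L) (TensorPower.mulEquiv (x ⊗ₜ[ℤ] y)) =
      TensorPower.mulEquiv (tensZMap f K x ⊗ₜ[ℤ] tensZMap f L y) := by
  induction x using PiTensorProduct.induction_on with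
  | add a b ha hb => simp only [TensorProduct.add_tmul, map_add, ha, hb]
  | smul_tprod c a =>
    induction y using PiTensorProduct.induction_on with
    | add a b ha hb => simp only [TensorProduct.tmul_add, map_add, ha, hb]
    | smul_tprod d b =>
      simp only [TensorProduct.tmul_smul, ← TensorProduct.smul_tmul', map_smul, mulEquiv_tprod]
      congr 2
      simp only [tensZMap, PiTensorProduct.map_tprod, mulEquiv_tprod]
      congr 1
      funext j
      refine Fin.addCases (fun j => ?_) (fun j => ?_) j <;> simp

theorem tensZMap_powZ {B : RBimod.{u, v}} {B' : RBimod.{u₁, v₁}} (f : Hom B B') {L : ℕ}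
    (x : TensorPower ℤ L B.M) (N : ℕ) :
    tensZMap f (N * L) (powZ B.M x N) = powZ B'.M (tensZMap f L x) N := by
  induction N with
  | zero =>
    rw [powZ, powZ, tensZMap_cast, tensZMap, PiTensorProduct.map_tprod]
    congr 2
    funext j
    exact j.elim0
  | succ N ih => rw [powZ, powZ, tensZMap_cast, tensZMap_mul, ih]

theorem cycMap_cycPow {B : RBimod.{u, v}} {B' : RBimod.{u₁, v₁}} (f : Hom B B') {L : ℕ} (N : ℕ)
    {L' : ℕ} (h : N * L = L') (x : Tens B L) :
    Cyc.map f L' (cycPow B N h x) = cycPow B' N h (Tens.map f L x) := by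
  obtain ⟨x, rfl⟩ := Submodule.Quotient.mk_surjective _ x
  refine congrArg Submodule.Quotient.mk ?_
  rw [tensZMap_cast, tensZMap_powZ]

theorem cycMap_rot {B : RBimod.{u, v}} {B' : RBimod.{u₁, v₁}} (f : Hom B B') (L : ℕ) [NeZero L]
    (c : Fin L) (x : Cyc B L) :
    Cyc.map f L (Cyc.rot B L c x) = Cyc.rot B' L c (Cyc.map f L x) := by
  obtain ⟨x, rfl⟩ := Submodule.Quotient.mk_surjective _ x
  exact congrArg Submodule.Quotient.mk
    (PiTensorProduct.map_reindex (fun _ => f.onMod.toIntLinearMap) (Equiv.addRight c) x)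

theorem ghost_map {B : RBimod.{u, v}} {B' : RBimod.{u₁, v₁}} (f : Hom B B') (a : Coords p n B)
    (j : ℕ) : ghost p n (Coords.map p n f a) j = Cyc.map f _ (ghost p n a j) := by
  simp only [ghost, map_sum]
  refine Finset.sum_congr rfl fun i _ => ?_
  split_ifs
  · rw [map_sum]
    refine Finset.sum_congr rfl fun s _ => ?_
    rw [cycMap_rot, cycMap_cycPow]
    rfl
  · rw [map_zero]

theorem Rel.map {B : RBimod.{u, v}} {B' : RBimod.{u₁, v₁}} (f : Hom B B') {a b : Coords p n B}
    (h : Rel p n B a b) : Rel p n B' (Coords.map p n f a) (Coords.map p n f b) := by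
  obtain ⟨q, u, z, rfl, rfl, hz⟩ := h
  refine ⟨Coords.map p n (coverMap f) q, Coords.map p n (coverMap f) u,
    Coords.map p n (coverMap (coverMap f)) z, ?_, ?_, fun j hj => ⟨?_, ?_⟩⟩
  · rw [← Coords.map_comp, ← Coords.map_comp, counit_comp_coverMap]
  · rw [← Coords.map_comp, ← Coords.map_comp, counit_comp_coverMap]
  · rw [← Coords.map_comp, counit_comp_coverMap, Coords.map_comp, ghost_map, ghost_map,
      (hz j hj).1]
  · rw [← Coords.map_comp, ← coverMap_comp, counit_comp_coverMap, coverMap_comp,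
      Coords.map_comp, ghost_map, ghost_map, (hz j hj).2]

/-- Functoriality of `W_{n,p}`. -/
def Witt.map {B : RBimod.{u, v}} {B' : RBimod.{u₁, v₁}} (f : Hom B B') :
    Witt p n B → Witt p n B' :=
  Quot.map (Coords.map p n f) fun _ _ => Rel.map p n f

/-- The graph of the addition of `W_{n,p}(R; M)`. The addition is the one that is natural in
`(R; M)` and makes the ghost maps additive; as these are injective over free bimodules, a sum is
computed by lifting both summands to `FU(R; M)` and adding their ghost components. -/
def Witt.IsSum {B : RBimod.{u, v}} (x y z : Witt p n B) : Prop :=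
  ∃ a b c : Coords p n (cover B),
    Witt.mk p n (Coords.map p n (counit B) a) = x ∧
    Witt.mk p n (Coords.map p n (counit B) b) = y ∧
    Witt.mk p n (Coords.map p n (counit B) c) = z ∧
    ∀ j < n, ghost p n c j = ghost p n a j + ghost p n b j

/-! ### The case of modules over a commutative ring -/

/-- The free module on the set `M` over the polynomial ring `ℤ[R]` on the set `R`. -/
abbrev commCover (R : Type u) (M : Type v) : RBimod.{u, max u v} :=
  ofModule (MvPolynomial R ℤ) (M →₀ MvPolynomial R ℤ)

/-- The canonical map from the commutative free cover to `(R; M)`. -/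
def commCounit (R : Type u) (M : Type v) [CommRing R] [AddCommGroup M] [Module R M] :
    Hom (commCover R M) (ofModule R M) :=
  letI ε : MvPolynomial R ℤ →+* R := (MvPolynomial.aeval fun r : R => r).toRingHom
  letI e : (M →₀ MvPolynomial R ℤ) →+ M :=
    Finsupp.liftAddHom fun m => ((smulAddHom R M).flip m).comp ε.toAddMonoidHom
  have he : ∀ (t : MvPolynomial R ℤ) (x : M →₀ MvPolynomial R ℤ), e (t • x) = ε t • e x := by
    intro t x
    induction x using Finsupp.induction_linear with
    | zero => simp
    | add a b ha hb => simp only [smul_add, map_add, ha, hb]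
    | single m c =>
      rw [Finsupp.smul_single, smul_eq_mul]
      simp only [e, Finsupp.liftAddHom_apply_single, AddMonoidHom.comp_apply]
      exact (congrArg (fun c : R => c • m) (map_mul ε t c)).trans (mul_smul _ _ _)
  { onRing := ε
    onMod := e
    map_smul := he
    map_op_smul := he }

theorem tprod_balanced (R : Type u) (M : Type v) [CommRing R] [AddCommGroup M] [Module R M]
    {L : ℕ} (m : Fin L → M) (i i' : Fin L) (r : R) :
    PiTensorProduct.lift ((tprod R (s := fun _ : Fin L => M)).restrictScalars ℤ)
      (tprod ℤ (Function.update m i (r • m i)) -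
        tprod ℤ (Function.update m i' (r • m i'))) = 0 := by
  rw [map_sub, PiTensorProduct.lift.tprod, PiTensorProduct.lift.tprod, sub_eq_zero,
    MultilinearMap.coe_restrictScalars, MultilinearMap.map_update_smul,
    MultilinearMap.map_update_smul, Function.update_eq_self, Function.update_eq_self]

/-- For a module over a commutative ring, the canonical isomorphism from the cyclic tensor power
to the tensor power over the ring. -/
def Cyc.toTensorPower (R : Type u) (M : Type v) [CommRing R] [AddCommGroup M] [Module R M]
    (L : ℕ) : Cyc (ofModule R M) L →+ TensorPower R L M :=
  (Submodule.liftQ (balanced (ofModule R M) L (circleAdj L))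
    (PiTensorProduct.lift ((tprod R (s := fun _ : Fin L => M)).restrictScalars ℤ))
    (Submodule.span_le.2 (by
      rintro _ ⟨m, i, i', r, h, rfl⟩
      exact tprod_balanced R M m i i' r))).toAddMonoidHom

/-- The graph of the scalar multiplication of the ring `W_n(R)` of truncated Witt vectors on
`W_{n,p}(R; M)`, for a module `M` over a commutative ring `R`. It is natural in `(R; M)`, and the
ghost map `w_j` of `W_{n,p}(R; M)` is linear over the ghost map `w_j : W_n(R) → R`; so `a • x` is
computed by lifting `a` and `x` to the commutative free cover of `(R; M)` and multiplying their
ghost components. -/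
def Witt.IsSMul {R : Type u} {M : Type v} [CommRing R] [AddCommGroup M] [Module R M]
    (a : TruncatedWittVector p n R) (x y : Witt p n (ofModule R M)) : Prop :=
  ∃ (t : Fin n → MvPolynomial R ℤ) (b c : Coords p n (commCover R M)),
    (∀ i, MvPolynomial.aeval (fun r : R => r) (t i) = a.coeff i) ∧
    Witt.mk p n (Coords.map p n (commCounit R M) b) = x ∧
    Witt.mk p n (Coords.map p n (commCounit R M) c) = y ∧
    ∀ j < n, Cyc.toTensorPower (MvPolynomial R ℤ) (M →₀ MvPolynomial R ℤ) _ (ghost p n c j) =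
      (∑ i : Fin n, if (i : ℕ) ≤ j then (p : MvPolynomial R ℤ) ^ (i : ℕ) * t i ^ p ^ (j - i)
        else 0) •
      Cyc.toTensorPower (MvPolynomial R ℤ) (M →₀ MvPolynomial R ℤ) _ (ghost p n b j)

end Ghost

end RBimod

end

/-! ### The functor `Q_{p^n}` over a commutative ring -/

noncomputable section

universe u v w

section Transfer

variable {Λ : Type u} [CommRing Λ] {E : Type v} [AddCommGroup E] [Module Λ E]
  {E' : Type w} [AddCommGroup E'] [Module Λ E']

/-- The action of `c ∈ C_L = ℤ/L` on `E^{⊗_Λ L}` by cyclic permutation of the factors. -/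
def cycRot (Λ : Type u) [CommRing Λ] (E : Type v) [AddCommGroup E] [Module Λ E] (L : ℕ)
    [NeZero L] (c : Fin L) : TensorPower Λ L E ≃ₗ[Λ] TensorPower Λ L E :=
  reindex Λ (fun _ => E) (Equiv.addRight c)

/-- The invariants of `C_L` in `E^{⊗_Λ L}`. -/
def cycInv (Λ : Type u) [CommRing Λ] (E : Type v) [AddCommGroup E] [Module Λ E] (L : ℕ)
    [NeZero L] : Submodule Λ (TensorPower Λ L E) where
  carrier := {x | ∀ c, cycRot Λ E L c x = x}
  add_mem' hx hy c := by rw [map_add, hx c, hy c]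
  zero_mem' c := map_zero _
  smul_mem' r x hx c := by rw [map_smul, hx c]

/-- The transfer `∑_{c ∈ C_L} c`. -/
def cycTransfer (Λ : Type u) [CommRing Λ] (E : Type v) [AddCommGroup E] [Module Λ E] (L : ℕ)
    [NeZero L] : TensorPower Λ L E →ₗ[Λ] TensorPower Λ L E :=
  ∑ c : Fin L, (cycRot Λ E L c).toLinearMap

variable {L : ℕ} [NeZero L]

theorem cycTransfer_apply (x : TensorPower Λ L E) :
    cycTransfer Λ E L x = ∑ c, cycRot Λ E L c x := by
  simp [cycTransfer]

theorem cycRot_add (c d : Fin L) (x : TensorPower Λ L E) :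
    cycRot Λ E L c (cycRot Λ E L d x) = cycRot Λ E L (c + d) x := by
  refine (reindex_reindex (s := fun _ : Fin L => E) (Equiv.addRight d) (Equiv.addRight c)
    x).trans ?_
  have : (Equiv.addRight d).trans (Equiv.addRight c) = Equiv.addRight (c + d) := by
    ext i
    simp [add_assoc, add_comm c d]
  rw [this]
  rfl

theorem cycTransfer_mem_cycInv (x : TensorPower Λ L E) :
    cycTransfer Λ E L x ∈ cycInv Λ E L := by
  intro c
  rw [cycTransfer_apply, map_sum]
  simp only [cycRot_add]
  exact Fintype.sum_equiv (Equiv.addLeft c) _ _ fun _ => rfl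

variable (Λ E L) in
/-- The cokernel of the transfer `(E^{⊗ L})_{C_L} → (E^{⊗ L})^{C_L}`. -/
abbrev CycQ : Type _ :=
  cycInv Λ E L ⧸ (LinearMap.range (cycTransfer Λ E L)).comap (cycInv Λ E L).subtype

/-- The `L`-th tensor power of a linear map. -/
def tensPowMap (L : ℕ) (f : E →ₗ[Λ] E') : TensorPower Λ L E →ₗ[Λ] TensorPower Λ L E' :=
  PiTensorProduct.map fun _ => f

theorem tensPowMap_cycRot (f : E →ₗ[Λ] E') (c : Fin L) (x : TensorPower Λ L E) :
    tensPowMap L f (cycRot Λ E L c x) = cycRot Λ E' L c (tensPowMap L f x) :=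
  PiTensorProduct.map_reindex (fun _ => f) (Equiv.addRight c) x

theorem tensPowMap_mem (f : E →ₗ[Λ] E') {x : TensorPower Λ L E} (hx : x ∈ cycInv Λ E L) :
    tensPowMap L f x ∈ cycInv Λ E' L := fun c => by
  rw [← tensPowMap_cycRot, hx c]

theorem tensPowMap_cycTransfer (f : E →ₗ[Λ] E') (x : TensorPower Λ L E) :
    tensPowMap L f (cycTransfer Λ E L x) = cycTransfer Λ E' L (tensPowMap L f x) := by
  simp only [cycTransfer_apply, map_sum, tensPowMap_cycRot]

variable (L) in
/-- Functoriality of the cokernel of the transfer. -/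
def CycQ.map (f : E →ₗ[Λ] E') : CycQ Λ E L →ₗ[Λ] CycQ Λ E' L :=
  Submodule.mapQ _ _ ((tensPowMap L f).restrict fun _ hx => tensPowMap_mem f hx) (by
    rintro ⟨x, hx⟩ ⟨y, hy⟩
    exact ⟨tensPowMap L f y, by rw [← tensPowMap_cycTransfer, hy]; rfl⟩)

theorem CycQ.map_id (x : CycQ Λ E L) : CycQ.map L (LinearMap.id : E →ₗ[Λ] E) x = x := by
  obtain ⟨x, rfl⟩ := Submodule.Quotient.mk_surjective _ x
  refine congrArg Submodule.Quotient.mk (Subtype.ext ?_)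
  change tensPowMap L LinearMap.id (x : TensorPower Λ L E) = x
  rw [tensPowMap, PiTensorProduct.map_id, LinearMap.id_apply]

theorem CycQ.map_comp {E'' : Type*} [AddCommGroup E''] [Module Λ E''] (g : E' →ₗ[Λ] E'')
    (f : E →ₗ[Λ] E') (x : CycQ Λ E L) :
    CycQ.map L (g.comp f) x = CycQ.map L g (CycQ.map L f x) := by
  obtain ⟨x, rfl⟩ := Submodule.Quotient.mk_surjective _ x
  refine congrArg Submodule.Quotient.mk (Subtype.ext ?_)
  change tensPowMap L (g.comp f) (x : TensorPower Λ L E) =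
    tensPowMap L g (tensPowMap L f (x : TensorPower Λ L E))
  rw [tensPowMap, PiTensorProduct.map_comp]
  rfl

theorem CycQ.torsion (x : CycQ Λ E L) : (L : Λ) • x = 0 := by
  obtain ⟨⟨x, hx⟩, rfl⟩ := Submodule.Quotient.mk_surjective _ x
  refine (Submodule.Quotient.mk_eq_zero _).2 ⟨x, ?_⟩
  rw [cycTransfer_apply, Finset.sum_congr rfl fun c _ => hx c]
  simp [Nat.cast_smul_eq_nsmul]

/-- Let the finite group `ℤ/L` act on a finite set. A sum of the values of an equivariant function,
weighted by the orders of the stabilisers, is a transfer. -/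
theorem exists_transfer {X : Type*} [Fintype X] [DecidableEq X] [AddAction (Fin L) X]
    (T : Finset X) (hT : ∀ (c : Fin L) (x : X), x ∈ T → c +ᵥ x ∈ T)
    (G : X → TensorPower Λ L E) (hG : ∀ (c : Fin L) (x : X), G (c +ᵥ x) = cycRot Λ E L c (G x)) :
    ∑ x ∈ T, (Finset.univ.filter fun c : Fin L => c +ᵥ x = x).card • G x ∈
      LinearMap.range (cycTransfer Λ E L) := by
  classical
  let r : X → X := fun x => (Quotient.mk (AddAction.orbitRel (Fin L) X) x).out
  have hr : ∀ x, ∃ c : Fin L, c +ᵥ r x = x := by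
    intro x
    exact (Quotient.exact (Quotient.out_eq
      (Quotient.mk (AddAction.orbitRel (Fin L) X) x)).symm :
        AddAction.orbitRel (Fin L) X x (r x))
  have hr' : ∀ (c : Fin L) x, r (c +ᵥ x) = r x := by
    intro c x
    exact congrArg Quotient.out (Quotient.sound (s := AddAction.orbitRel (Fin L) X) ⟨c, rfl⟩)
  have hrr : ∀ x, r (r x) = r x := by
    intro x
    obtain ⟨c, hc⟩ := hr x
    conv_rhs => rw [← hc]
    rw [hr']
  have hrT : ∀ x ∈ T, r x ∈ T := by
    intro x hx
    obtain ⟨c, hc⟩ := hr x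
    have := hT (-c) x hx
    rwa [← hc, neg_vadd_vadd] at this
  have hcard : ∀ x, (Finset.univ.filter fun c : Fin L => c +ᵥ x = x).card =
      (Finset.univ.filter fun c : Fin L => c +ᵥ r x = x).card := by
    intro x
    obtain ⟨d, hd⟩ := hr x
    refine Finset.card_bij (fun c _ => c + d) ?_ (fun _ _ _ _ h => add_right_cancel h) ?_
    · intro c hc
      simp only [Finset.mem_filter, Finset.mem_univ, true_and] at hc ⊢
      rw [add_vadd, hd, hc]
    · intro c hc
      simp only [Finset.mem_filter, Finset.mem_univ, true_and] at hc
      refine ⟨c - d, ?_, sub_add_cancel c d⟩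
      simp only [Finset.mem_filter, Finset.mem_univ, true_and]
      conv_lhs => rw [← hd, ← add_vadd, sub_add_cancel, hc]
  refine ⟨∑ x ∈ T.filter (fun x => r x = x), G x, ?_⟩
  rw [map_sum]
  simp only [cycTransfer_apply, ← hG]
  rw [← Finset.sum_product']
  have : ∀ x ∈ T, (Finset.univ.filter fun c : Fin L => c +ᵥ x = x).card • G x =
      ∑ c ∈ Finset.univ.filter fun c : Fin L => c +ᵥ r x = x, G (c +ᵥ r x) := by
    intro x _
    rw [hcard, Finset.sum_congr rfl (g := fun _ => G x), Finset.sum_const]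
    intro c hc
    rw [(Finset.mem_filter.1 hc).2]
  rw [Finset.sum_congr rfl this, Finset.sum_sigma']
  refine Finset.sum_bij' (fun a _ => ⟨a.2 +ᵥ a.1, a.2⟩) (fun b _ => (r b.1, b.2)) ?_ ?_ ?_ ?_ ?_
  · rintro ⟨x, c⟩ h
    simp only [Finset.mem_product, Finset.mem_filter, Finset.mem_univ, and_true] at h
    simp only [Finset.mem_sigma, Finset.mem_filter, Finset.mem_univ, true_and]
    exact ⟨hT c x h.1, by rw [hr', h.2]⟩
  · rintro ⟨x, c⟩ h
    simp only [Finset.mem_sigma, Finset.mem_filter, Finset.mem_univ, true_and] at h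
    simp only [Finset.mem_product, Finset.mem_filter, Finset.mem_univ, and_true]
    exact ⟨hrT x h.1, hrr x⟩
  · rintro ⟨x, c⟩ h
    simp only [Finset.mem_product, Finset.mem_filter, Finset.mem_univ, and_true] at h
    simp only [hr', h.2]
  · rintro ⟨x, c⟩ h
    simp only [Finset.mem_sigma, Finset.mem_filter, Finset.mem_univ, true_and] at h
    simp only [h.2]
  · rintro ⟨x, c⟩ h
    simp only [Finset.mem_product, Finset.mem_filter, Finset.mem_univ, and_true] at h
    simp only [hr', h.2]

open scoped Pointwise in
/-- Two linear maps that are congruent modulo `p` agree on the cokernel of the transfer. -/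
theorem CycQ.map_congr (p n : ℕ) [Fact p.Prime] {f g h : E →ₗ[Λ] E'}
    (hf : f = (p : Λ) • h + g) (x : CycQ Λ E (p ^ n)) :
    CycQ.map (p ^ n) f x = CycQ.map (p ^ n) g x := by
  classical
  obtain ⟨⟨x, hx⟩, rfl⟩ := Submodule.Quotient.mk_surjective _ x
  refine (Submodule.Quotient.eq _).2 ?_
  change tensPowMap (p ^ n) f x - tensPowMap (p ^ n) g x ∈
    LinearMap.range (cycTransfer Λ E' (p ^ n))
  let φ : Finset (Fin (p ^ n)) → TensorPower Λ (p ^ n) E →ₗ[Λ] TensorPower Λ (p ^ n) E' :=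
    fun s => PiTensorProduct.map (s.piecewise (fun _ => h) (fun _ => g))
  have hφ : ∀ (c : Fin (p ^ n)) (s : Finset (Fin (p ^ n))),
      φ (c +ᵥ s) x = cycRot Λ E' (p ^ n) c (φ s x) := by
    intro c s
    have := PiTensorProduct.map_reindex (s.piecewise (fun _ => h) (fun _ => g))
      (Equiv.addRight c) x
    refine Eq.trans ?_ this
    change _ = PiTensorProduct.map _ (cycRot Λ E (p ^ n) c x)
    rw [hx c]
    simp only [φ]
    congr 2
    funext i
    have hi : i ∈ c +ᵥ s ↔ (Equiv.addRight c).symm i ∈ s := by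
      rw [← Finset.neg_vadd_mem_iff]
      simp [vadd_eq_add, add_comm]
    by_cases hs : (Equiv.addRight c).symm i ∈ s
    · rw [Finset.piecewise_eq_of_mem _ _ _ (hi.2 hs), Finset.piecewise_eq_of_mem _ _ _ hs]
    · rw [Finset.piecewise_eq_of_notMem _ _ _ (fun h => hs (hi.1 h)),
        Finset.piecewise_eq_of_notMem _ _ _ hs]
  have hexp : tensPowMap (p ^ n) f x = ∑ s, p ^ s.card • φ s x := by
    have h₁ := MultilinearMap.map_add_univ
      (PiTensorProduct.mapMultilinear Λ (fun _ : Fin (p ^ n) => E) (fun _ => E'))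
      (fun _ => (p : Λ) • h) (fun _ => g)
    have h₂ : tensPowMap (p ^ n) f = ∑ s, p ^ s.card • φ s := by
      rw [hf]
      refine h₁.trans (Finset.sum_congr rfl fun s _ => ?_)
      have h₃ := MultilinearMap.map_piecewise_smul
        (PiTensorProduct.mapMultilinear Λ (fun _ : Fin (p ^ n) => E) (fun _ => E'))
        (fun _ => (p : Λ)) (s.piecewise (fun _ => h) (fun _ => g)) s
      rw [Finset.prod_const, ← Nat.cast_pow, Nat.cast_smul_eq_nsmul] at h₃
      refine Eq.trans ?_ h₃
      congr 1
      funext i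
      by_cases hi : i ∈ s <;> simp [hi]
    rw [h₂, LinearMap.sum_apply]
    rfl
  have hempty : tensPowMap (p ^ n) g x = p ^ (∅ : Finset (Fin (p ^ n))).card • φ ∅ x := by
    simp [φ, tensPowMap]
  rw [hexp, hempty, ← Finset.sum_erase_eq_sub (Finset.mem_univ _)]
  have hdvd : ∀ s : Finset (Fin (p ^ n)), s ≠ ∅ →
      (Finset.univ.filter fun c : Fin (p ^ n) => c +ᵥ s = s).card ∣ p ^ s.card := by
    intro s hs
    have h₁ : (Finset.univ.filter fun c : Fin (p ^ n) => c +ᵥ s = s).card =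
        Nat.card (AddAction.stabilizer (Fin (p ^ n)) s) := by
      exact (Nat.subtype_card _ fun c => by
        simp [AddAction.mem_stabilizer_iff]).symm
    have h₂ : Nat.card (AddAction.stabilizer (Fin (p ^ n)) s) ∣ p ^ n := by
      simpa using AddSubgroup.card_addSubgroup_dvd_card (AddAction.stabilizer (Fin (p ^ n)) s)
    obtain ⟨l, -, hl⟩ := (Nat.dvd_prime_pow Fact.out).1 h₂
    obtain ⟨a, ha⟩ := Finset.nonempty_iff_ne_empty.2 hs
    have h₃ : (Finset.univ.filter fun c : Fin (p ^ n) => c +ᵥ s = s).card ≤ s.card := by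
      refine Finset.card_le_card_of_injOn (fun c => c + a) ?_ fun _ _ _ _ h => add_right_cancel h
      intro c hc
      have hc' := (Finset.mem_filter.1 hc).2
      rw [← hc']
      exact Finset.vadd_mem_vadd_finset ha
    rw [h₁, hl] at h₃ ⊢
    exact pow_dvd_pow p ((Nat.lt_pow_self (Fact.out : p.Prime).one_lt).le.trans h₃)
  have key := exists_transfer (Λ := Λ) (E := E') (L := p ^ n)
    (Finset.univ.erase (∅ : Finset (Fin (p ^ n)))) ?_
    (fun s => (p ^ s.card /
      (Finset.univ.filter fun c : Fin (p ^ n) => c +ᵥ s = s).card) • φ s x) ?_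
  · refine (congrArg (· ∈ LinearMap.range (cycTransfer Λ E' (p ^ n))) ?_).mp key
    refine Finset.sum_congr rfl fun s hs => ?_
    rw [smul_smul, Nat.mul_div_cancel' (hdvd s (Finset.ne_of_mem_erase hs))]
  · intro c s hs
    simpa using hs
  · intro c s
    rw [map_nsmul, hφ]
    congr 2
    · rw [Finset.card_vadd_finset]
    · congr 1
      ext d
      simp only [Finset.mem_filter, Finset.mem_univ, true_and]
      rw [vadd_comm, vadd_left_cancel_iff]

end Transfer

/-! ### Kaledin's polynomial Witt vectors -/

/-- A surjective ring homomorphism `Λ → k` with kernel `pΛ`, that is, an identification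
`Λ / p = k`. -/
structure ModPReduction (p : ℕ) (Λ : Type u) (k : Type v) [CommRing Λ] [CommRing k] where
  hom : Λ →+* k
  surjective : Function.Surjective hom
  ker : RingHom.ker hom = Ideal.span {(p : Λ)}

namespace ModPReduction

/-- The reduction `ℤ → 𝔽_p`. -/
def int (p : ℕ) : ModPReduction p ℤ (ZMod p) where
  hom := Int.castRingHom (ZMod p)
  surjective := ZMod.intCast_surjective
  ker := ZMod.ker_intCastRingHom p

/-- The reduction `W_m(k) → k`, `a ↦ a_0`, for `m ≥ 1` and a perfect ring `k` of
characteristic `p`. -/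
def witt (p : ℕ) [Fact p.Prime] (k : Type v) [CommRing k] [CharP k p] [PerfectRing k p] (m : ℕ)
    (hm : 1 ≤ m) : ModPReduction p (TruncatedWittVector p m k) k :=
  haveI hker : RingHom.ker (WittVector.truncate m : WittVector p k →+* _) ≤
      RingHom.ker (WittVector.constantCoeff : WittVector p k →+* k) := fun x hx =>
    (WittVector.mem_ker_truncate m x).1 hx 0 hm
  letI red : TruncatedWittVector p m k →+* k := RingHom.liftOfSurjective
    (WittVector.truncate m) (WittVector.truncate_surjective p m k)
    ⟨WittVector.constantCoeff, hker⟩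
  haveI hred : ∀ x : WittVector p k, red (WittVector.truncate m x) = x.coeff 0 := fun x =>
    RingHom.liftOfSurjective_comp_apply ..
  { hom := red
    surjective := fun a => ⟨WittVector.truncate m (WittVector.teichmuller p a), by
      rw [hred]; simp⟩
    ker := by
      ext y
      obtain ⟨x, rfl⟩ := WittVector.truncate_surjective p m k y
      rw [RingHom.mem_ker, hred, Ideal.mem_span_singleton]
      constructor
      · intro h
        obtain ⟨z, rfl⟩ := Ideal.mem_span_singleton.1
          ((WittVector.mem_span_p_iff_coeff_zero_eq_zero x).2 h)
        exact ⟨WittVector.truncate m z, by rw [map_mul, map_natCast]⟩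
      · rintro ⟨z, hz⟩
        obtain ⟨z, rfl⟩ := WittVector.truncate_surjective p m k z
        rw [← hred, hz, map_mul, map_natCast, CharP.cast_eq_zero, zero_mul] }

variable {p : ℕ} {Λ : Type u} {k : Type v} [CommRing Λ]

section Ring

variable [Fact p.Prime] [CommRing k] (ρ : ModPReduction p Λ k) (n : ℕ)

/-- The map `W(Λ) → W_n(k)`. -/
def wittMap : WittVector p Λ →+* TruncatedWittVector p n k :=
  (WittVector.truncate n).comp (WittVector.map ρ.hom)

theorem wittMap_surjective : Function.Surjective (ρ.wittMap n : WittVector p Λ →+* _) :=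
  (WittVector.truncate_surjective p n k).comp (WittVector.map_surjective _ ρ.surjective)

theorem ker_wittMap_le : RingHom.ker (ρ.wittMap n : WittVector p Λ →+* _) ≤
    RingHom.ker ((Ideal.Quotient.mk (Ideal.span {((p ^ n : ℕ) : Λ)})).comp
      (WittVector.ghostComponent n)) := by
  intro x hx
  have hx₀ : WittVector.map ρ.hom x ∈ RingHom.ker
      (WittVector.truncate n : WittVector p k →+* TruncatedWittVector p n k) := by
    rw [RingHom.mem_ker, wittMap, RingHom.comp_apply] at hx
    rwa [RingHom.mem_ker]
  rw [WittVector.mem_ker_truncate] at hx₀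
  have hx' : ∀ i < n, (p : Λ) ∣ x.coeff i := by
    intro i hi
    have := hx₀ i hi
    rw [WittVector.map_coeff, ← RingHom.mem_ker, ρ.ker, Ideal.mem_span_singleton] at this
    exact this
  rw [RingHom.mem_ker, RingHom.comp_apply, Ideal.Quotient.eq_zero_iff_mem,
    Ideal.mem_span_singleton, WittVector.ghostComponent_apply, aeval_wittPolynomial]
  refine Finset.dvd_sum fun i hi => ?_
  rw [Nat.cast_pow]
  rcases (Nat.lt_succ_iff.1 (Finset.mem_range.1 hi)).lt_or_eq with h | rfl
  · have h₁ : (p : Λ) ^ n = p ^ i * p ^ (n - i) := by rw [← pow_add, Nat.add_sub_cancel' h.le]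
    have h₂ : (p : Λ) ^ (n - i) ∣ p ^ p ^ (n - i) :=
      pow_dvd_pow _ (Nat.lt_pow_self (Fact.out : p.Prime).one_lt).le
    rw [h₁]
    exact mul_dvd_mul_left _ (h₂.trans (pow_dvd_pow_of_dvd (hx' i h) _))
  · exact Dvd.intro _ rfl

/-- The ring homomorphism `w_n : W_n(k) = W_n(Λ/p) → Λ/p^n`, which sends `(a_0, …, a_{n-1})` to
`∑_{i < n} p^i ã_i^{p^{n-i}}` for any lifts `ã_i ∈ Λ` of the `a_i`. -/
def ghostHom : TruncatedWittVector p n k →+* Λ ⧸ Ideal.span {((p ^ n : ℕ) : Λ)} :=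
  RingHom.liftOfSurjective (ρ.wittMap n) (ρ.wittMap_surjective n)
    ⟨(Ideal.Quotient.mk _).comp (WittVector.ghostComponent n), ρ.ker_wittMap_le n⟩

end Ring

variable [Field k] (ρ : ModPReduction p Λ k) (n : ℕ)

/-- A free `Λ`-module `E` with `E / p = V`, for a `k`-vector space `V`. -/
abbrev FreeLift (_ : ModPReduction p Λ k) (V : Type w) [AddCommGroup V] [Module k V] : Type _ :=
  Module.Basis.ofVectorSpaceIndex k V →₀ Λ

section Lift

variable {V : Type w} [AddCommGroup V] [Module k V]
  {V' : Type w} [AddCommGroup V'] [Module k V']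

variable (V) in
/-- The reduction map `E → E / p = V`. -/
def red : FreeLift ρ V →+ V :=
  Finsupp.liftAddHom fun b => ((smulAddHom k V).flip (b : V)).comp ρ.hom.toAddMonoidHom

theorem red_single (b : Module.Basis.ofVectorSpaceIndex k V) (c : Λ) :
    ρ.red V (Finsupp.single b c) = ρ.hom c • (b : V) :=
  Finsupp.liftAddHom_apply_single _ _ _

theorem red_smul (c : Λ) (x : FreeLift ρ V) : ρ.red V (c • x) = ρ.hom c • ρ.red V x := by
  induction x using Finsupp.induction_linear with
  | zero => simp
  | add a b ha hb => simp only [smul_add, map_add, ha, hb]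
  | single b d => rw [Finsupp.smul_single, red_single, red_single, smul_eq_mul, map_mul, mul_smul]

theorem red_eq (x : FreeLift ρ V) :
    ρ.red V x = Finsupp.linearCombination k (Module.Basis.ofVectorSpace k V)
      (Finsupp.mapRange ρ.hom (map_zero _) x) := by
  induction x using Finsupp.induction_linear with
  | zero => simp
  | add a b ha hb =>
    rw [map_add, ha, hb, Finsupp.mapRange_add (hf' := map_add ρ.hom), map_add]
  | single b d => simp [red_single]

theorem red_surjective : Function.Surjective (ρ.red V) := by
  intro v
  obtain ⟨x, hx⟩ := Finsupp.mapRange_surjective (α := Module.Basis.ofVectorSpaceIndex k V)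
    ρ.hom (map_zero _) ρ.surjective ((Module.Basis.ofVectorSpace k V).repr v)
  refine ⟨x, ?_⟩
  rw [red_eq, hx]
  exact (Module.Basis.ofVectorSpace k V).linearCombination_repr v

theorem exists_of_red_eq_zero {x : FreeLift ρ V} (hx : ρ.red V x = 0) :
    ∃ y : FreeLift ρ V, x = (p : Λ) • y := by
  classical
  rw [red_eq] at hx
  have h₀ : Finsupp.mapRange ρ.hom (map_zero _) x = 0 :=
    (Module.Basis.ofVectorSpace k V).linearIndependent (hx.trans (map_zero _).symm)
  have h₁ : ∀ b, ∃ c, x b = p * c := by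
    intro b
    have : ρ.hom (x b) = 0 := by simpa using DFunLike.congr_fun h₀ b
    rw [← RingHom.mem_ker, ρ.ker, Ideal.mem_span_singleton] at this
    exact this
  choose c hc using h₁
  refine ⟨Finsupp.onFinset x.support (fun b => if x b = 0 then 0 else c b) ?_, ?_⟩
  · intro b hb
    rw [Finsupp.mem_support_iff]
    intro h
    simp [h] at hb
  · ext b
    by_cases h : x b = 0 <;> simp [h, ← hc]

theorem exists_lift {E : Type*} [AddCommGroup E] [Module Λ E] [Module.Free Λ E] (f : E →+ V)
    (hf : ∀ (c : Λ) (x : E), f (c • x) = ρ.hom c • f x) :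
    ∃ g : E →ₗ[Λ] FreeLift ρ V, ∀ x, ρ.red V (g x) = f x := by
  choose s hs using ρ.red_surjective (V := V)
  let b := Module.Free.chooseBasis Λ E
  refine ⟨b.constr Λ fun i => s (f (b i)), fun x => ?_⟩
  induction b.mem_span x using Submodule.span_induction with
  | zero => simp
  | add a b _ _ ha hb => simp only [map_add, ha, hb]
  | smul c x _ hx => rw [map_smul, red_smul, hx, hf]
  | mem x hx =>
    obtain ⟨i, rfl⟩ := hx
    simp [hs]

/-- A lift of a linear map `V → V'` to the free modules. -/
def liftHom (f : V →ₗ[k] V') : FreeLift ρ V →ₗ[Λ] FreeLift ρ V' :=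
  (ρ.exists_lift (f.toAddMonoidHom.comp (ρ.red V))
    (fun c x => by simp [red_smul])).choose

theorem red_liftHom (f : V →ₗ[k] V') (x : FreeLift ρ V) :
    ρ.red V' (ρ.liftHom f x) = f (ρ.red V x) :=
  (ρ.exists_lift (f.toAddMonoidHom.comp (ρ.red V))
    (fun c x => by simp [red_smul])).choose_spec x

variable [Fact p.Prime]

/-- Maps of free modules with the same reduction modulo `p` induce the same map. -/
theorem map_eq_of_red_eq {E : Type*} [AddCommGroup E] [Module Λ E] [Module.Free Λ E]
    {f g : E →ₗ[Λ] FreeLift ρ V} (h : ∀ x, ρ.red V (f x) = ρ.red V (g x))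
    (x : CycQ Λ E (p ^ n)) : CycQ.map (p ^ n) f x = CycQ.map (p ^ n) g x := by
  have : ∀ y, ∃ z, f y - g y = (p : Λ) • z := fun y =>
    ρ.exists_of_red_eq_zero (by rw [map_sub, h, sub_self])
  choose z hz using this
  let b := Module.Free.chooseBasis Λ E
  refine CycQ.map_congr p n (h := b.constr Λ fun i => z (b i)) (b.ext fun i => ?_) x
  simp [← hz]

/-- Kaledin's formula `W̄_n(E / p) = Q_{p^n}(Λ; E)`: if `E` is a free `Λ`-module with reduction
`f : E → E / p = V`, then any lift `E → FreeLift V` of the identity of `V` induces a bijection on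
`Q_{p^n}`. It does not depend on the lift and is natural in `E` by `map_eq_of_red_eq`. -/
theorem map_bijective {E : Type*} [AddCommGroup E] [Module Λ E] [Module.Free Λ E] (f : E →+ V)
    (hf : ∀ (c : Λ) (x : E), f (c • x) = ρ.hom c • f x) (hsurj : Function.Surjective f)
    (hker : ∀ x, f x = 0 → ∃ y, x = (p : Λ) • y)
    (g : E →ₗ[Λ] FreeLift ρ V) (hg : ∀ x, ρ.red V (g x) = f x) :
    Function.Bijective (CycQ.map (p ^ n) g) := by
  choose s hs using hsurj
  let b := Module.Free.chooseBasis Λ (FreeLift ρ V)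
  let g' : FreeLift ρ V →ₗ[Λ] E := b.constr Λ fun i => s (ρ.red V (b i))
  have hg' : ∀ x, f (g' x) = ρ.red V x := by
    intro x
    induction b.mem_span x using Submodule.span_induction with
    | zero => simp
    | add a b _ _ ha hb => simp only [map_add, ha, hb]
    | smul c x _ hx => rw [map_smul, red_smul, ← hx, hf]
    | mem x hx =>
      obtain ⟨i, rfl⟩ := hx
      simp [g', hs]
  refine Function.bijective_iff_has_inverse.2 ⟨CycQ.map (p ^ n) g', fun x => ?_, fun x => ?_⟩
  · rw [← CycQ.map_comp]
    have : ∀ y, ∃ z, g' (g y) - y = (p : Λ) • z := fun y =>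
      hker _ (by rw [map_sub, hg', hg, sub_self])
    choose z hz using this
    let c := Module.Free.chooseBasis Λ E
    refine (CycQ.map_congr p n (g := LinearMap.id) (h := c.constr Λ fun i => z (c i))
      (c.ext fun i => ?_) x).trans (CycQ.map_id x)
    simp [← hz]
  · rw [← CycQ.map_comp]
    refine (ρ.map_eq_of_red_eq n (g := LinearMap.id) (fun x => ?_) x).trans (CycQ.map_id x)
    rw [LinearMap.comp_apply, hg, hg', LinearMap.id_apply]

end Lift

variable [Fact p.Prime]

/-- The value `Q_{p^n}(Λ; E)`, for `E` a free `Λ`-module with `E / p = V`. -/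
def PolyWitt (V : Type w) [AddCommGroup V] [Module k V] : Type _ :=
  CycQ Λ (FreeLift ρ V) (p ^ n)

section

variable (V : Type w) [AddCommGroup V] [Module k V]

instance : AddCommGroup (ρ.PolyWitt n V) :=
  inferInstanceAs (AddCommGroup (CycQ Λ (FreeLift ρ V) (p ^ n)))

instance : Module Λ (ρ.PolyWitt n V) :=
  inferInstanceAs (Module Λ (CycQ Λ (FreeLift ρ V) (p ^ n)))

theorem PolyWitt.isTorsion : Module.IsTorsionBySet Λ (ρ.PolyWitt n V)
    (Ideal.span {((p ^ n : ℕ) : Λ)} : Set Λ) :=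
  (Module.isTorsionBySet_span_singleton_iff _).2 fun x => CycQ.torsion (L := p ^ n) x

/-- The action of `W_n(k)` on `Q_{p^n}(Λ; E)` through `w_n : W_n(k) → Λ/p^n = Q_{p^n}(Λ; Λ)`. -/
instance : Module (TruncatedWittVector p n k) (ρ.PolyWitt n V) :=
  letI := (PolyWitt.isTorsion ρ n V).module
  Module.compHom _ (ρ.ghostHom n)

theorem PolyWitt.smul_def (a : TruncatedWittVector p n k) (c : Λ)
    (h : ρ.ghostHom n a = Ideal.Quotient.mk _ c) (x : ρ.PolyWitt n V) : a • x = c • x := by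
  let _ := (PolyWitt.isTorsion ρ n V).module
  change ρ.ghostHom n a • x = c • x
  rw [h]
  rfl

end

/-- Kaledin's functor `W̄_n` of polynomial Witt vectors from `k`-vector spaces to
`W_n(k)`-modules, formed with a ring `Λ` such that `Λ / p = k`: it is `V ↦ Q_{p^n}(Λ; E)` for a
free `Λ`-module `E` with `E / p = V`, and a linear map acts through any lift to the free
modules. -/
def polyWitt : CategoryTheory.Functor (ModuleCat.{w} k)
    (ModuleCat.{max w u} (TruncatedWittVector p n k)) where
  obj V := ModuleCat.of _ (ρ.PolyWitt n V)
  map {V V'} f := ModuleCat.ofHom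
    { toFun := (CycQ.map (p ^ n) (ρ.liftHom f.hom) :
        CycQ Λ (FreeLift ρ V) (p ^ n) →ₗ[Λ] CycQ Λ (FreeLift ρ V') (p ^ n))
      map_add' := map_add _
      map_smul' := fun a (x : ρ.PolyWitt n V) => by
        obtain ⟨c, hc⟩ := Ideal.Quotient.mk_surjective (ρ.ghostHom n a)
        rw [PolyWitt.smul_def ρ n V a c hc.symm]
        refine Eq.trans ?_ (PolyWitt.smul_def ρ n V' a c hc.symm _).symm
        exact map_smul (CycQ.map (p ^ n) (ρ.liftHom f.hom)) c x }
  map_id V := by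
    ext x
    refine (ρ.map_eq_of_red_eq n (g := LinearMap.id) (fun x => ?_) x).trans (CycQ.map_id x)
    rw [red_liftHom]
    rfl
  map_comp {V V' V''} f g := by
    ext x
    refine Eq.trans (ρ.map_eq_of_red_eq n (fun x => ?_) x)
      (CycQ.map_comp (ρ.liftHom g.hom) (ρ.liftHom f.hom) x)
    rw [LinearMap.comp_apply, red_liftHom, red_liftHom, red_liftHom]
    rfl

end ModPReduction

end

universe u v

/-! Let `Λ` be a ring with `Λ/p = k`, let `ψ` be a ring endomorphism of `Λ` with `x^p ≡ ψ x` modulo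
`p`, and let `E` be a free module lifting `V`. A Witt vector with `n` coordinates is built from the
ghost maps `w_0, …, w_{n-1}`. The comparison map is the next one: lift the coordinates to `E` and
take the class of `w_n`, an invariant of `E^{⊗ p^n}`, modulo transfers. (Most statements below have
`n + 1` in place of `n`.)

Everything is checked on coefficients. In a basis, a tensor of length `p^j` is a function on words,
viewed as sequences of period `p^j`; rotation becomes the shift, and coefficients of `w_j` become
sums of coset norms (`coef_ghost`). An invariant tensor is a transfer once its coefficient at each
word of period `p^r` is divisible by `p^(j-r)` (`exists_cycTr_eq`). Dwork's congruence
(`dworkCong_ghost`) therefore says that `w_j` determines `w_{j+1}` modulo transfers. Conversely,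
Dwork's lemma (`exists_ghost_eq`) realises every sequence of invariants satisfying the congruences.

Well-definedness and linearity: changing the lifts by multiples of `p` changes `w_n` by a transfer
(`ghostClass_congr`). The equivalence relation, the sum and the scalar product are all given by
identities between ghost components over free objects. These map to `E`, and the identity for
`w_{n-1}` yields the one for `w_n` modulo transfers. Scalars act through `w_n` of a lift, which is
the map `W_n(k) → Λ/p^n`.

Surjectivity: an invariant is a sum of orbit sums. For a word of period `p^r` with coefficient `c`,
perfectness gives `c = f^(p^(n-r)) + p c'`. The first term comes from a single word in coordinate
`r`; the second is an orbit sum for the period `p^(r+1)`. At `r = n` an orbit sum is a transfer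
(`inImage_orbitSum`).

Injectivity: let two sequences have the same class and agree below index `m`. Comparing coefficients
modulo `p^(m-r+1)`, cancelling `p^(m-r)` and using that Frobenius is injective on `k`, the
coefficients of the difference of the `m`-th coordinates sum to zero over each orbit
(`sum_coef_eq_zero`). So this difference has the form `t - rot t`. The transfer kills it, hence over
`ℤ` it can be added to coordinate `m` without changing `w_0, …, w_m`, and Dwork's lemma corrects the
later coordinates: the Witt vector is the same and `m` has increased (`exists_mk_eq_of_sub_rotZ`).

The algebraic structure is transported along this bijection; it is the prescribed one because sums
and scalar multiples exist by Dwork's lemma over `ℤ` and `ℤ[R]`. -/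

set_option linter.unusedSectionVars false

/-! ### Shifts of sequences and orbits of a periodic self-map -/

section Shift

variable {β : Type*}

/-- The shift of a sequence. -/
def seqShift (w : ℕ → β) : ℕ → β := fun i => w (i + 1)

theorem seqShift_iterate (s : ℕ) (w : ℕ → β) (i : ℕ) : seqShift^[s] w i = w (i + s) := by
  induction s generalizing w with
  | zero => rfl
  | succ s ih => rw [Function.iterate_succ_apply, ih]; rfl

theorem seqShift_periodic {L : ℕ} {w : ℕ → β} (h : Function.IsPeriodicPt seqShift L w) :
    Function.Periodic w L := fun i => by
  rw [← seqShift_iterate L w i]; exact congrFun h i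

theorem isPeriodicPt_seqShift {L : ℕ} {w : ℕ → β} (h : Function.Periodic w L) :
    Function.IsPeriodicPt seqShift L w := funext fun i => by
  rw [seqShift_iterate]; exact h i

theorem eq_of_eqOn_period {L : ℕ} (hL : 0 < L) {w w' : ℕ → β}
    (h : Function.IsPeriodicPt seqShift L w) (h' : Function.IsPeriodicPt seqShift L w')
    (heq : ∀ i < L, w i = w' i) : w = w' := by
  funext i
  rw [← (seqShift_periodic h).map_mod_nat, ← (seqShift_periodic h').map_mod_nat]
  exact heq _ (Nat.mod_lt _ hL)

theorem periodic_iterate_seqShift {L : ℕ} {w : ℕ → β} {γ : Type*}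
    (h : Function.IsPeriodicPt seqShift L w) (f : (ℕ → β) → γ) :
    Function.Periodic (fun s => f (seqShift^[s] w)) L := fun s => by
  simp only [Function.iterate_add_apply, h.eq]

/-- The sum over an invariant finite set of periodic points, orbit by orbit. -/
theorem exists_sum_orbits {X : Type*} (σ : X → X) {L : ℕ} (hL : 0 < L) {A : Type*}
    [AddCommMonoid A] (F : Finset X) (hF : ∀ x ∈ F, σ x ∈ F ∧ Function.IsPeriodicPt σ L x) :
    ∃ S ⊆ F, ∀ g : X → A, ∑ x ∈ F, g x =
      ∑ x ∈ S, ∑ s ∈ Finset.range (Function.minimalPeriod σ x), g (σ^[s] x) := by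
  classical
  induction hn : F.card using Nat.strong_induction_on generalizing F with
  | _ n ih =>
  obtain rfl | ⟨x, hx⟩ := F.eq_empty_or_nonempty
  · exact ⟨∅, subset_rfl, fun g => by simp⟩
  have hmem : ∀ s, σ^[s] x ∈ F := by
    intro s
    induction s with
    | zero => exact hx
    | succ s ihs => rw [Function.iterate_succ_apply']; exact (hF _ ihs).1
  -- Induction on the size of `F`: the orbit `O` of one point is split off, with `x` as its
  -- representative.
  let O := (Finset.range (Function.minimalPeriod σ x)).image fun s => σ^[s] x
  have hOF : O ⊆ F := by
    intro y hy
    obtain ⟨s, -, rfl⟩ := Finset.mem_image.1 hy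
    exact hmem s
  have hxp : x ∈ Function.periodicPts σ := ⟨L, hL, (hF x hx).2⟩
  have hO : ∀ s, σ^[s] x ∈ O := fun s => Finset.mem_image.2
    ⟨s % Function.minimalPeriod σ x, Finset.mem_range.2
      (Nat.mod_lt _ (Function.minimalPeriod_pos_of_mem_periodicPts hxp)),
      Function.iterate_mod_minimalPeriod_eq⟩
  have hclosed : ∀ y ∈ F, σ y ∈ O → y ∈ O := by
    intro y hy h
    obtain ⟨s, -, hs⟩ := Finset.mem_image.1 h
    -- On points of period `L` the map `σ` has the inverse `σ^[L - 1]`, so the complement of an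
    -- orbit is again invariant.
    have hy' : y = σ^[L - 1] (σ y) := by
      rw [← Function.iterate_succ_apply, Nat.succ_eq_add_one, Nat.sub_one_add_one hL.ne']
      exact ((hF y hy).2).symm
    rw [hy', ← hs, ← Function.iterate_add_apply]
    exact hO _
  obtain ⟨S, hS, hS'⟩ := ih (F \ O).card
    (hn ▸ Finset.card_lt_card (Finset.sdiff_ssubset hOF ⟨x, hO 0⟩)) (F \ O)
    (fun y hy => by
      rw [Finset.mem_sdiff] at hy
      exact ⟨Finset.mem_sdiff.2 ⟨(hF y hy.1).1, fun h => hy.2 (hclosed y hy.1 h)⟩,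
        (hF y hy.1).2⟩) rfl
  have hxS : x ∉ S := fun h => (Finset.mem_sdiff.1 (hS h)).2 (hO 0)
  refine ⟨insert x S, ?_, fun g => ?_⟩
  · exact Finset.insert_subset hx (hS.trans Finset.sdiff_subset)
  · rw [Finset.sum_insert hxS, ← hS' g, add_comm, ← Finset.sum_sdiff hOF]
    congr 1
    refine Finset.sum_image fun a ha b hb h => ?_
    exact Function.iterate_injOn_Iio_minimalPeriod (Finset.mem_range.1 ha)
      (Finset.mem_range.1 hb) h

end Shift

/-! ### Coset norms of periodic sequences -/

section CosetNorm

variable {R : Type*} [CommRing R] {p : ℕ}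

theorem sum_range_mul_of_periodic {A : Type*} [AddCommMonoid A] {f : ℕ → A} {m : ℕ}
    (hf : Function.Periodic f m) (q : ℕ) :
    ∑ s ∈ Finset.range (q * m), f s = q • ∑ s ∈ Finset.range m, f s := by
  induction q with
  | zero => simp
  | succ q ih =>
    rw [Nat.succ_mul, Finset.sum_range_add, ih, succ_nsmul]
    congr 1
    refine Finset.sum_congr rfl fun s _ => ?_
    rw [add_comm]
    simpa using hf.nsmul q s

theorem prod_range_mul_of_periodic {A : Type*} [CommMonoid A] {f : ℕ → A} {m : ℕ}
    (hf : Function.Periodic f m) (q : ℕ) :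
    ∏ s ∈ Finset.range (q * m), f s = (∏ s ∈ Finset.range m, f s) ^ q :=
  sum_range_mul_of_periodic (A := Additive A) hf q

/-- `∑_{s < p^i} ∏_{l < p^{j-i}} α (s + l p^i)`: a sum over the cosets of `p^iℤ/p^j` of the
products of `α`. -/
def cosetNorm (p : ℕ) (α : ℕ → R) (i j : ℕ) : R :=
  ∑ s ∈ Finset.range (p ^ i), ∏ l ∈ Finset.range (p ^ (j - i)), α (s + l * p ^ i)

theorem periodic_pow_le {A : Type*} {α : ℕ → A} {r i : ℕ} (h : Function.Periodic α (p ^ r))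
    (hri : r ≤ i) : Function.Periodic α (p ^ i) := by
  obtain ⟨d, rfl⟩ := Nat.exists_eq_add_of_le' hri
  rw [pow_add]
  simpa using h.nsmul (p ^ d)

/-- Steps of `p^i` are multiples of the period, so each product is a pure power; the outer sum then
runs `p^(i-r)` times through a period. -/
theorem cosetNorm_eq_of_le {α : ℕ → R} {r i j : ℕ} (h : Function.Periodic α (p ^ r))
    (hri : r ≤ i) :
    cosetNorm p α i j = (p : R) ^ (i - r) *
      ∑ s ∈ Finset.range (p ^ r), α s ^ p ^ (j - i) := by
  have h₁ : cosetNorm p α i j = ∑ s ∈ Finset.range (p ^ i), α s ^ p ^ (j - i) := by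
    refine Finset.sum_congr rfl fun s _ => ?_
    rw [Finset.prod_congr rfl (g := fun _ => α s), Finset.prod_const, Finset.card_range]
    intro l _
    simpa using (periodic_pow_le h hri).nsmul l s
  have h₂ : p ^ i = p ^ (i - r) * p ^ r := by rw [← pow_add, Nat.sub_add_cancel hri]
  rw [h₁, h₂, sum_range_mul_of_periodic (fun s => by simp only [h s]), nsmul_eq_mul,
    Nat.cast_pow]

/-- In the other range it is the product that repeats: in steps of `p^i` it passes `p^(j-r)` times
through the period. -/
theorem cosetNorm_eq_of_ge {α : ℕ → R} {r i j : ℕ} (h : Function.Periodic α (p ^ r))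
    (hir : i ≤ r) (hrj : r ≤ j) :
    cosetNorm p α i j = ∑ s ∈ Finset.range (p ^ i),
      (∏ l ∈ Finset.range (p ^ (r - i)), α (s + l * p ^ i)) ^ p ^ (j - r) := by
  refine Finset.sum_congr rfl fun s _ => ?_
  have h₂ : p ^ (j - i) = p ^ (j - r) * p ^ (r - i) := by
    rw [← pow_add]; congr 1; omega
  rw [h₂, prod_range_mul_of_periodic]
  intro l
  beta_reduce
  rw [add_mul, ← pow_add, Nat.sub_add_cancel hir, ← add_assoc, h]

theorem pow_dvd_cosetNorm {α : ℕ → R} {r i j : ℕ} (h : Function.Periodic α (p ^ r))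
    (hri : r ≤ i) : (p : R) ^ (i - r) ∣ cosetNorm p α i j := by
  rw [cosetNorm_eq_of_le h hri]; exact Dvd.intro _ rfl

/-- Dwork's congruence. -/
theorem cosetNorm_frobenius {ψ : R →+* R} (hψ : ∀ x, (p : R) ∣ x ^ p - ψ x) {α : ℕ → R}
    {r i j : ℕ} (h : Function.Periodic α (p ^ r)) (hij : i ≤ j) (hrj : r ≤ j) :
    (p : R) ^ (j + 1 - r) ∣ cosetNorm p α i (j + 1) - ψ (cosetNorm p α i j) := by
  -- Each `p`-th power gains one factor `p` in a congruence modulo `p`.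
  have key : ∀ (a : ℕ) (x : R), (p : R) ^ (a + 1) ∣ x ^ p ^ (a + 1) - ψ (x ^ p ^ a) := by
    intro a x
    rw [pow_succ' p a, pow_mul, map_pow]
    exact dvd_sub_pow_of_dvd_sub (hψ x) a
  obtain hri | hir := le_total r i
  · rw [cosetNorm_eq_of_le h hri, cosetNorm_eq_of_le h hri, map_mul, map_pow, map_natCast,
      ← mul_sub, map_sum, ← Finset.sum_sub_distrib]
    -- The exponent has two sources: `p^(i-r)` from repeating the cosets, `p^(j-i+1)` from the
    -- congruence between powers.
    have : j + 1 - r = (i - r) + (j - i + 1) := by omega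
    rw [this, pow_add, Nat.sub_add_comm hij]
    exact mul_dvd_mul_left _ (Finset.dvd_sum fun s _ => key _ _)
  · rw [cosetNorm_eq_of_ge h hir hrj, cosetNorm_eq_of_ge h hir (hrj.trans j.le_succ), map_sum,
      ← Finset.sum_sub_distrib, Nat.sub_add_comm hrj]
    exact Finset.dvd_sum fun s _ => key _ _

/-- The same two cases as in Dwork's congruence. The powers are congruent to one order better than
claimed; the modulus kept is the one that makes an invariant tensor a transfer. -/
theorem cosetNorm_congr {α α' : ℕ → R} (hα : ∀ s, (p : R) ∣ α s - α' s)
    {r i j : ℕ} (h : Function.Periodic α (p ^ r)) (h' : Function.Periodic α' (p ^ r))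
    (hij : i ≤ j) (hrj : r ≤ j) :
    (p : R) ^ (j - r) ∣ cosetNorm p α i j - cosetNorm p α' i j := by
  obtain hri | hir := le_total r i
  · rw [cosetNorm_eq_of_le h hri, cosetNorm_eq_of_le h' hri, ← mul_sub, ← Finset.sum_sub_distrib]
    have : j - r = (i - r) + (j - i) := by omega
    rw [this, pow_add]
    exact mul_dvd_mul_left _ (Finset.dvd_sum fun s _ =>
      (pow_dvd_pow _ (Nat.le_succ _)).trans (dvd_sub_pow_of_dvd_sub (hα s) _))
  · rw [cosetNorm_eq_of_ge h hir hrj, cosetNorm_eq_of_ge h' hir hrj, ← Finset.sum_sub_distrib]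
    refine Finset.dvd_sum fun s _ =>
      (pow_dvd_pow _ (Nat.le_succ _)).trans (dvd_sub_pow_of_dvd_sub ?_ _)
    simp only [← Ideal.mem_span_singleton, ← Ideal.Quotient.eq, map_prod] at hα ⊢
    exact Finset.prod_congr rfl fun l _ => hα _

theorem prod_range_add_one {A : Type*} [CommMonoid A] {f : ℕ → A} {m : ℕ} (h : f m = f 0) :
    ∏ s ∈ Finset.range m, f (s + 1) = ∏ s ∈ Finset.range m, f s := by
  cases m with
  | zero => rfl
  | succ m => rw [Finset.prod_range_succ, h, ← Finset.prod_range_succ']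

theorem sum_range_add_one {A : Type*} [AddCommMonoid A] {f : ℕ → A} {m : ℕ} (h : f m = f 0) :
    ∑ s ∈ Finset.range m, f (s + 1) = ∑ s ∈ Finset.range m, f s :=
  prod_range_add_one (A := Multiplicative A) h

/-- The shift permutes the cosets cyclically. At the wrap-around `s = p^i` one returns to the coset
of `0`, with its elements permuted cyclically. -/
theorem cosetNorm_shift {α : ℕ → R} {i j : ℕ} (hij : i ≤ j)
    (h : Function.Periodic α (p ^ j)) :
    cosetNorm p (fun s => α (s + 1)) i j = cosetNorm p α i j := by
  let f : ℕ → R := fun s => ∏ l ∈ Finset.range (p ^ (j - i)), α (s + l * p ^ i)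
  have hf : f (p ^ i) = f 0 := by
    refine Eq.trans (Finset.prod_congr rfl fun l _ => ?_)
      (prod_range_add_one (f := fun l => α (0 + l * p ^ i)) ?_)
    · rw [add_mul, one_mul, zero_add, add_comm]
    · rw [← pow_add, Nat.sub_add_cancel hij, h, zero_mul, add_zero]
  refine Eq.trans (Finset.sum_congr rfl fun s _ => ?_) (sum_range_add_one hf)
  refine Finset.prod_congr rfl fun l _ => ?_
  rw [add_right_comm]

end CosetNorm

/-! ### Coefficients of tensors with respect to a basis -/

namespace RBimod

noncomputable section

variable {R : Type u} {M : Type v} [CommRing R] [AddCommGroup M] [Module R M] {β : Type*}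
  {L : ℕ}

/-- Quotients of the integral tensor power of a module by balancing relations. -/
abbrev BalTens (R : Type u) (M : Type v) [CommRing R] [AddCommGroup M] [Module R M] (L : ℕ)
    (adj : Fin L → Fin L → Prop) : Type v :=
  TensorPower ℤ L M ⧸ balanced (ofModule R M) L adj

/-- The relation contains consecutive positions. -/
def IsConnecting (adj : Fin L → Fin L → Prop) : Prop :=
  ∀ i i' : Fin L, lineAdj L i i' → adj i i'

theorem isConnecting_line : IsConnecting (lineAdj L) := fun _ _ h => h

theorem isConnecting_circle : IsConnecting (circleAdj L) := fun i i' h => by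
  simp only [lineAdj, circleAdj] at h ⊢
  rw [Nat.mod_eq_of_lt (by omega), h]

/-- The coefficient of a tensor at the word `w 0, …, w (L - 1)` in a basis. -/
def coefZ (b : Module.Basis β R M) (L : ℕ) (w : ℕ → β) : TensorPower ℤ L M →ₗ[ℤ] R :=
  PiTensorProduct.lift (((MultilinearMap.mkPiAlgebra R (Fin L) R).compLinearMap
    fun i => b.coord (w i)).restrictScalars ℤ)

variable (b : Module.Basis β R M)

theorem coefZ_tprod (w : ℕ → β) (m : Fin L → M) :
    coefZ b L w (tprod ℤ m) = ∏ i, b.repr (m i) (w i) := by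
  simp [coefZ]

theorem coefZ_update_smul (w : ℕ → β) (m : Fin L → M) (j : Fin L) (r : R) :
    coefZ b L w (tprod ℤ (Function.update m j (r • m j))) = r * coefZ b L w (tprod ℤ m) := by
  rw [coefZ, PiTensorProduct.lift.tprod, PiTensorProduct.lift.tprod,
    MultilinearMap.coe_restrictScalars, MultilinearMap.map_update_smul,
    Function.update_eq_self, smul_eq_mul]

theorem balanced_le_ker_coefZ (adj : Fin L → Fin L → Prop) (w : ℕ → β) :
    balanced (ofModule R M) L adj ≤ LinearMap.ker (coefZ b L w) := by
  refine Submodule.span_le.2 ?_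
  rintro _ ⟨m, i, i', r, h, rfl⟩
  rw [SetLike.mem_coe, LinearMap.mem_ker, map_sub, sub_eq_zero]
  exact (coefZ_update_smul b w m i r).trans (coefZ_update_smul b w m i' r).symm

variable {adj : Fin L → Fin L → Prop}

/-- The coefficient at a word, on a quotient by balancing relations. -/
def coef (w : ℕ → β) : BalTens R M L adj →+ R :=
  (Submodule.liftQ _ (coefZ b L w) (balanced_le_ker_coefZ b adj w)).toAddMonoidHom

theorem coef_mk (w : ℕ → β) (x : TensorPower ℤ L M) :
    coef b w (Submodule.Quotient.mk x : BalTens R M L adj) = coefZ b L w x := rfl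

@[elab_as_elim]
theorem tensZ_induction [NeZero L] {A : Type*} [AddCommGroup A] {motive : TensorPower ℤ L A → Prop}
    (x : TensorPower ℤ L A) (add : ∀ x y, motive x → motive y → motive (x + y))
    (tprod : ∀ m : Fin L → A, motive (tprod ℤ m)) : motive x := by
  induction x using PiTensorProduct.induction_on with
  | add a b ha hb => exact add _ _ ha hb
  | smul_tprod c m =>
    have h := (PiTensorProduct.tprod ℤ).map_update_smul m 0 c (m 0)
    rw [Function.update_eq_self] at h
    rw [← h]
    exact tprod _

/-- Each relation between neighbours moves the scalar one place to the left, until it reaches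
position `0`. -/
theorem mk_update_smul [NeZero L] (hadj : IsConnecting adj) (r : R) (m : Fin L → M) (i : Fin L) :
    (Submodule.Quotient.mk (tprod ℤ (Function.update m i (r • m i))) : BalTens R M L adj) =
      Submodule.Quotient.mk (tprod ℤ (Function.update m 0 (r • m 0))) := by
  obtain ⟨i, hi⟩ := i
  induction i with
  | zero => rfl
  | succ i ih =>
    refine Eq.trans ?_ (ih (Nat.lt_of_succ_lt hi))
    refine ((Submodule.Quotient.eq _).2 (Submodule.subset_span ?_)).symm
    exact ⟨m, ⟨i, Nat.lt_of_succ_lt hi⟩, ⟨i + 1, hi⟩, r, hadj _ _ rfl, rfl⟩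

/-- The canonical map from the integral tensor power to the tensor power over `R`. -/
def tensorOver (R : Type u) (M : Type v) [CommRing R] [AddCommGroup M] [Module R M] (L : ℕ) :
    TensorPower ℤ L M →ₗ[ℤ] TensorPower R L M :=
  PiTensorProduct.lift ((tprod R (s := fun _ : Fin L => M)).restrictScalars ℤ)

theorem tensorOver_tprod (m : Fin L → M) : tensorOver R M L (tprod ℤ m) = tprod R m := by
  simp [tensorOver]

/-- Over a commutative ring, balancing neighbours on a line already lets scalars move to any factor.
So the line and circle quotients both agree with the tensor power over `R`, and the proof builds a
left inverse of the map to it. -/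
theorem mk_eq_zero_of_tensorOver [NeZero L] (hadj : IsConnecting adj) {x : TensorPower ℤ L M}
    (hx : tensorOver R M L x = 0) : (Submodule.Quotient.mk x : BalTens R M L adj) = 0 := by
  classical
  let μ : MultilinearMap ℤ (fun _ : Fin L => M) (BalTens R M L adj) :=
    (Submodule.mkQ (balanced (ofModule R M) L adj)).compMultilinearMap (tprod ℤ)
  have hμ : ∀ (r : R) (m : Fin L → M) (i : Fin L),
      μ (Function.update m 0 (r • m 0)) = μ (Function.update m i (r • m i)) :=
    fun r m i => (mk_update_smul hadj r m i).symm
  -- A generator `(r, m)` goes to the tensor of `m` with `r` put on factor `0`. To check a relation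
  -- at position `i`, `hμ` first moves the scalar there.
  let inv : TensorPower R L M →+ BalTens R M L adj :=
    PiTensorProduct.liftAddHom (fun x => μ (Function.update x.2 0 (x.1 • x.2 0)))
      (fun r f i hi => by
        simp only
        rw [hμ r f i, hi, smul_zero]
        exact μ.map_update_zero f i)
      (fun f => by
        simp only
        rw [zero_smul]
        exact μ.map_update_zero f 0)
      (fun {inst} r f i m₁ m₂ => by
        obtain rfl : inst = instDecidableEqFin L := Subsingleton.elim _ _
        simp only
        rw [hμ r _ i, hμ r _ i, hμ r _ i]
        simp only [Function.update_self, smul_add]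
        have := μ.map_update_add f i (r • m₁) (r • m₂)
        simp)
      (fun r r' f => by
        simp only
        rw [add_smul]
        exact (μ.map_update_add f 0 _ _).symm)
      (fun {inst} r f i r' => by
        obtain rfl : inst = instDecidableEqFin L := Subsingleton.elim _ _
        simp only
        rw [hμ r _ i, hμ _ _ i]
        congr 1
        simp [mul_smul, smul_comm r r'])
  have hinv : ∀ x, inv (tensorOver R M L x) = Submodule.Quotient.mk x := by
    intro x
    induction x using tensZ_induction with
    | add a b ha hb => rw [map_add, map_add, ha, hb]; rfl
    | tprod m =>
      rw [tensorOver_tprod]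
      have h₁ : inv (tprod R m) = μ (Function.update m 0 ((1 : R) • m 0)) := by
        rw [tprod_eq_tprodCoeff_one]
        exact FreeAddMonoid.lift_eval_of _ _
      rw [h₁, one_smul, Function.update_eq_self]
      rfl
  rw [← hinv, hx, map_zero]

/-- A periodic extension of a finite word. -/
def wordExt [NeZero L] (w : Fin L → β) : ℕ → β := fun i => w (Fin.ofNat L i)

theorem wordExt_apply [NeZero L] (w : Fin L → β) (i : Fin L) : wordExt w i = w i := by
  simp [wordExt]

theorem wordExt_isPeriodicPt [NeZero L] (w : Fin L → β) :
    Function.IsPeriodicPt seqShift L (wordExt w) :=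
  isPeriodicPt_seqShift fun i => by simp [wordExt, Fin.ofNat]

theorem repr_tensorOver [NeZero L] (x : TensorPower ℤ L M) (w : Fin L → β) :
    (Basis.piTensorProduct fun _ : Fin L => b).repr (tensorOver R M L x) w =
      coefZ b L (wordExt w) x := by
  induction x using tensZ_induction with
  | add a b ha hb => rw [map_add, map_add, map_add, Finsupp.add_apply, ha, hb]
  | tprod m =>
    rw [tensorOver_tprod, Basis.piTensorProduct_repr_tprod_apply, coefZ_tprod]
    simp only [wordExt_apply]

/-- A tensor is determined by its coefficients. -/
theorem coef_ext [NeZero L] (hadj : IsConnecting adj) {x y : BalTens R M L adj}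
    (h : ∀ w, Function.IsPeriodicPt seqShift L w → coef b w x = coef b w y) : x = y := by
  rw [← sub_eq_zero]
  obtain ⟨z, hz⟩ := Submodule.Quotient.mk_surjective _ (x - y)
  rw [← hz]
  refine mk_eq_zero_of_tensorOver hadj ?_
  refine (Basis.piTensorProduct fun _ : Fin L => b).ext_elem fun w => ?_
  rw [repr_tensorOver, ← coef_mk (adj := adj), hz, map_sub, h _ (wordExt_isPeriodicPt w), sub_self,
    map_zero, Finsupp.zero_apply]

end

end RBimod

/-! ### ### Coefficients of powers, rotations and basis tensors -/

namespace RBimod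

noncomputable section

variable {R : Type u} {M : Type v} [CommRing R] [AddCommGroup M] [Module R M] {β : Type*}
  {L : ℕ} (b : Module.Basis β R M) {adj : Fin L → Fin L → Prop}

theorem coefZ_cast {K : ℕ} (h : K = L) (w : ℕ → β) (x : TensorPower ℤ K M) :
    coefZ b L w (TensorPower.cast ℤ M h x) = coefZ b K w x := by
  subst h; simp

theorem coefZ_mul {K L : ℕ} (w : ℕ → β) (x : TensorPower ℤ K M) (y : TensorPower ℤ L M) :
    coefZ b (K + L) w (TensorPower.mulEquiv (x ⊗ₜ y)) =
      coefZ b K w x * coefZ b L (seqShift^[K] w) y := by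
  induction x using PiTensorProduct.induction_on with
  | add a b ha hb => simp only [TensorProduct.add_tmul, map_add, ha, hb, add_mul]
  | smul_tprod c a =>
    induction y using PiTensorProduct.induction_on with
    | add a b ha hb => simp only [TensorProduct.tmul_add, map_add, ha, hb, mul_add]
    | smul_tprod d e =>
      simp only [TensorProduct.tmul_smul, ← TensorProduct.smul_tmul', map_smul, mulEquiv_tprod,
        coefZ_tprod, Fin.prod_univ_add, Fin.append_left, Fin.append_right, Fin.val_castAdd,
        Fin.val_natAdd, seqShift_iterate, smul_mul_assoc, mul_smul_comm]
      simp only [add_comm K]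

theorem coefZ_powZ (w : ℕ → β) (x : TensorPower ℤ L M) (N : ℕ) :
    coefZ b (N * L) w (powZ M x N) =
      ∏ l ∈ Finset.range N, coefZ b L (seqShift^[l * L] w) x := by
  induction N with
  | zero => rw [powZ, coefZ_cast, coefZ_tprod]; simp
  | succ N ih => rw [powZ, coefZ_cast, coefZ_mul, ih, Finset.prod_range_succ]

theorem coef_cycPow (w : ℕ → β) (x : Tens (ofModule R M) L) (N : ℕ) {L' : ℕ} (h : N * L = L') :
    coef b w (cycPow (ofModule R M) N h x) =
      ∏ l ∈ Finset.range N, coef b (seqShift^[l * L] w) x := by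
  obtain ⟨x, rfl⟩ := Submodule.Quotient.mk_surjective _ x
  refine (coefZ_cast b h w _).trans (coefZ_powZ b w x N)

/-- Rotation moves factor `i` to position `i + s` modulo `L`; reading it there as `w (i + s)`
requires `w` to be periodic. -/
theorem coefZ_rotZ [NeZero L] (s : ℕ) {w : ℕ → β} (hw : Function.IsPeriodicPt seqShift L w)
    (x : TensorPower ℤ L M) :
    coefZ b L w (rotZ M L (Fin.ofNat L s) x) = coefZ b L (seqShift^[s] w) x := by
  induction x using tensZ_induction with
  | add a b ha hb => rw [map_add, map_add, map_add, ha, hb]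
  | tprod m =>
    rw [rotZ, reindex_tprod, coefZ_tprod, coefZ_tprod]
    refine (Fintype.prod_equiv (Equiv.addRight (Fin.ofNat L s)) _ _ fun i => ?_).symm
    rw [Equiv.symm_apply_apply, seqShift_iterate]
    congr 1
    rw [Equiv.coe_addRight, Fin.val_add, (seqShift_periodic hw).map_mod_nat, Fin.val_ofNat,
      ← (seqShift_periodic hw).map_mod_nat (i + s),
      ← (seqShift_periodic hw).map_mod_nat (i + s % L)]
    simp

theorem coef_rot [NeZero L] (s : ℕ) {w : ℕ → β} (hw : Function.IsPeriodicPt seqShift L w)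
    (x : Cyc (ofModule R M) L) :
    coef b w (Cyc.rot (ofModule R M) L (Fin.ofNat L s) x) = coef b (seqShift^[s] w) x := by
  obtain ⟨x, rfl⟩ := Submodule.Quotient.mk_surjective _ x
  exact coefZ_rotZ b s hw x

/-- The scaled basis tensor `c b_{w 0} ⊗ ⋯ ⊗ b_{w (L - 1)}`. -/
def wordTens (L : ℕ) [NeZero L] (c : R) (w : ℕ → β) : TensorPower ℤ L M :=
  tprod ℤ (Function.update (fun i : Fin L => b (w i)) 0 (c • b (w 0)))

open Classical in
theorem coefZ_wordTens [NeZero L] (c : R) (w w' : ℕ → β) :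
    coefZ b L w' (wordTens b L c w) = if ∀ i < L, w i = w' i then c else 0 := by
  have h : coefZ b L w' (wordTens b L c w) = c * ∏ i : Fin L, b.repr (b (w i)) (w' i) := by
    rw [← coefZ_tprod b w' fun i : Fin L => b (w i)]
    exact coefZ_update_smul b w' _ 0 c
  rw [h]
  split_ifs with heq
  · rw [Finset.prod_congr rfl (g := fun _ => 1), Finset.prod_const_one, mul_one]
    intro i _
    rw [heq i i.2]
    simp
  · push Not at heq
    obtain ⟨i, hi, hne⟩ := heq
    rw [Finset.prod_eq_zero (Finset.mem_univ (⟨i, hi⟩ : Fin L)), mul_zero]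
    simp [hne]

open Classical in
theorem coefZ_wordTens_of_isPeriodicPt [NeZero L] (c : R) {w w' : ℕ → β}
    (hw : Function.IsPeriodicPt seqShift L w) (hw' : Function.IsPeriodicPt seqShift L w') :
    coefZ b L w' (wordTens b L c w) = if w = w' then c else 0 := by
  rw [coefZ_wordTens]
  exact if_congr ⟨eq_of_eqOn_period (NeZero.pos L) hw hw', fun h i _ => congrFun h i⟩ rfl rfl

variable (adj) in
/-- The class of the scaled basis tensor. -/
def word [NeZero L] (c : R) (w : ℕ → β) : BalTens R M L adj :=
  Submodule.Quotient.mk (wordTens b L c w)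

open Classical in
theorem coef_word [NeZero L] (c : R) {w w' : ℕ → β}
    (hw : Function.IsPeriodicPt seqShift L w) (hw' : Function.IsPeriodicPt seqShift L w') :
    coef b w' (word b adj c w) = if w = w' then c else 0 :=
  coefZ_wordTens_of_isPeriodicPt b c hw hw'

/-- A coefficient sees only the first `L` letters of a word; restricting to periodic words makes
these letters determine the word. -/
theorem finite_support_coefZ [NeZero L] (x : TensorPower ℤ L M) :
    {w : ℕ → β | Function.IsPeriodicPt seqShift L w ∧ coefZ b L w x ≠ 0}.Finite := by
  induction x using tensZ_induction with
  | add x y hx hy =>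
    refine (hx.union hy).subset fun w hw => ?_
    by_contra hcon
    simp only [Set.mem_union, Set.mem_ofPred_eq, not_or, not_and, not_not] at hcon
    exact hw.2 (by rw [map_add, hcon.1 hw.1, hcon.2 hw.1, add_zero])
  | tprod m =>
    have hfin : {f : Fin L → β | ∀ i, f i ∈ ((b.repr (m i)).support : Set β)}.Finite :=
      Set.Finite.pi' fun i => Finset.finite_toSet _
    refine Set.Finite.of_finite_image (f := fun w (i : Fin L) => w i) (hfin.subset ?_) ?_
    · rintro _ ⟨w, hw, rfl⟩ i
      rw [Finset.mem_coe, Finsupp.mem_support_iff]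
      intro h
      exact hw.2 (by rw [coefZ_tprod]; exact Finset.prod_eq_zero (Finset.mem_univ i) h)
    · intro w hw w' hw' h
      exact eq_of_eqOn_period (NeZero.pos L) hw.1 hw'.1 fun i hi => congrFun h ⟨i, hi⟩

/-- A tensor is a sum of the parts supported on the orbits of cyclic rotation. -/
theorem exists_eq_sum_orbits [NeZero L] (hadj : IsConnecting adj) (x : BalTens R M L adj) :
    ∃ S : Finset (ℕ → β), (∀ w ∈ S, Function.IsPeriodicPt seqShift L w) ∧
      x = ∑ w ∈ S, ∑ s ∈ Finset.range (Function.minimalPeriod seqShift w),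
        word b adj (coef b (seqShift^[s] w) x) (seqShift^[s] w) := by
  classical
  obtain ⟨t, ht⟩ := Submodule.Quotient.mk_surjective _ x
  let F₀ := (finite_support_coefZ b t).toFinset
  have hF₀ : ∀ w, w ∈ F₀ ↔ Function.IsPeriodicPt seqShift L w ∧ coef b w x ≠ 0 := fun w => by
    rw [← ht]
    exact Set.Finite.mem_toFinset _
  -- The support need not be stable under the shift, so it is enlarged to a union of orbits; the
  -- added words have coefficient zero.
  let F := (Finset.range L ×ˢ F₀).image fun sw => seqShift^[sw.1] sw.2
  have hF : ∀ w ∈ F, seqShift w ∈ F ∧ Function.IsPeriodicPt seqShift L w := by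
    intro w hw
    obtain ⟨⟨s, w₀⟩, h, rfl⟩ := Finset.mem_image.1 hw
    rw [Finset.mem_product, Finset.mem_range] at h
    have hper := ((hF₀ w₀).1 h.2).1
    refine ⟨Finset.mem_image.2 ⟨((s + 1) % L, w₀), Finset.mem_product.2
      ⟨Finset.mem_range.2 (Nat.mod_lt _ (NeZero.pos L)), h.2⟩, ?_⟩, hper.apply_iterate s⟩
    simp only
    rw [hper.iterate_mod_apply, Function.iterate_succ_apply']
  obtain ⟨S, hS, hsum⟩ := exists_sum_orbits (A := BalTens R M L adj) seqShift (NeZero.pos L) F hF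
  refine ⟨S, fun w hw => (hF w (hS hw)).2, ?_⟩
  rw [← hsum fun w => word b adj (coef b w x) w]
  refine coef_ext b hadj fun w hw => ?_
  rw [map_sum, Finset.sum_congr rfl fun w' hw' => coef_word b _ (hF w' hw').2 hw,
    Finset.sum_ite_eq' F w]
  split_ifs with h
  · rfl
  · by_contra hcon
    exact h (Finset.mem_image.2 ⟨(0, w), Finset.mem_product.2
      ⟨Finset.mem_range.2 (NeZero.pos L), (hF₀ w).2 ⟨hw, hcon⟩⟩, rfl⟩)

end

end RBimod

/-! ### ### Invariants, transfers and Dwork's lemma -/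

namespace RBimod

noncomputable section

variable {R : Type u} {M : Type v} [CommRing R] [AddCommGroup M] [Module R M] {β : Type*}
  (b : Module.Basis β R M) {p : ℕ} [Fact p.Prime] {n j : ℕ}

/-- The transfer from the trivial group to `C_{p^j}` on a cyclic tensor power. -/
def cycTr (p : ℕ) [Fact p.Prime] (B : RBimod.{u, v}) (j : ℕ) : Cyc B (p ^ j) →+ Cyc B (p ^ j) :=
  ∑ s ∈ Finset.range (p ^ j), (Cyc.rot B (p ^ j) (Fin.ofNat (p ^ j) s)).toAddMonoidHom

theorem cycTr_apply (B : RBimod.{u, v}) (x : Cyc B (p ^ j)) : cycTr p B j x =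
    ∑ s ∈ Finset.range (p ^ j), Cyc.rot B (p ^ j) (Fin.ofNat (p ^ j) s) x := by
  simp [cycTr]

theorem coef_cycTr {w : ℕ → β} (hw : Function.IsPeriodicPt seqShift (p ^ j) w)
    (x : Cyc (ofModule R M) (p ^ j)) : coef b w (cycTr p (ofModule R M) j x) =
      ∑ s ∈ Finset.range (p ^ j), coef b (seqShift^[s] w) x := by
  rw [cycTr_apply, map_sum]
  exact Finset.sum_congr rfl fun s _ => coef_rot b s hw x

theorem isPeriodicPt_pow_le {X : Type*} {σ : X → X} {w : X} {r i : ℕ} (hri : r ≤ i)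
    (h : Function.IsPeriodicPt σ (p ^ r) w) : Function.IsPeriodicPt σ (p ^ i) w :=
  h.trans_dvd (pow_dvd_pow _ hri)

/-- Rotating a basis tensor by `s` shifts its word by `-s`; over a full period both directions give
the same sum. -/
theorem sum_rot_word {r : ℕ} (hrj : r ≤ j) (c : R) {w : ℕ → β}
    (hw : Function.IsPeriodicPt seqShift (p ^ r) w) :
    ∑ s ∈ Finset.range (p ^ r), Cyc.rot (ofModule R M) (p ^ j) (Fin.ofNat (p ^ j) s)
      (word b (circleAdj (p ^ j)) c w) =
    ∑ s ∈ Finset.range (p ^ r), (word b _ c (seqShift^[s] w) : Cyc (ofModule R M) (p ^ j)) := by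
  classical
  refine coef_ext b isConnecting_circle fun w' hw' => ?_
  have hwj := isPeriodicPt_pow_le hrj hw
  have hf : (fun s => if seqShift^[s] w = w' then c else 0) (p ^ r) =
      (fun s => if seqShift^[s] w = w' then c else 0) 0 := by
    exact if_congr (by rw [hw.eq]; rfl) rfl rfl
  -- The sum on the right is reindexed by `s ↦ p^r - s`, as a shift of the index by one followed by
  -- a reflection of `range (p^r)`.
  rw [map_sum, map_sum, Finset.sum_congr rfl fun s _ => coef_word b c (hwj.apply_iterate s) hw',
    ← sum_range_add_one (f := fun s => if seqShift^[s] w = w' then c else 0) hf,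
    ← Finset.sum_range_reflect (fun s => if seqShift^[s + 1] w = w' then c else 0)]
  refine Finset.sum_congr rfl fun s hs => ?_
  rw [coef_rot b s hw', coef_word b c hwj (hw'.apply_iterate s)]
  rw [Finset.mem_range] at hs
  have e : p ^ r - 1 - s + 1 = p ^ r - s := by omega
  rw [e]
  refine if_congr ⟨fun h => ?_, fun h => ?_⟩ rfl rfl
  · have hle : s ≤ p ^ j := hs.le.trans (Nat.pow_le_pow_right (Fact.out : p.Prime).pos hrj)
    have h₁ : w' = seqShift^[p ^ j - s] w := by
      rw [h, ← Function.iterate_add_apply, Nat.sub_add_cancel hle]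
      exact hw'.symm
    have h₂ : Function.IsPeriodicPt seqShift (p ^ r) w' := h₁ ▸ hw.apply_iterate _
    rw [h, ← Function.iterate_add_apply, Nat.sub_add_cancel hs.le]
    exact h₂
  · rw [← h, ← Function.iterate_add_apply, Nat.add_sub_cancel' hs.le]
    exact hw.symm

theorem word_natCast_mul {L : ℕ} [NeZero L] {adj : Fin L → Fin L → Prop}
    (hadj : IsConnecting adj) (N : ℕ) (c : R) {w : ℕ → β}
    (hw : Function.IsPeriodicPt seqShift L w) :
    (word b adj (N * c) w : BalTens R M L adj) = N • word b adj c w := by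
  classical
  refine coef_ext b hadj fun w' hw' => ?_
  rw [map_nsmul, coef_word b _ hw hw', coef_word b _ hw hw']
  split_ifs <;> simp

/-- The sum of the words in the orbit of a word of period `p^r`. -/
def orbitSum (j r : ℕ) (c : R) (w : ℕ → β) : Cyc (ofModule R M) (p ^ j) :=
  ∑ s ∈ Finset.range (p ^ r), word b _ c (seqShift^[s] w)

theorem cycTr_word (c : R) {w : ℕ → β} (hw : Function.IsPeriodicPt seqShift (p ^ j) w) :
    cycTr p (ofModule R M) j (word b (circleAdj (p ^ j)) c w) = orbitSum b j j c w := by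
  rw [cycTr_apply, sum_rot_word b le_rfl c hw]
  rfl

/-- The longer sum goes `p^(r'-r)` times around. Multiples of `p` can thus be traded for a longer
period, and at `r' = j` for a transfer. -/
theorem orbitSum_of_le {r r' : ℕ} (hr : r ≤ r') (hj : r' ≤ j) (c : R) {w : ℕ → β}
    (hw : Function.IsPeriodicPt seqShift (p ^ r) w) :
    (orbitSum b j r' c w : Cyc (ofModule R M) (p ^ j)) =
      orbitSum b j r ((p : R) ^ (r' - r) * c) w := by
  have hwj := isPeriodicPt_pow_le (hr.trans hj) hw
  have h₂ : p ^ r' = p ^ (r' - r) * p ^ r := by rw [← pow_add, Nat.sub_add_cancel hr]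
  have h₃ := sum_range_mul_of_periodic (m := p ^ r)
    (f := fun s => (word b _ c (seqShift^[s] w) : Cyc (ofModule R M) (p ^ j)))
    (fun s => by simp only [Function.iterate_add_apply, hw.eq]) (p ^ (r' - r))
  rw [← h₂] at h₃
  refine h₃.trans ((Finset.sum_nsmul _ _ _).symm.trans ?_)
  refine Finset.sum_congr rfl fun s _ => ?_
  rw [← Nat.cast_pow, word_natCast_mul b isConnecting_circle _ _ (hwj.apply_iterate s)]

/-- Invariance under cyclic rotation, in terms of coefficients. -/
def RotInv (x : Cyc (ofModule R M) (p ^ j)) : Prop :=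
  ∀ w : ℕ → β, Function.IsPeriodicPt seqShift (p ^ j) w → coef b (seqShift w) x = coef b w x

theorem RotInv.iterate {x : Cyc (ofModule R M) (p ^ j)} (hx : RotInv b x) {w : ℕ → β}
    (hw : Function.IsPeriodicPt seqShift (p ^ j) w) (s : ℕ) :
    coef b (seqShift^[s] w) x = coef b w x := by
  induction s with
  | zero => rfl
  | succ s ih => rw [Function.iterate_succ_apply', hx _ (hw.apply_iterate s), ih]

theorem RotInv.rot {x : Cyc (ofModule R M) (p ^ j)} (hx : RotInv b x) (c : Fin (p ^ j)) :
    Cyc.rot (ofModule R M) (p ^ j) c x = x := by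
  refine coef_ext b isConnecting_circle fun w hw => ?_
  have : c = Fin.ofNat (p ^ j) c := by simp
  rw [this, coef_rot b _ hw, hx.iterate b hw]

theorem RotInv.add {x y : Cyc (ofModule R M) (p ^ j)} (hx : RotInv b x) (hy : RotInv b y) :
    RotInv b (x + y) := fun w hw => by rw [map_add, map_add, hx w hw, hy w hw]

theorem RotInv.sub {x y : Cyc (ofModule R M) (p ^ j)} (hx : RotInv b x) (hy : RotInv b y) :
    RotInv b (x - y) := fun w hw => by rw [map_sub, map_sub, hx w hw, hy w hw]

theorem exists_minimalPeriod_eq {X : Type*} {σ : X → X} {w : X}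
    (h : Function.IsPeriodicPt σ (p ^ j) w) :
    ∃ r ≤ j, Function.minimalPeriod σ w = p ^ r ∧ Function.IsPeriodicPt σ (p ^ r) w := by
  obtain ⟨r, hr, hr'⟩ := (Nat.dvd_prime_pow Fact.out).1 h.minimalPeriod_dvd
  exact ⟨r, hr, hr', hr' ▸ Function.isPeriodicPt_minimalPeriod σ w⟩

/-- A rotation invariant tensor is a transfer if its coefficients are divisible by the orders of
the stabilisers. -/
theorem exists_cycTr_eq {x : Cyc (ofModule R M) (p ^ j)} (hx : RotInv b x)
    (hdvd : ∀ r ≤ j, ∀ w : ℕ → β, Function.IsPeriodicPt seqShift (p ^ r) w →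
      (p : R) ^ (j - r) ∣ coef b w x) :
    ∃ y, cycTr p (ofModule R M) j y = x := by
  suffices x ∈ (cycTr p (ofModule R M) j).range from this
  obtain ⟨S, hS, hx'⟩ := exists_eq_sum_orbits b isConnecting_circle x
  rw [hx']
  refine sum_mem fun w hw => ?_
  obtain ⟨r, hrj, hr, hwr⟩ := exists_minimalPeriod_eq (hS w hw)
  obtain ⟨d, hd⟩ := hdvd r hrj w hwr
  refine ⟨word b _ d w, ?_⟩
  -- The transfer of `d` times the word counts its orbit `p^(j-r)` times, which restores the
  -- coefficient `p^(j-r) d`.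
  rw [cycTr_word b d (hS w hw), orbitSum_of_le b hrj le_rfl d hwr, orbitSum, hr, ← hd]
  refine Finset.sum_congr rfl fun s _ => ?_
  rw [hx.iterate b (hS w hw)]

/-- Rotations and tensor powers both read coefficients along the shift orbit of `w`. This reduces
every statement on ghost maps to sequences of scalars. -/
theorem coef_ghost (a : Coords p n (ofModule R M)) {w : ℕ → β}
    (hw : Function.IsPeriodicPt seqShift (p ^ j) w) :
    coef b w (ghost p n a j) = ∑ i : Fin n, if (i : ℕ) ≤ j then
      cosetNorm p (fun s => coef b (seqShift^[s] w) (a i)) i j else 0 := by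
  rw [ghost, map_sum]
  refine Finset.sum_congr rfl fun i _ => ?_
  split_ifs with h
  · rw [map_sum]
    refine Finset.sum_congr rfl fun s _ => ?_
    rw [coef_rot b s hw, coef_cycPow]
    refine Finset.prod_congr rfl fun l _ => ?_
    rw [← Function.iterate_add_apply, add_comm]
  · exact map_zero _

theorem periodic_coef {r : ℕ} {w : ℕ → β} (hw : Function.IsPeriodicPt seqShift (p ^ r) w)
    {L : ℕ} {adj : Fin L → Fin L → Prop} (x : BalTens R M L adj) :
    Function.Periodic (fun s => coef b (seqShift^[s] w) x) (p ^ r) :=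
  periodic_iterate_seqShift hw fun w => coef b w x

theorem rotInv_ghost (a : Coords p n (ofModule R M)) : RotInv b (ghost p n a j) := by
  intro w hw
  rw [coef_ghost b a hw, coef_ghost b a hw.apply]
  refine Finset.sum_congr rfl fun i _ => ?_
  split_ifs with h
  · exact cosetNorm_shift h (periodic_coef b hw (a i))
  · rfl

/-- `y` is congruent to the Frobenius of `x` modulo transfers, in terms of coefficients. -/
def DworkCong (ψ : R →+* R) (x : Cyc (ofModule R M) (p ^ j))
    (y : Cyc (ofModule R M) (p ^ (j + 1))) : Prop :=
  ∀ r ≤ j, ∀ w : ℕ → β, Function.IsPeriodicPt seqShift (p ^ r) w →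
    (p : R) ^ (j + 1 - r) ∣ coef b w y - ψ (coef b w x)

variable {ψ : R →+* R}

theorem DworkCong.add {x x' : Cyc (ofModule R M) (p ^ j)}
    {y y' : Cyc (ofModule R M) (p ^ (j + 1))} (h : DworkCong b ψ x y) (h' : DworkCong b ψ x' y') :
    DworkCong b ψ (x + x') (y + y') := fun r hr w hw => by
  rw [map_add, map_add, map_add, add_sub_add_comm]
  exact dvd_add (h r hr w hw) (h' r hr w hw)

theorem DworkCong.sub {x x' : Cyc (ofModule R M) (p ^ j)}
    {y y' : Cyc (ofModule R M) (p ^ (j + 1))} (h : DworkCong b ψ x y) (h' : DworkCong b ψ x' y') :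
    DworkCong b ψ (x - x') (y - y') := fun r hr w hw => by
  rw [map_sub, map_sub, map_sub, sub_sub_sub_comm]
  exact dvd_sub (h r hr w hw) (h' r hr w hw)

/-- The congruence with source `0` is the required divisibility at periods `p^r`, `r ≤ j`; at the
period `p^(j+1)` nothing is required. -/
theorem DworkCong.exists_cycTr {y : Cyc (ofModule R M) (p ^ (j + 1))}
    (h : DworkCong b ψ (0 : Cyc (ofModule R M) (p ^ j)) y) (hy : RotInv b y) :
    ∃ z, cycTr p (ofModule R M) (j + 1) z = y := by
  refine exists_cycTr_eq b hy fun r hr w hw => ?_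
  obtain hr | rfl := hr.lt_or_eq
  · simpa using h r (Nat.lt_succ_iff.1 hr) w hw
  · simp

/-- The terms `i ≤ j` are matched by `cosetNorm_frobenius`. The new term `i = j + 1` has no
counterpart in `w_j`, but repetition of its cosets makes it divisible by `p^(j+1-r)`. -/
theorem dworkCong_ghost (hψ : ∀ x, (p : R) ∣ x ^ p - ψ x) (a : Coords p n (ofModule R M)) :
    DworkCong b ψ (ghost p n a j) (ghost p n a (j + 1)) := by
  intro r hr w hw
  rw [coef_ghost b a (isPeriodicPt_pow_le hr hw),
    coef_ghost b a (isPeriodicPt_pow_le (hr.trans j.le_succ) hw), map_sum,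
    ← Finset.sum_sub_distrib]
  refine Finset.dvd_sum fun i _ => ?_
  obtain h | h | h : (i : ℕ) ≤ j ∨ (i : ℕ) = j + 1 ∨ j + 1 < i := by omega
  · rw [if_pos h, if_pos (h.trans j.le_succ)]
    exact cosetNorm_frobenius hψ (periodic_coef b hw (a i)) h hr
  · rw [if_pos h.le, if_neg (by omega), map_zero, sub_zero]
    have := pow_dvd_cosetNorm (i := (i : ℕ)) (j := j + 1) (periodic_coef b hw (a i)) (by omega)
    exact (pow_dvd_pow _ (by omega)).trans this
  · rw [if_neg (by omega), if_neg (by omega), map_zero, sub_zero]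
    exact dvd_zero _

theorem ghost_congr {B : RBimod.{u, v}} {a a' : Coords p n B}
    (h : ∀ i : Fin n, (i : ℕ) ≤ j → a i = a' i) : ghost p n a j = ghost p n a' j := by
  refine Finset.sum_congr rfl fun i _ => ?_
  split_ifs with hi
  · rw [h i hi]
  · rfl

/-- The coordinate `a_j` enters `w_j` without being raised to a power, hence additively, through the
transfer. In use, `y` and `y'` are classes of one tensor in the two quotients. -/
theorem ghost_update_add (a : Coords p n (ofModule R M)) (hj : j < n)
    (y : Tens (ofModule R M) (p ^ j)) (y' : Cyc (ofModule R M) (p ^ j))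
    (hy : ∀ w, coef b w y' = coef b w y) :
    ghost p n (Function.update a ⟨j, hj⟩ (a ⟨j, hj⟩ + y)) j =
      ghost p n a j + cycTr p (ofModule R M) j y' := by
  refine coef_ext b isConnecting_circle fun w hw => ?_
  rw [map_add, coef_ghost b _ hw, coef_ghost b _ hw, ← sub_eq_iff_eq_add',
    ← Finset.sum_sub_distrib, Finset.sum_eq_single ⟨j, hj⟩]
  · rw [if_pos le_rfl, if_pos le_rfl, coef_cycTr b hw, Function.update_self]
    simp [cosetNorm, hy, Finset.sum_add_distrib]
  · intro i _ hi
    rw [Function.update_of_ne hi, sub_self]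
  · simp

theorem RotInv.exists_cycTr_zero {x : Cyc (ofModule R M) (p ^ 0)} (hx : RotInv b x) :
    ∃ y, cycTr p (ofModule R M) 0 y = x :=
  exists_cycTr_eq b hx fun r _ w _ => by
    rw [Nat.zero_sub, pow_zero]
    exact one_dvd _

/-- If the components of index `j - 1` agree, subtracting the two Dwork congruences leaves one with
source `0`. For `j = 0` the transfer is the identity. -/
theorem exists_cycTr_eq_sub_ghost (hψ : ∀ x, (p : R) ∣ x ^ p - ψ x)
    (g : (j : ℕ) → Cyc (ofModule R M) (p ^ j)) (hg : RotInv b (g j))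
    (hgψ : ∀ i, i + 1 = j → DworkCong b ψ (g i) (g (i + 1)))
    (c : Coords p n (ofModule R M)) (hc : ∀ i < j, ghost p n c i = g i) :
    ∃ y, cycTr p (ofModule R M) j y = g j - ghost p n c j := by
  have hinv : RotInv b (g j - ghost p n c j) := hg.sub b (rotInv_ghost b c)
  cases j with
  | zero => exact hinv.exists_cycTr_zero b
  | succ m =>
    have h := (hgψ m rfl).sub b (dworkCong_ghost b hψ c)
    have h0 : g m - ghost p n c m = 0 := sub_eq_zero.2 (hc m (Nat.lt_succ_self m)).symm
    rw [h0] at h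
    exact h.exists_cycTr b hinv

/-- Dwork's lemma: a sequence of rotation invariant tensors satisfying the congruences is the
sequence of ghost components of some coordinates, the first of which may be prescribed. -/
theorem exists_ghost_eq (hψ : ∀ x, (p : R) ∣ x ^ p - ψ x)
    (g : (j : ℕ) → Cyc (ofModule R M) (p ^ j)) (hg : ∀ j < n, RotInv b (g j))
    (hgψ : ∀ j, j + 1 < n → DworkCong b ψ (g j) (g (j + 1))) {i₀ : ℕ} (hi₀ : i₀ ≤ n)
    (c₀ : Coords p n (ofModule R M)) (hc₀ : ∀ j < i₀, ghost p n c₀ j = g j) :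
    ∃ c : Coords p n (ofModule R M), (∀ i : Fin n, (i : ℕ) < i₀ → c i = c₀ i) ∧
      ∀ j < n, ghost p n c j = g j := by
  suffices ∀ m, i₀ ≤ m → m ≤ n → ∃ c : Coords p n (ofModule R M),
      (∀ i : Fin n, (i : ℕ) < i₀ → c i = c₀ i) ∧ ∀ j < m, ghost p n c j = g j from
    this n hi₀ le_rfl
  intro m hm
  induction m, hm using Nat.le_induction with
  | base => exact fun _ => ⟨c₀, fun _ _ => rfl, hc₀⟩
  | succ m him ih =>
    intro hmn
    obtain ⟨c, hc, hcg⟩ := ih (Nat.le_of_succ_le hmn)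
    -- The error in `w_m` is a transfer, so it is absorbed by adding a preimage to coordinate `m`;
    -- this does not affect `w_j` for `j < m`.
    obtain ⟨y', hy'⟩ := exists_cycTr_eq_sub_ghost b hψ g (hg m hmn)
      (fun i hi => hgψ i (hi ▸ hmn)) c hcg
    obtain ⟨t, rfl⟩ := Submodule.Quotient.mk_surjective _ y'
    refine ⟨Function.update c ⟨m, hmn⟩ (c ⟨m, hmn⟩ + Submodule.Quotient.mk t), fun i hi => ?_,
      fun j hj => ?_⟩
    · rw [Function.update_of_ne (fun h => by subst h; exact absurd hi (by simpa using him)),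
        hc i hi]
    · obtain hj | rfl := (Nat.lt_succ_iff.1 hj).lt_or_eq
      · rw [← hcg j hj]
        refine ghost_congr fun i hi => Function.update_of_ne (fun h => ?_) _ _
        subst h
        exact absurd hi (by simpa using hj)
      · rw [ghost_update_add b c hmn _ (Submodule.Quotient.mk t)
          (fun w => (coef_mk b w t).trans (coef_mk b w t).symm), hy']
        exact add_sub_cancel _ _

end

end RBimod

namespace RBimod

noncomputable section

universe u₁ v₁

/-! ### Homomorphisms out of free bimodules over commutative rings -/

theorem Tens.map_surjective {B : RBimod.{u, v}} {B' : RBimod.{u₁, v₁}} (f : Hom B B')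
    (hf : Function.Surjective f.onMod) (L : ℕ) [NeZero L] :
    Function.Surjective (Tens.map f L) := by
  intro y
  obtain ⟨y, rfl⟩ := Submodule.Quotient.mk_surjective _ y
  induction y using tensZ_induction with
  | add a b ha hb =>
    obtain ⟨x, hx⟩ := ha
    obtain ⟨y, hy⟩ := hb
    exact ⟨x + y, by rw [map_add, hx, hy]; rfl⟩
  | tprod m =>
    choose g hg using hf
    refine ⟨Submodule.Quotient.mk (tprod ℤ fun i => g (m i)),
      congrArg Submodule.Quotient.mk ?_⟩
    rw [tensZMap, PiTensorProduct.map_tprod]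
    congr 1
    funext i
    exact hg (m i)

theorem Coords.map_surjective (p : ℕ) [Fact p.Prime] (n : ℕ) {B : RBimod.{u, v}}
    {B' : RBimod.{u₁, v₁}} (f : Hom B B') (hf : Function.Surjective f.onMod) :
    Function.Surjective (Coords.map p n f) := by
  intro y
  choose x hx using fun i : Fin n => Tens.map_surjective f hf (p ^ (i : ℕ)) (y i)
  exact ⟨x, funext hx⟩

/-- The morphism from the free abelian group on a set to a bimodule. -/
def intLift (B : RBimod.{u, v}) {Y : Type v₁} (g : Y → B.M) : Hom (ofModule ℤ (Y →₀ ℤ)) B where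
  onRing := Int.castRingHom B.R
  onMod := Finsupp.liftAddHom fun y => (smulAddHom ℤ B.M).flip (g y)
  map_smul r m := by
    rw [eq_intCast, Int.cast_smul_eq_zsmul]
    exact map_zsmul _ r m
  map_op_smul r m := by
    rw [eq_intCast, MulOpposite.op_intCast, Int.cast_smul_eq_zsmul]
    exact map_zsmul _ r m

theorem intLift_single (B : RBimod.{u, v}) {Y : Type v₁} (g : Y → B.M) (y : Y) :
    (intLift B g).onMod (Finsupp.single y 1) = g y := by
  refine (Finsupp.liftAddHom_apply_single _ _ _).trans ?_
  simp

theorem int_hom_ext {B : RBimod.{u, v}} {Y : Type v₁} {f g : Hom (ofModule ℤ (Y →₀ ℤ)) B}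
    (h : ∀ y, f.onMod (Finsupp.single y 1) = g.onMod (Finsupp.single y 1)) : f = g := by
  refine Hom.ext' (RingHom.ext_int _ _) (Finsupp.addHom_ext' fun y => AddMonoidHom.ext_int ?_)
  exact h y

/-- Every sequence of coordinates thus lifts to a free abelian group, where the identity of `ℤ` is a
Frobenius lift and coefficients are available. -/
theorem intLift_surjective (B : RBimod.{u, v}) :
    Function.Surjective (intLift B fun m : B.M => m).onMod :=
  fun m => ⟨_, intLift_single B _ m⟩

theorem comp_intLift {B : RBimod.{u, v}} {B' : RBimod.{u₁, v₁}} {Y : Type*} (f : Hom B B')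
    (g : Y → B.M) : f.comp (intLift B g) = intLift B' fun y => f.onMod (g y) :=
  int_hom_ext fun y =>
    (congrArg f.onMod (intLift_single B g y)).trans
      (intLift_single B' (fun y => f.onMod (g y)) y).symm

theorem counit_of (B : RBimod.{u, v}) (m : B.M) :
    (counit B).onMod (FreeBimodule.of m) = m :=
  freeLift_of B (fun r => r) (fun m => m) m

theorem coverMap_of {B : RBimod.{u, v}} {B' : RBimod.{u₁, v₁}} (f : Hom B B') (m : B.M) :
    (coverMap f).onMod (FreeBimodule.of m) = FreeBimodule.of (f.onMod m) :=
  freeLift_of (cover B') _ _ m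

/-- Sequences with integral lifts that have the same ghost components represent the same Witt
vector. -/
theorem mk_intLift_eq_of_ghost_eq {p n : ℕ} [Fact p.Prime] (B : RBimod.{u, v})
    {q q' : Coords p n (ofModule ℤ (B.M →₀ ℤ))} (h : ∀ j < n, ghost p n q j = ghost p n q' j) :
    Witt.mk p n (Coords.map p n (intLift B fun m => m) q) =
      Witt.mk p n (Coords.map p n (intLift B fun m => m) q') := by
  have h₁ : (counit B).comp (intLift (cover B) fun m => FreeBimodule.of m) =
      intLift B fun m => m := by
    rw [comp_intLift]
    congr 1
    funext m
    exact counit_of B m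
  -- Doubly formal generators have the same image under both maps `FUFU ⇉ FU`. So `z` is the image
  -- of `q`, and both of its images have the ghost components common to `q` and `q'`.
  refine Quot.sound ⟨Coords.map p n (intLift (cover B) fun m => FreeBimodule.of m) q,
    Coords.map p n (intLift (cover B) fun m => FreeBimodule.of m) q',
    Coords.map p n (intLift (cover (cover B)) fun m => FreeBimodule.of (FreeBimodule.of m)) q,
    ?_, ?_, fun j hj => ⟨?_, ?_⟩⟩
  · rw [← Coords.map_comp, h₁]
  · rw [← Coords.map_comp, h₁]
  · rw [← Coords.map_comp, comp_intLift]
    congr 3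
    funext m
    exact (counit_of (cover B) _).symm
  · rw [← Coords.map_comp, comp_intLift, ghost_map, ← h j hj, ← ghost_map]
    congr 3
    funext m
    exact ((coverMap_of (counit B) _).trans (congrArg FreeBimodule.of (counit_of B m))).symm

section Comm

variable {R : Type u} {M : Type v} {Λ : Type u₁} {E : Type v₁} [CommRing Λ] [AddCommGroup E]
  [Module Λ E]

/-- The morphism from the free module on a set over a polynomial ring. -/
def commLift (α : R → Λ) (g : M → E) : Hom (commCover R M) (ofModule Λ E) :=
  letI ε : MvPolynomial R ℤ →+* Λ := (MvPolynomial.aeval α).toRingHom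
  letI e : (M →₀ MvPolynomial R ℤ) →+ E :=
    Finsupp.liftAddHom fun m => ((smulAddHom Λ E).flip (g m)).comp ε.toAddMonoidHom
  have he : ∀ (t : MvPolynomial R ℤ) (x : M →₀ MvPolynomial R ℤ), e (t • x) = ε t • e x := by
    intro t x
    induction x using Finsupp.induction_linear with
    | zero => simp
    | add a b ha hb => simp only [smul_add, map_add, ha, hb]
    | single m c =>
      rw [Finsupp.smul_single, smul_eq_mul]
      simp only [e, Finsupp.liftAddHom_apply_single, AddMonoidHom.comp_apply]
      exact (congrArg (fun c : Λ => c • g m) (map_mul ε t c)).trans (mul_smul _ _ _)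
  { onRing := ε
    onMod := e
    map_smul := he
    map_op_smul := he }

theorem commLift_single (α : R → Λ) (g : M → E) (m : M) :
    (commLift α g).onMod (Finsupp.single m 1) = g m := by
  refine (Finsupp.liftAddHom_apply_single _ _ _).trans ?_
  change MvPolynomial.aeval α (1 : MvPolynomial R ℤ) • g m = g m
  rw [map_one, one_smul]

theorem comm_hom_ext {B : RBimod} {f g : Hom (commCover R M) B}
    (h₁ : ∀ r, f.onRing (MvPolynomial.X r) = g.onRing (MvPolynomial.X r))
    (h₂ : ∀ m, f.onMod (Finsupp.single m 1) = g.onMod (Finsupp.single m 1)) : f = g := by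
  have hR : f.onRing = g.onRing := MvPolynomial.ringHom_ext
    (fun n => by
      rw [← RingHom.comp_apply, ← RingHom.comp_apply]; congr 1; exact RingHom.ext_int _ _)
    h₁
  refine Hom.ext' hR (Finsupp.addHom_ext fun m c => ?_)
  have h : Finsupp.single m c = c • (Finsupp.single m 1 : M →₀ MvPolynomial R ℤ) := by
    rw [Finsupp.smul_single, smul_eq_mul, mul_one]
  rw [h]
  exact (f.map_smul c _).trans (((congrArg₂ (· • ·) (congrArg (fun e => e c) hR) (h₂ m))).trans
    (g.map_smul c _).symm)

end Comm

theorem commCounit_surjective (R : Type u) (M : Type v) [CommRing R] [AddCommGroup M]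
    [Module R M] : Function.Surjective (commCounit R M).onMod :=
  fun m => ⟨_, commLift_single _ _ m⟩

/-! ### Coefficients and base change -/

section BaseChange

variable {R : Type u} {M : Type v} [CommRing R] [AddCommGroup M] [Module R M]
  {R' : Type u₁} {M' : Type v₁} [CommRing R'] [AddCommGroup M'] [Module R' M']
  {β : Type*} {L : ℕ}

theorem coef_tensMap [NeZero L] (b : Module.Basis β R M) (b' : Module.Basis β R' M')
    (f : Hom (ofModule R M) (ofModule R' M'))
    (hf : ∀ m i, b'.repr (f.onMod m) i = f.onRing (b.repr m i)) (w : ℕ → β)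
    (x : Tens (ofModule R M) L) :
    coef b' w (Tens.map f L x) = f.onRing (coef b w x) := by
  obtain ⟨x, rfl⟩ := Submodule.Quotient.mk_surjective _ x
  change coefZ b' L w _ = f.onRing (coefZ b L w x)
  induction x using tensZ_induction with
  | add x y hx hy => rw [map_add, map_add, map_add, hx, hy]; exact (map_add f.onRing _ _).symm
  | tprod m =>
    rw [coefZ_tprod, tensZMap, PiTensorProduct.map_tprod, coefZ_tprod]
    refine Eq.trans ?_ (map_prod f.onRing _ _).symm
    exact Finset.prod_congr rfl fun i _ => hf (m i) (w i)

theorem toTensorPower_injective [NeZero L] :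
    Function.Injective (Cyc.toTensorPower R M L) := by
  rw [injective_iff_map_eq_zero]
  intro x hx
  obtain ⟨x, rfl⟩ := Submodule.Quotient.mk_surjective _ x
  exact mk_eq_zero_of_tensorOver isConnecting_circle hx

theorem toTensorPower_mk_tprod (m : Fin L → M) :
    Cyc.toTensorPower R M L (Submodule.Quotient.mk (tprod ℤ m)) = tprod R m :=
  tensorOver_tprod m

/-- `Cyc` carries only its additive structure here, so `r x` is provided as an element, together
with its behaviour under base change. -/
theorem exists_toTensorPower_smul [NeZero L] (r : R) (x : Cyc (ofModule R M) L) :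
    ∃ y : Cyc (ofModule R M) L,
      (∀ f : Hom (ofModule R M) (ofModule R' M'), Cyc.toTensorPower R' M' L (Cyc.map f L y) =
        f.onRing r • Cyc.toTensorPower R' M' L (Cyc.map f L x)) ∧
      Cyc.toTensorPower R M L y = r • Cyc.toTensorPower R M L x := by
  obtain ⟨x, rfl⟩ := Submodule.Quotient.mk_surjective _ x
  induction x using tensZ_induction with
  | add x₁ x₂ h₁ h₂ =>
    obtain ⟨y₁, h₁, h₁'⟩ := h₁
    obtain ⟨y₂, h₂, h₂'⟩ := h₂
    refine ⟨y₁ + y₂, fun f => ?_, ?_⟩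
    · rw [map_add, map_add, h₁, h₂, ← smul_add, ← map_add, ← map_add]; rfl
    · rw [map_add, h₁', h₂', ← smul_add, ← map_add]; rfl
  | tprod m =>
    refine ⟨Submodule.Quotient.mk (tprod ℤ (Function.update m 0 (r • m 0))), fun f => ?_, ?_⟩
    · have h : ∀ m : Fin L → M, Cyc.map f L (Submodule.Quotient.mk (tprod ℤ m)) =
          Submodule.Quotient.mk (tprod ℤ fun i => f.onMod (m i)) := fun m =>
        congrArg Submodule.Quotient.mk (PiTensorProduct.map_tprod _ _)
      have h' : (fun i => f.onMod (Function.update m 0 (r • m 0) i)) =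
          Function.update (fun i => f.onMod (m i)) 0 (f.onRing r • f.onMod (m 0)) := by
        funext i
        by_cases hi : i = 0
        · subst hi; simpa using f.map_smul r _
        · simp [hi]
      rw [h, h, h', toTensorPower_mk_tprod, toTensorPower_mk_tprod,
        MultilinearMap.map_update_smul]
      congr 2
      exact Function.update_eq_self 0 fun i => f.onMod (m i)
    · rw [toTensorPower_mk_tprod, toTensorPower_mk_tprod, MultilinearMap.map_update_smul,
        Function.update_eq_self]

theorem coef_of_toTensorPower_smul [NeZero L] (b : Module.Basis β R M) {r : R}
    {x y : Cyc (ofModule R M) L}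
    (h : Cyc.toTensorPower R M L y = r • Cyc.toTensorPower R M L x) {w : ℕ → β}
    (hw : Function.IsPeriodicPt seqShift L w) : coef b w y = r * coef b w x := by
  have hw' : wordExt (fun i : Fin L => w i) = w := by
    funext i
    exact (seqShift_periodic hw).map_mod_nat i
  have key : ∀ z : Cyc (ofModule R M) L, coef b w z =
      (Basis.piTensorProduct fun _ : Fin L => b).repr (Cyc.toTensorPower R M L z)
        fun i : Fin L => w i := by
    intro z
    obtain ⟨z, rfl⟩ := Submodule.Quotient.mk_surjective _ z
    exact (((repr_tensorOver b z fun i : Fin L => w i).trans (by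
      rw [hw', coef_mk]))).symm
  rw [key, key, h, map_smul, Finsupp.smul_apply, smul_eq_mul]

theorem toTensorPower_surjective [NeZero L] :
    Function.Surjective (Cyc.toTensorPower R M L) := by
  intro t
  induction t using PiTensorProduct.induction_on with
  | add a b ha hb =>
    obtain ⟨x, rfl⟩ := ha
    obtain ⟨y, rfl⟩ := hb
    exact ⟨x + y, map_add _ _ _⟩
  | smul_tprod c m =>
    refine ⟨Submodule.Quotient.mk (tprod ℤ (Function.update m 0 (c • m 0))), ?_⟩
    rw [toTensorPower_mk_tprod, MultilinearMap.map_update_smul, Function.update_eq_self]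

end BaseChange

end

end RBimod

namespace RBimod

noncomputable section

universe u₁ v₁

/-! ### Classes in the cokernel of the transfer -/

section CycClass

variable {Λ : Type u} {E : Type v} [CommRing Λ] [AddCommGroup E] [Module Λ E]

theorem toTensorPower_rot {L : ℕ} [NeZero L] (c : Fin L) (x : Cyc (ofModule Λ E) L) :
    Cyc.toTensorPower Λ E L (Cyc.rot (ofModule Λ E) L c x) =
      cycRot Λ E L c (Cyc.toTensorPower Λ E L x) := by
  obtain ⟨x, rfl⟩ := Submodule.Quotient.mk_surjective _ x
  change tensorOver Λ E L (rotZ E L c x) = cycRot Λ E L c (tensorOver Λ E L x)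
  induction x using tensZ_induction with
  | add x y hx hy => simp only [map_add, hx, hy]
  | tprod m => rw [rotZ, reindex_tprod, tensorOver_tprod, tensorOver_tprod, cycRot, reindex_tprod]

theorem toTensorPower_map {E' : Type u₁} [AddCommGroup E'] [Module Λ E'] {L : ℕ} [NeZero L]
    (g : E →ₗ[Λ] E') (x : Cyc (ofModule Λ E) L) :
    Cyc.toTensorPower Λ E' L (Cyc.map (ofLinearMap g) L x) =
      tensPowMap L g (Cyc.toTensorPower Λ E L x) := by
  obtain ⟨x, rfl⟩ := Submodule.Quotient.mk_surjective _ x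
  change tensorOver Λ E' L (tensZMap (ofLinearMap g) L x) = tensPowMap L g (tensorOver Λ E L x)
  induction x using tensZ_induction with
  | add x y hx hy => simp only [map_add, hx, hy]
  | tprod m =>
    rw [tensZMap, PiTensorProduct.map_tprod, tensorOver_tprod, tensorOver_tprod, tensPowMap,
      PiTensorProduct.map_tprod]
    rfl

variable {p : ℕ} [Fact p.Prime] {j : ℕ}

theorem toTensorPower_cycTr (x : Cyc (ofModule Λ E) (p ^ j)) :
    Cyc.toTensorPower Λ E (p ^ j) (cycTr p (ofModule Λ E) j x) =
      cycTransfer Λ E (p ^ j) (Cyc.toTensorPower Λ E (p ^ j) x) := by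
  rw [cycTr_apply, map_sum, cycTransfer_apply, Finset.sum_range]
  refine Finset.sum_congr rfl fun c _ => ?_
  rw [toTensorPower_rot]
  congr 2
  simp

/-- The class of an invariant tensor in the cokernel of the transfer. -/
def cycClass {β : Type*} (b : Module.Basis β Λ E) (x : Cyc (ofModule Λ E) (p ^ j))
    (hx : RotInv b x) : CycQ Λ E (p ^ j) :=
  Submodule.Quotient.mk ⟨Cyc.toTensorPower Λ E (p ^ j) x, fun c => by
    rw [← toTensorPower_rot, hx.rot]⟩

variable {β : Type*} (b : Module.Basis β Λ E)

theorem cycClass_add {x y : Cyc (ofModule Λ E) (p ^ j)} (hx : RotInv b x) (hy : RotInv b y) :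
    cycClass b (x + y) (hx.add b hy) = cycClass b x hx + cycClass b y hy :=
  congrArg Submodule.Quotient.mk (Subtype.ext (map_add _ _ _))

theorem cycClass_smul {x y : Cyc (ofModule Λ E) (p ^ j)} (hx : RotInv b x) (hy : RotInv b y)
    (r : Λ) (h : Cyc.toTensorPower Λ E _ y = r • Cyc.toTensorPower Λ E _ x) :
    cycClass b y hy = r • cycClass b x hx :=
  congrArg Submodule.Quotient.mk (Subtype.ext h)

theorem cycClass_eq_iff {x y : Cyc (ofModule Λ E) (p ^ j)} (hx : RotInv b x) (hy : RotInv b y) :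
    cycClass b x hx = cycClass b y hy ↔ ∃ z, cycTr p (ofModule Λ E) j z = x - y := by
  refine (Submodule.Quotient.eq _).trans ⟨?_, ?_⟩
  · rintro ⟨t, ht⟩
    obtain ⟨z, rfl⟩ := toTensorPower_surjective t
    refine ⟨z, toTensorPower_injective ?_⟩
    rw [toTensorPower_cycTr, ht]
    exact (map_sub (Cyc.toTensorPower Λ E (p ^ j)) x y).symm
  · rintro ⟨z, hz⟩
    refine ⟨Cyc.toTensorPower Λ E _ z, ?_⟩
    rw [← toTensorPower_cycTr, hz]
    exact map_sub (Cyc.toTensorPower Λ E (p ^ j)) x y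

theorem cycClass_surjective (q : CycQ Λ E (p ^ j)) : ∃ x hx, cycClass b x hx = q := by
  obtain ⟨⟨t, ht⟩, rfl⟩ := Submodule.Quotient.mk_surjective _ q
  obtain ⟨x, rfl⟩ := toTensorPower_surjective t
  refine ⟨x, fun w hw => ?_, rfl⟩
  -- Rotation by the generator `1` corresponds to a single shift of words.
  have h := ht (Fin.ofNat _ 1)
  rw [← toTensorPower_rot] at h
  have h' := coef_rot b 1 hw x
  rw [toTensorPower_injective h] at h'
  exact h'.symm

/-- The class of `∑_{i < n} tr (a_i^{⊗ p^{n-i}})` in the cokernel of the transfer. -/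
def ghostClass {n : ℕ} (a : Coords p n (ofModule Λ E)) : CycQ Λ E (p ^ n) :=
  cycClass b (ghost p n a n) (rotInv_ghost b a)

theorem ghostClass_map {E' : Type u₁} [AddCommGroup E'] [Module Λ E'] {β' : Type*}
    (b' : Module.Basis β' Λ E') (g : E →ₗ[Λ] E') {n : ℕ} (a : Coords p n (ofModule Λ E)) :
    ghostClass b' (Coords.map p n (ofLinearMap g) a) =
      CycQ.map (p ^ n) g (ghostClass b a) := by
  refine congrArg Submodule.Quotient.mk (Subtype.ext ?_)
  change Cyc.toTensorPower Λ E' _ (ghost p n _ n) = tensPowMap _ g (Cyc.toTensorPower Λ E _ _)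
  rw [ghost_map, toTensorPower_map]

/-- The ghost components of a sequence of scalars. -/
def scalarGhost (p : ℕ) {R : Type*} [CommRing R] {n : ℕ} (t : Fin n → R) (j : ℕ) : R :=
  ∑ i : Fin n, if (i : ℕ) ≤ j then (p : R) ^ (i : ℕ) * t i ^ p ^ (j - i) else 0

/-- The scalar analogue of Dwork's congruence: the factor `p^i` complements the congruence modulo
`p^(j-i+1)` between powers. -/
theorem scalarGhost_frobenius {R : Type*} [CommRing R] {ψ : R →+* R}
    (hψ : ∀ x, (p : R) ∣ x ^ p - ψ x) {n : ℕ} (t : Fin n → R) (j : ℕ) :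
    (p : R) ^ (j + 1) ∣ scalarGhost p t (j + 1) - ψ (scalarGhost p t j) := by
  rw [scalarGhost, scalarGhost, map_sum, ← Finset.sum_sub_distrib]
  refine Finset.dvd_sum fun i _ => ?_
  obtain h | h | h : (i : ℕ) ≤ j ∨ (i : ℕ) = j + 1 ∨ j + 1 < i := by omega
  · rw [if_pos h, if_pos (h.trans j.le_succ), map_mul, map_pow, map_pow, map_natCast, ← mul_sub,
      Nat.sub_add_comm h]
    have e : j + 1 = (i : ℕ) + (j - i + 1) := by omega
    rw [pow_succ' p, pow_mul]
    conv_lhs => rw [e, pow_add]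
    exact mul_dvd_mul_left _ (dvd_sub_pow_of_dvd_sub (hψ _) _)
  · rw [if_pos h.le, if_neg (by omega), map_zero, sub_zero, h]
    exact Dvd.intro _ rfl
  · rw [if_neg (by omega), if_neg (by omega), map_zero, sub_zero]
    exact dvd_zero _

theorem map_scalarGhost {R R' : Type*} [CommRing R] [CommRing R'] (f : R →+* R') {n : ℕ}
    (t : Fin n → R) (j : ℕ) : f (scalarGhost p t j) = scalarGhost p (fun i => f (t i)) j := by
  simp [scalarGhost, apply_ite f]

/-- A Leibniz-type splitting: one summand uses the congruence for scalars, the other the one for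
tensors. -/
theorem DworkCong.smul {ψ : Λ →+* Λ} {x x' : Cyc (ofModule Λ E) (p ^ j)}
    {y y' : Cyc (ofModule Λ E) (p ^ (j + 1))} (h : DworkCong b ψ x y) {r r' : Λ}
    (hr : (p : Λ) ^ (j + 1) ∣ r' - ψ r)
    (hx : Cyc.toTensorPower Λ E _ x' = r • Cyc.toTensorPower Λ E _ x)
    (hy : Cyc.toTensorPower Λ E _ y' = r' • Cyc.toTensorPower Λ E _ y) :
    DworkCong b ψ x' y' := fun s hs w hw => by
  rw [coef_of_toTensorPower_smul b hx (isPeriodicPt_pow_le hs hw),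
    coef_of_toTensorPower_smul b hy (isPeriodicPt_pow_le (hs.trans j.le_succ) hw), map_mul]
  have e : r' * coef b w y - ψ r * ψ (coef b w x) =
      (r' - ψ r) * coef b w y + ψ r * (coef b w y - ψ (coef b w x)) := by ring
  rw [e]
  exact dvd_add (Dvd.dvd.mul_right ((pow_dvd_pow _ (Nat.sub_le _ _)).trans hr) _)
    (Dvd.dvd.mul_left (h s hs w hw) _)

theorem RotInv.smul {x y : Cyc (ofModule Λ E) (p ^ j)} (hx : RotInv b x) {r : Λ}
    (h : Cyc.toTensorPower Λ E _ y = r • Cyc.toTensorPower Λ E _ x) : RotInv b y :=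
  fun w hw => by
    rw [coef_of_toTensorPower_smul b h hw, coef_of_toTensorPower_smul b h hw.apply, hx w hw]

variable {n : ℕ} {ψ : Λ →+* Λ}

/-- This is how a component of index `j` controls the next one modulo transfers; additivity and
linearity of the comparison map follow from it. -/
theorem DworkCong.cycClass_eq {x x' : Cyc (ofModule Λ E) (p ^ j)}
    {y y' : Cyc (ofModule Λ E) (p ^ (j + 1))} (h : DworkCong b ψ x y) (h' : DworkCong b ψ x' y')
    (hx : x = x') (hy : RotInv b y) (hy' : RotInv b y') : cycClass b y hy = cycClass b y' hy' := by
  have h₁ := h.sub b h'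
  rw [sub_eq_zero.2 hx] at h₁
  exact (cycClass_eq_iff b hy hy').2 (h₁.exists_cycTr b (hy.sub b hy'))

theorem ghostClass_eq_of_ghost_eq (hψ : ∀ x, (p : Λ) ∣ x ^ p - ψ x)
    {a c : Coords p (n + 1) (ofModule Λ E)} (h : ghost p (n + 1) a n = ghost p (n + 1) c n) :
    ghostClass b a = ghostClass b c :=
  (dworkCong_ghost b hψ a).cycClass_eq b (dworkCong_ghost b hψ c) h _ _

theorem ghostClass_eq_add (hψ : ∀ x, (p : Λ) ∣ x ^ p - ψ x)
    {a a' c : Coords p (n + 1) (ofModule Λ E)}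
    (h : ghost p (n + 1) c n = ghost p (n + 1) a n + ghost p (n + 1) a' n) :
    ghostClass b c = ghostClass b a + ghostClass b a' :=
  ((dworkCong_ghost b hψ c).cycClass_eq b
    ((dworkCong_ghost b hψ a).add b (dworkCong_ghost b hψ a')) h _ _).trans
    (cycClass_add b (rotInv_ghost b a) (rotInv_ghost b a'))

theorem ghostClass_eq_smul (hψ : ∀ x, (p : Λ) ∣ x ^ p - ψ x)
    {a c : Coords p (n + 1) (ofModule Λ E)} (t : Fin (n + 1) → Λ)
    (h : Cyc.toTensorPower Λ E _ (ghost p (n + 1) c n) =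
      scalarGhost p t n • Cyc.toTensorPower Λ E _ (ghost p (n + 1) a n)) :
    ghostClass b c = scalarGhost p t (n + 1) • ghostClass b a := by
  obtain ⟨y, -, hy⟩ := exists_toTensorPower_smul (R' := Λ) (M' := E) (scalarGhost p t (n + 1))
    (ghost p (n + 1) a (n + 1))
  have hyi : RotInv b y := (rotInv_ghost b a).smul b hy
  rw [ghostClass, ghostClass, ← cycClass_smul b (rotInv_ghost b a) hyi _ hy]
  exact (dworkCong_ghost b hψ c).cycClass_eq b
    ((dworkCong_ghost b hψ a).smul b (scalarGhost_frobenius hψ t n) h hy) rfl _ _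

/-- At a word of period `p^r`, `cosetNorm_congr` makes the change divisible by `p^(n-r)`, which
suffices for a transfer. So the class depends only on the coordinates modulo `p`. -/
theorem ghostClass_congr {a c : Coords p n (ofModule Λ E)}
    (h : ∀ (i : Fin n) (w : ℕ → β), (p : Λ) ∣ coef b w (a i) - coef b w (c i)) :
    ghostClass b a = ghostClass b c := by
  refine (cycClass_eq_iff b _ _).2 (exists_cycTr_eq b
    ((rotInv_ghost b a).sub b (rotInv_ghost b c)) fun r hr w hw => ?_)
  have hw' := isPeriodicPt_pow_le hr hw
  rw [map_sub, coef_ghost b a hw', coef_ghost b c hw', ← Finset.sum_sub_distrib]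
  refine Finset.dvd_sum fun i _ => ?_
  rw [if_pos i.2.le, if_pos i.2.le]
  exact cosetNorm_congr (fun s => h i _) (periodic_coef b hw _) (periodic_coef b hw _) i.2.le hr

end CycClass

end

end RBimod

namespace RBimod

noncomputable section

/-! ### Orbit sums -/

variable {R : Type u} {M : Type v} [CommRing R] [AddCommGroup M] [Module R M] {β : Type*}
  (b : Module.Basis β R M) {p : ℕ} [Fact p.Prime] {n j : ℕ}

theorem word_add {L : ℕ} [NeZero L] {adj : Fin L → Fin L → Prop}
    (hadj : IsConnecting adj) (c d : R) {w : ℕ → β} (hw : Function.IsPeriodicPt seqShift L w) :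
    (word b adj (c + d) w : BalTens R M L adj) = word b adj c w + word b adj d w := by
  classical
  refine coef_ext b hadj fun w' hw' => ?_
  rw [map_add, coef_word b _ hw hw', coef_word b _ hw hw', coef_word b _ hw hw']
  split_ifs <;> simp

theorem word_zero {L : ℕ} [NeZero L] {adj : Fin L → Fin L → Prop}
    (hadj : IsConnecting adj) {w : ℕ → β} (hw : Function.IsPeriodicPt seqShift L w) :
    (word b adj 0 w : BalTens R M L adj) = 0 := by
  classical
  refine coef_ext b hadj fun w' hw' => ?_
  rw [coef_word b _ hw hw', ite_self, map_zero]

theorem word_sum {L : ℕ} [NeZero L] {adj : Fin L → Fin L → Prop}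
    (hadj : IsConnecting adj) {w : ℕ → β} (hw : Function.IsPeriodicPt seqShift L w)
    {ι : Type*} (S : Finset ι) (c : ι → R) :
    (word b adj (∑ i ∈ S, c i) w : BalTens R M L adj) = ∑ i ∈ S, word b adj (c i) w := by
  classical
  induction S using Finset.induction_on with
  | empty => simpa using word_zero b hadj hw
  | insert i S hi ih => rw [Finset.sum_insert hi, Finset.sum_insert hi, word_add b hadj _ _ hw, ih]

theorem orbitSum_add {r : ℕ} (c d : R) {w : ℕ → β}
    (hw : Function.IsPeriodicPt seqShift (p ^ j) w) :
    (orbitSum b j r (c + d) w : Cyc (ofModule R M) (p ^ j)) =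
      orbitSum b j r c w + orbitSum b j r d w := by
  rw [orbitSum, orbitSum, orbitSum, ← Finset.sum_add_distrib]
  exact Finset.sum_congr rfl fun s _ => word_add b isConnecting_circle _ _ (hw.apply_iterate s)

theorem orbitSum_rotInv {r : ℕ} (hr : r ≤ j) (c : R) {w : ℕ → β}
    (hw : Function.IsPeriodicPt seqShift (p ^ r) w) :
    RotInv b (orbitSum b j r c w : Cyc (ofModule R M) (p ^ j)) := by
  classical
  have hwj := isPeriodicPt_pow_le hr hw
  intro w' hw'
  have h : ∀ w', Function.IsPeriodicPt seqShift (p ^ j) w' →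
      coef b w' (orbitSum b j r c w : Cyc (ofModule R M) (p ^ j)) =
      ∑ s ∈ Finset.range (p ^ r), if seqShift^[s] w = w' then c else 0 := fun w' hw' => by
    rw [orbitSum, map_sum]
    exact Finset.sum_congr rfl fun s _ => coef_word b _ (hwj.apply_iterate s) hw'
  have hf : (fun s => if seqShift^[s] w = seqShift w' then c else 0) (p ^ r) =
      (fun s => if seqShift^[s] w = seqShift w' then c else 0) 0 :=
    if_congr (by rw [hw.eq]; rfl) rfl rfl
  rw [h _ hw', h _ hw'.apply,
    ← sum_range_add_one (f := fun s => if seqShift^[s] w = seqShift w' then c else 0) hf]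
  refine Finset.sum_congr rfl fun s _ => if_congr ⟨fun h => ?_, fun h => ?_⟩ rfl rfl
  · rw [Function.iterate_succ_apply'] at h
    exact (hwj.apply_iterate s).eq_of_apply_eq_same hw' (pow_pos (Fact.out : p.Prime).pos j) h
  · rw [Function.iterate_succ_apply', h]

theorem cycPow_zero (b : Module.Basis β R M) {L N L' : ℕ} [NeZero L'] (hN : N ≠ 0)
    (h : N * L = L') :
    cycPow (ofModule R M) N h 0 = 0 := by
  refine coef_ext b isConnecting_circle fun w _ => ?_
  rw [coef_cycPow, map_zero]
  simp [hN]

theorem cycPow_word {r N : ℕ} (h : N * p ^ r = p ^ j) (d : R)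
    {w : ℕ → β} (hw : Function.IsPeriodicPt seqShift (p ^ r) w) :
    cycPow (ofModule R M) N h (word b (lineAdj (p ^ r)) d w) = word b _ (d ^ N) w := by
  classical
  have hwj : Function.IsPeriodicPt seqShift (p ^ j) w := hw.trans_dvd (Dvd.intro_left _ h)
  refine coef_ext b isConnecting_circle fun w' hw' => ?_
  rw [coef_cycPow, coef_word b _ hwj hw']
  have e : ∀ l, coef b (seqShift^[l * p ^ r] w')
      (word b (lineAdj (p ^ r)) d w : Tens (ofModule R M) (p ^ r)) =
      if ∀ i < p ^ r, w i = w' (i + l * p ^ r) then d else 0 := fun l => by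
    simp only [← seqShift_iterate]
    exact coefZ_wordTens b d w _
  rw [Finset.prod_congr rfl fun l _ => e l]
  split_ifs with heq
  · subst heq
    rw [Finset.prod_congr rfl (g := fun _ => d), Finset.prod_const, Finset.card_range]
    intro l _
    exact if_pos fun i _ => ((seqShift_periodic hw).nat_mul l i).symm
  · obtain ⟨i, hi, hne⟩ : ∃ i < p ^ j, w i ≠ w' i := by
      by_contra! hcon
      exact heq (eq_of_eqOn_period (pow_pos (Fact.out : p.Prime).pos j) hwj hw' hcon)
    have hpr := pow_pos (Fact.out : p.Prime).pos r
    -- A letter `i` where the words differ lies in block `i / p^r`, whose factor vanishes.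
    refine Finset.prod_eq_zero (i := i / p ^ r) (Finset.mem_range.2 ?_) (if_neg fun hcon => hne ?_)
    · rwa [Nat.div_lt_iff_lt_mul hpr, h]
    · have := hcon (i % p ^ r) (Nat.mod_lt _ hpr)
      rw [mul_comm, Nat.mod_add_div] at this
      rw [← this, (seqShift_periodic hw).map_mod_nat]

theorem ghost_single_word {r : ℕ} (hr : r < n) (d : R) {w : ℕ → β}
    (hw : Function.IsPeriodicPt seqShift (p ^ r) w) :
    ghost p n (Function.update (0 : Coords p n (ofModule R M)) ⟨r, hr⟩ (word b _ d w)) n =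
      orbitSum b n r (d ^ p ^ (n - r)) w := by
  rw [ghost, Finset.sum_eq_single ⟨r, hr⟩]
  · rw [dif_pos hr.le, orbitSum, ← sum_rot_word b hr.le _ hw]
    refine Finset.sum_congr rfl fun s _ => ?_
    rw [Function.update_self, cycPow_word b _ d hw]
  · intro i _ hi
    rw [dif_pos i.2.le]
    refine Finset.sum_eq_zero fun s _ => ?_
    rw [Function.update_of_ne hi, Pi.zero_apply, cycPow_zero b, map_zero]
    exact (pow_pos (Fact.out : p.Prime).pos _).ne'
  · simp

/-! ### Tensors with vanishing orbit sums -/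

/-- A tensor whose coefficients sum to zero over all orbits is a sum of differences between
tensors and their rotations. -/
theorem exists_eq_sub_rotZ (x : Tens (ofModule R M) (p ^ j))
    (hx : ∀ r ≤ j, ∀ w : ℕ → β, Function.IsPeriodicPt seqShift (p ^ r) w →
      ∑ s ∈ Finset.range (p ^ r), coef b (seqShift^[s] w) x = 0) :
    ∃ t : TensorPower ℤ (p ^ j) M,
      x = Submodule.Quotient.mk (t - rotZ M (p ^ j) (Fin.ofNat _ 1) t) := by
  let φ : TensorPower ℤ (p ^ j) M →ₗ[ℤ] Tens (ofModule R M) (p ^ j) :=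
    (Submodule.mkQ _).comp (LinearMap.id - (rotZ M (p ^ j) (Fin.ofNat _ 1)).toLinearMap)
  suffices x ∈ LinearMap.range φ by
    obtain ⟨t, ht⟩ := this
    exact ⟨t, ht.symm⟩
  -- Modulo the image of `1 - rot`, all shifts of a word are equal, one step at a time.
  have h₁ : ∀ (c : R) (w : ℕ → β), Function.IsPeriodicPt seqShift (p ^ j) w → ∀ s,
      word b _ c (seqShift^[s] w) - word b _ c w ∈ LinearMap.range φ := by
    intro c w hw s
    induction s with
    | zero => rw [Function.iterate_zero, id, sub_self]; exact zero_mem _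
    | succ s ih =>
      rw [← sub_add_sub_cancel _ (word b _ c (seqShift^[s] w)) _]
      refine add_mem ⟨wordTens b _ c (seqShift^[s + 1] w), ?_⟩ ih
      refine Eq.trans (map_sub (Submodule.mkQ (balanced (ofModule R M) (p ^ j) (lineAdj (p ^ j))))
        (wordTens b _ c (seqShift^[s + 1] w))
        (rotZ M (p ^ j) (Fin.ofNat _ 1) (wordTens b _ c (seqShift^[s + 1] w))))
        (congrArg₂ (· - ·) rfl ?_)
      refine coef_ext b isConnecting_line fun w' hw' => ?_
      refine (coefZ_rotZ b 1 hw' (wordTens b _ c (seqShift^[s + 1] w))).trans ?_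
      classical
      rw [coefZ_wordTens_of_isPeriodicPt b c (hw.apply_iterate _) (hw'.apply_iterate _),
        coef_word b c (hw.apply_iterate _) hw']
      refine if_congr ⟨fun h => ?_, fun h => ?_⟩ rfl rfl
      · rw [Function.iterate_succ_apply'] at h
        exact (hw.apply_iterate s).eq_of_apply_eq_same hw' (pow_pos (Fact.out : p.Prime).pos j) h
      · rw [Function.iterate_succ_apply', h]; rfl
  obtain ⟨S, hS, hx'⟩ := exists_eq_sum_orbits b isConnecting_line x
  rw [hx']
  refine sum_mem fun w hw => ?_
  obtain ⟨r, hrj, hr, hwr⟩ := exists_minimalPeriod_eq (hS w hw)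
  have h₂ := word_sum b isConnecting_line (hS w hw) (Finset.range (p ^ r))
    fun s => coef b (seqShift^[s] w) x
  rw [hx r hrj w hwr, word_zero b isConnecting_line (hS w hw)] at h₂
  -- The subtracted zero is written as the word `w` with each coefficient of its orbit, so that
  -- every summand becomes a difference of two shifts.
  rw [hr, ← sub_zero (∑ s ∈ _, _), h₂, ← Finset.sum_sub_distrib]
  exact sum_mem fun s _ => h₁ _ w (hS w hw) s

/-- The coefficients telescope around the circle. -/
theorem cycTr_sub_rotZ (b : Module.Basis β R M) (t : TensorPower ℤ (p ^ j) M) :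
    cycTr p (ofModule R M) j
      (Submodule.Quotient.mk (t - rotZ M (p ^ j) (Fin.ofNat _ 1) t)) = 0 := by
  refine coef_ext b isConnecting_circle fun w hw => ?_
  rw [coef_cycTr b hw, map_zero]
  have h : ∀ s, coef b (seqShift^[s] w) (Submodule.Quotient.mk
      (t - rotZ M (p ^ j) (Fin.ofNat _ 1) t) : Cyc (ofModule R M) (p ^ j)) =
      coefZ b _ (seqShift^[s] w) t - coefZ b _ (seqShift^[s + 1] w) t := fun s => by
    rw [coef_mk, map_sub, coefZ_rotZ b 1 (hw.apply_iterate s), ← Function.iterate_add_apply,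
      add_comm 1 s]
  rw [Finset.sum_congr rfl fun s _ => h s, Finset.sum_range_sub', hw.eq]
  simp

end

end RBimod

namespace ModPReduction

noncomputable section

open RBimod

universe u₁ u₂ w

variable {p : ℕ} [Fact p.Prime] {Λ : Type u₁} {k : Type u₂} [CommRing Λ] [Field k]
  (ρ : ModPReduction p Λ k) {V : Type w} [AddCommGroup V] [Module k V] {n : ℕ}

theorem dvd_iff (x : Λ) : (p : Λ) ∣ x ↔ ρ.hom x = 0 := by
  rw [← RingHom.mem_ker, ρ.ker, Ideal.mem_span_singleton]

theorem dvd_sub_iff (x y : Λ) : (p : Λ) ∣ x - y ↔ ρ.hom x = ρ.hom y := by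
  rw [ρ.dvd_iff, map_sub, sub_eq_zero]

/-! ### The comparison map -/

variable (V) in
/-- The reduction as a morphism of bimodules. -/
def redHom : Hom (ofModule Λ (FreeLift ρ V)) (ofModule k V) where
  onRing := ρ.hom
  onMod := ρ.red V
  map_smul := ρ.red_smul
  map_op_smul := ρ.red_smul

variable (V) in
/-- The standard basis of the free lift. -/
abbrev liftBasis : Module.Basis (Module.Basis.ofVectorSpaceIndex k V) Λ (FreeLift ρ V) :=
  Finsupp.basisSingleOne

theorem coef_redHom {L : ℕ} [NeZero L] (w : ℕ → Module.Basis.ofVectorSpaceIndex k V)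
    (x : Tens (ofModule Λ (FreeLift ρ V)) L) :
    coef (Module.Basis.ofVectorSpace k V) w (Tens.map (ρ.redHom V) L x) =
      ρ.hom (coef (ρ.liftBasis V) w x) := by
  refine coef_tensMap (ρ.liftBasis V) (Module.Basis.ofVectorSpace k V) (ρ.redHom V)
    (fun m i => ?_) w x
  change (Module.Basis.ofVectorSpace k V).repr (ρ.red V m) i = _
  rw [red_eq, Module.Basis.repr_linearCombination]
  rfl

variable (V) in
theorem coordsMap_redHom_surjective :
    Function.Surjective (Coords.map p n (ρ.redHom V)) :=
  Coords.map_surjective p n _ ρ.red_surjective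

theorem ghostClass_eq_of_redHom {a c : Coords p n (ofModule Λ (FreeLift ρ V))}
    (h : Coords.map p n (ρ.redHom V) a = Coords.map p n (ρ.redHom V) c) :
    ghostClass (ρ.liftBasis V) a = ghostClass (ρ.liftBasis V) c := by
  refine ghostClass_congr _ fun i w => ?_
  rw [ρ.dvd_sub_iff, ← coef_redHom, ← coef_redHom]
  exact congrArg _ (congrFun h i)

variable (V) in
/-- A lift of the counit of `(k; V)`. -/
def coverToLift : Hom (cover (ofModule k V)) (ofModule Λ (FreeLift ρ V)) :=
  freeLift _ (Function.surjInv ρ.surjective) (Function.surjInv (ρ.red_surjective (V := V)))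

theorem redHom_comp_coverToLift :
    (ρ.redHom V).comp (ρ.coverToLift V) = counit (ofModule k V) := by
  refine free_hom_ext (fun x => ?_) (fun y => ?_)
  · refine Eq.trans ?_ (freeLift_ι (ofModule k V) (fun r => r) _ x).symm
    refine (congrArg ρ.hom (freeLift_ι _ _ _ x)).trans ?_
    exact Function.surjInv_eq ρ.surjective x
  · refine Eq.trans ?_ (counit_of (ofModule k V) y).symm
    refine (congrArg (ρ.red V) (freeLift_of _ _ _ y)).trans ?_
    exact Function.surjInv_eq ρ.red_surjective y

variable (V) in
/-- A lift of the commutative counit of `(k; V)`. -/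
def commToLift : Hom (commCover k V) (ofModule Λ (FreeLift ρ V)) :=
  commLift (Function.surjInv ρ.surjective) (Function.surjInv (ρ.red_surjective (V := V)))

theorem redHom_comp_commToLift : (ρ.redHom V).comp (ρ.commToLift V) = commCounit k V := by
  refine comm_hom_ext (fun x => ?_) (fun y => ?_)
  · refine Eq.trans ?_ (MvPolynomial.aeval_X (fun r : k => r) x).symm
    refine (congrArg ρ.hom (MvPolynomial.aeval_X _ x)).trans ?_
    exact Function.surjInv_eq ρ.surjective x
  · refine Eq.trans ?_ (commLift_single (fun r : k => r) (fun m : V => m) y).symm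
    refine (congrArg (ρ.red V) (commLift_single _ _ y)).trans ?_
    exact Function.surjInv_eq ρ.red_surjective y

variable {ψ : Λ →+* Λ}

/-- The free cover maps to the lift over `Λ` compatibly with the counit, and so carries the ghost
identities there. Only the last one, `j = n`, is needed. -/
theorem ghostClass_eq_of_rel (hψ : ∀ x, (p : Λ) ∣ x ^ p - ψ x)
    {a c : Coords p (n + 1) (ofModule Λ (FreeLift ρ V))}
    (h : Rel p (n + 1) (ofModule k V) (Coords.map p (n + 1) (ρ.redHom V) a)
      (Coords.map p (n + 1) (ρ.redHom V) c)) :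
    ghostClass (ρ.liftBasis V) a = ghostClass (ρ.liftBasis V) c := by
  obtain ⟨q, u, z, hq, hu, hz⟩ := h
  have key : ∀ (q : Coords p (n + 1) (cover (ofModule k V)))
      (a : Coords p (n + 1) (ofModule Λ (FreeLift ρ V))),
      Coords.map p (n + 1) (counit (ofModule k V)) q = Coords.map p (n + 1) (ρ.redHom V) a →
      ghostClass (ρ.liftBasis V) a =
        ghostClass (ρ.liftBasis V) (Coords.map p (n + 1) (ρ.coverToLift V) q) := by
    intro q a hqa
    refine ρ.ghostClass_eq_of_redHom ?_
    rw [← hqa, ← Coords.map_comp, redHom_comp_coverToLift]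
  have key' : ∀ q q' : Coords p (n + 1) (cover (ofModule k V)),
      ghost p (n + 1) q n = ghost p (n + 1) q' n →
      ghostClass (ρ.liftBasis V) (Coords.map p (n + 1) (ρ.coverToLift V) q) =
        ghostClass (ρ.liftBasis V) (Coords.map p (n + 1) (ρ.coverToLift V) q') := by
    intro q q' hqq'
    refine ghostClass_eq_of_ghost_eq _ hψ ?_
    rw [ghost_map, ghost_map, hqq']
  obtain ⟨h₁, h₂⟩ := hz n n.lt_succ_self
  rw [key q a hq, key u c hu, key' _ _ h₁, key' _ _ h₂]
  -- The two images of `z` agree after applying the counit, so their lifts agree modulo `p`.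
  refine ρ.ghostClass_eq_of_redHom ?_
  rw [← Coords.map_comp, ← Coords.map_comp, ← Coords.map_comp, ← Coords.map_comp,
    redHom_comp_coverToLift, counit_comp_coverMap]

variable (hψ : ∀ x, (p : Λ) ∣ x ^ p - ψ x)

/-- The comparison map from Witt vectors with coefficients to the cokernel of the transfer. -/
def wittClass (x : Witt p (n + 1) (ofModule k V)) : CycQ Λ (FreeLift ρ V) (p ^ (n + 1)) :=
  Quot.lift (fun a => ghostClass (ρ.liftBasis V)
      (Function.surjInv (ρ.coordsMap_redHom_surjective V) a))
    (fun a c h => ρ.ghostClass_eq_of_rel hψ (by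
      have e := Function.surjInv_eq (ρ.coordsMap_redHom_surjective (n := n + 1) V)
      rwa [e, e])) x

theorem wittClass_mk (a : Coords p (n + 1) (ofModule Λ (FreeLift ρ V))) :
    ρ.wittClass hψ (Witt.mk p (n + 1) (Coords.map p (n + 1) (ρ.redHom V) a)) =
      ghostClass (ρ.liftBasis V) a :=
  ρ.ghostClass_eq_of_redHom (Function.surjInv_eq (ρ.coordsMap_redHom_surjective V) _)

theorem wittClass_counit (a : Coords p (n + 1) (cover (ofModule k V))) :
    ρ.wittClass hψ (Witt.mk p (n + 1) (Coords.map p (n + 1) (counit (ofModule k V)) a)) =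
      ghostClass (ρ.liftBasis V) (Coords.map p (n + 1) (ρ.coverToLift V) a) := by
  rw [← ρ.wittClass_mk hψ, ← Coords.map_comp, redHom_comp_coverToLift]

theorem wittClass_commCounit (a : Coords p (n + 1) (commCover k V)) :
    ρ.wittClass hψ (Witt.mk p (n + 1) (Coords.map p (n + 1) (commCounit k V) a)) =
      ghostClass (ρ.liftBasis V) (Coords.map p (n + 1) (ρ.commToLift V) a) := by
  rw [← ρ.wittClass_mk hψ, ← Coords.map_comp, redHom_comp_commToLift]

theorem wittClass_of_isSum {x y z : Witt p (n + 1) (ofModule k V)}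
    (h : Witt.IsSum p (n + 1) x y z) :
    ρ.wittClass hψ x + ρ.wittClass hψ y = ρ.wittClass hψ z := by
  obtain ⟨a, b, c, rfl, rfl, rfl, h⟩ := h
  rw [wittClass_counit, wittClass_counit, wittClass_counit]
  refine (ghostClass_eq_add _ hψ ?_).symm
  rw [ghost_map, ghost_map, ghost_map, h n n.lt_succ_self, map_add]

theorem ghostHom_eq (a : TruncatedWittVector p n k) (t : Fin n → Λ)
    (ht : ∀ i, ρ.hom (t i) = a.coeff i) :
    ρ.ghostHom n a = Ideal.Quotient.mk _ (scalarGhost p t n) := by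
  -- Extending the lifts by zero makes the summand `p^n x_n` of the ghost component vanish.
  let x : WittVector p Λ := WittVector.mk p fun i => if h : i < n then t ⟨i, h⟩ else 0
  have hx : ρ.wittMap n x = a := by
    ext i
    rw [wittMap, RingHom.comp_apply, WittVector.coeff_truncate, WittVector.map_coeff, ← ht]
    simp [x]
  have h : ρ.ghostHom n a = Ideal.Quotient.mk _ (WittVector.ghostComponent n x) := by
    rw [← hx]
    exact RingHom.liftOfSurjective_comp_apply ..
  rw [h, WittVector.ghostComponent_apply, aeval_wittPolynomial, Finset.sum_range_succ,
    Finset.sum_range, scalarGhost, map_add, map_sum, map_sum]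
  have h₀ : x.coeff n = 0 := by simp [x]
  rw [h₀, Nat.sub_self, pow_zero, pow_one, mul_zero, map_zero, add_zero]
  refine Finset.sum_congr rfl fun i _ => ?_
  rw [if_pos i.2.le]
  congr 3
  simp [x]

theorem wittClass_of_isSMul {a : TruncatedWittVector p (n + 1) k}
    {x y : Witt p (n + 1) (ofModule k V)} (h : Witt.IsSMul p (n + 1) a x y) :
    ∃ c : Λ, ρ.ghostHom (n + 1) a = Ideal.Quotient.mk _ c ∧
      ρ.wittClass hψ y = c • ρ.wittClass hψ x := by
  obtain ⟨t, b, c, ht, rfl, rfl, h⟩ := h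
  refine ⟨scalarGhost p (fun i => (ρ.commToLift V).onRing (t i)) (n + 1),
    ρ.ghostHom_eq a _ fun i => ?_, ?_⟩
  · rw [← ht]
    exact congrArg (fun f : Hom (commCover k V) (ofModule k V) => f.onRing (t i))
      (ρ.redHom_comp_commToLift (V := V))
  · rw [wittClass_commCounit, wittClass_commCounit]
    refine ghostClass_eq_smul _ hψ _ ?_
    obtain ⟨y, hy, hy'⟩ := exists_toTensorPower_smul (R' := Λ) (M' := FreeLift ρ V)
      (scalarGhost p t n) (ghost p (n + 1) b n)
    -- The multiple prescribed over `ℤ[k]` is identified with the constructed `y`, whose image over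
    -- `Λ` is known.
    have h₁ : ghost p (n + 1) c n = y :=
      toTensorPower_injective ((h n n.lt_succ_self).trans hy'.symm)
    rw [ghost_map, ghost_map, h₁]
    refine (hy (ρ.commToLift V)).trans ?_
    rw [map_scalarGhost]

theorem wittClass_map {V' : Type w} [AddCommGroup V'] [Module k V'] (f : V →ₗ[k] V')
    (x : Witt p (n + 1) (ofModule k V)) :
    ρ.wittClass hψ (Witt.map p (n + 1) (ofLinearMap f) x) =
      CycQ.map (p ^ (n + 1)) (ρ.liftHom f) (ρ.wittClass hψ x) := by
  obtain ⟨a, rfl⟩ := Quot.exists_rep x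
  obtain ⟨a, rfl⟩ := ρ.coordsMap_redHom_surjective V a
  have h : (ofLinearMap f).comp (ρ.redHom V) =
      (ρ.redHom V').comp (ofLinearMap (ρ.liftHom f)) :=
    Hom.ext' rfl (AddMonoidHom.ext fun x => (ρ.red_liftHom f x).symm)
  refine Eq.trans ?_ (congrArg _ (ρ.wittClass_mk hψ a).symm)
  rw [← ghostClass_map (ρ.liftBasis V) (ρ.liftBasis V'), ← ρ.wittClass_mk hψ, ← Coords.map_comp,
    ← h, Coords.map_comp]
  rfl

end

end ModPReduction

/-! ### Existence of sums and of scalar multiples -/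

namespace RBimod

noncomputable section

variable {p n : ℕ} [Fact p.Prime]

theorem int_dvd_pow_sub (x : ℤ) : (p : ℤ) ∣ x ^ p - RingHom.id ℤ x := by
  rw [← ZMod.intCast_zmod_eq_zero_iff_dvd]
  simp

/-- Raising the variables to the power `p` is a Frobenius lift, since modulo `p` it is the `p`-th
power map. -/
theorem mvPolynomial_dvd_pow_sub {σ : Type*} (x : MvPolynomial σ ℤ) :
    (p : MvPolynomial σ ℤ) ∣ x ^ p - (MvPolynomial.expand p).toRingHom x := by
  have h : (MvPolynomial.C (p : ℤ) : MvPolynomial σ ℤ) = p := map_natCast _ _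
  rw [← h, MvPolynomial.C_dvd_iff_zmod, map_sub, sub_eq_zero, map_pow]
  refine Eq.trans ?_ (MvPolynomial.map_expand p (Int.castRingHom (ZMod p)) x).symm
  rw [MvPolynomial.expand_zmod]

/-- Dwork congruences are additive, so Dwork's lemma over `ℤ[M]` realises the sum of the ghost
components; the result is then mapped to the free cover. -/
theorem Witt.exists_isSum {B : RBimod.{u, v}} (x y : Witt p n B) : ∃ z, Witt.IsSum p n x y z := by
  obtain ⟨x, rfl⟩ := Quot.exists_rep x
  obtain ⟨y, rfl⟩ := Quot.exists_rep y
  obtain ⟨a, rfl⟩ := Coords.map_surjective p n _ (intLift_surjective B) x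
  obtain ⟨a', rfl⟩ := Coords.map_surjective p n _ (intLift_surjective B) y
  let b : Module.Basis B.M ℤ (B.M →₀ ℤ) := Finsupp.basisSingleOne
  obtain ⟨c, -, hc⟩ := exists_ghost_eq b int_dvd_pow_sub
    (fun j => ghost p n a j + ghost p n a' j)
    (fun j _ => (rotInv_ghost b a).add b (rotInv_ghost b a'))
    (fun j _ => (dworkCong_ghost b int_dvd_pow_sub a).add b
      (dworkCong_ghost b int_dvd_pow_sub a')) (Nat.zero_le n) 0 (fun j hj => absurd hj (by omega))
  have h₁ : (counit B).comp (intLift (cover B) fun m => FreeBimodule.of m) =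
      intLift B fun m => m := by
    rw [comp_intLift]
    congr 1
    funext m
    exact counit_of B m
  let ι := Coords.map p n (intLift (cover B) fun m => FreeBimodule.of m)
  refine ⟨Witt.mk p n (Coords.map p n (intLift B fun m => m) c), ι a, ι a', ι c, ?_, ?_, ?_,
    fun j hj => ?_⟩
  · rw [← Coords.map_comp, h₁]; rfl
  · rw [← Coords.map_comp, h₁]; rfl
  · rw [← Coords.map_comp, h₁]
  · rw [ghost_map, ghost_map, ghost_map, hc j hj, map_add]

/-- The same argument over `ℤ[R]`, with variables as the lifts of the coordinates of the scalar. -/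
theorem Witt.exists_isSMul {R : Type u} {M : Type v} [CommRing R] [AddCommGroup M] [Module R M]
    (a : TruncatedWittVector p n R) (x : Witt p n (ofModule R M)) :
    ∃ y, Witt.IsSMul p n a x y := by
  obtain ⟨x, rfl⟩ := Quot.exists_rep x
  obtain ⟨x, rfl⟩ := Coords.map_surjective p n _ (commCounit_surjective R M) x
  let t : Fin n → MvPolynomial R ℤ := fun i => MvPolynomial.X (a.coeff i)
  let b : Module.Basis M (MvPolynomial R ℤ) (M →₀ MvPolynomial R ℤ) := Finsupp.basisSingleOne
  choose g _ hg using fun j => exists_toTensorPower_smul (R' := MvPolynomial R ℤ)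
    (M' := M →₀ MvPolynomial R ℤ) (scalarGhost p t j) (ghost p n x j)
  obtain ⟨c, -, hc⟩ := exists_ghost_eq b mvPolynomial_dvd_pow_sub g
    (fun j _ => (rotInv_ghost b x).smul b (hg j))
    (fun j _ => (dworkCong_ghost b mvPolynomial_dvd_pow_sub x).smul b
      (scalarGhost_frobenius mvPolynomial_dvd_pow_sub t j) (hg j) (hg (j + 1)))
    (Nat.zero_le n) 0 (fun j hj => absurd hj (by omega))
  refine ⟨_, t, x, c, fun i => MvPolynomial.aeval_X _ _, rfl, rfl, fun j hj => ?_⟩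
  rw [hc j hj]
  exact hg j

end

end RBimod

namespace ModPReduction

noncomputable section

open RBimod

universe u₁ u₂ w

variable {p : ℕ} [Fact p.Prime] {Λ : Type u₁} {k : Type u₂} [CommRing Λ] [Field k]
  [CharP k p] [PerfectRing k p]
  (ρ : ModPReduction p Λ k) {V : Type w} [AddCommGroup V] [Module k V] {n : ℕ}
  {ψ : Λ →+* Λ}

/-! ### Surjectivity of the comparison map -/

/-- The classes of the invariant tensors in the image of the comparison map. -/
def InImage (x : Cyc (ofModule Λ (FreeLift ρ V)) (p ^ (n + 1))) : Prop :=
  ∃ (hx : RotInv (ρ.liftBasis V) x) (a : Coords p (n + 1) (ofModule Λ (FreeLift ρ V))),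
    ghostClass (ρ.liftBasis V) a = cycClass (ρ.liftBasis V) x hx

theorem InImage.add (hψ : ∀ x, (p : Λ) ∣ x ^ p - ψ x)
    {x y : Cyc (ofModule Λ (FreeLift ρ V)) (p ^ (n + 1))} (hx : ρ.InImage x)
    (hy : ρ.InImage y) : ρ.InImage (x + y) := by
  obtain ⟨hx, a, ha⟩ := hx
  obtain ⟨hy, a', ha'⟩ := hy
  let b := ρ.liftBasis V
  obtain ⟨c, -, hc⟩ := exists_ghost_eq b hψ
    (fun j => ghost p (n + 1) a j + ghost p (n + 1) a' j)
    (fun j _ => (rotInv_ghost b a).add b (rotInv_ghost b a'))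
    (fun j _ => (dworkCong_ghost b hψ a).add b (dworkCong_ghost b hψ a')) (Nat.zero_le _) 0
    (fun j hj => absurd hj (by omega))
  refine ⟨hx.add b hy, c, ?_⟩
  rw [cycClass_add b hx hy, ← ha, ← ha']
  exact ghostClass_eq_add b hψ (hc n n.lt_succ_self)

theorem inImage_cycTr (z : Cyc (ofModule Λ (FreeLift ρ V)) (p ^ (n + 1)))
    (hz : RotInv (ρ.liftBasis V) (cycTr p _ (n + 1) z)) : ρ.InImage (cycTr p _ (n + 1) z) := by
  refine ⟨hz, 0, (cycClass_eq_iff _ _ _).2 ⟨-z, ?_⟩⟩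
  have h : ghost p (n + 1) (0 : Coords p (n + 1) (ofModule Λ (FreeLift ρ V))) (n + 1) = 0 := by
    rw [ghost]
    refine Finset.sum_eq_zero fun i _ => ?_
    rw [dif_pos i.2.le]
    refine Finset.sum_eq_zero fun s _ => ?_
    rw [Pi.zero_apply, cycPow_zero (ρ.liftBasis V), map_zero]
    exact (pow_pos (Fact.out : p.Prime).pos _).ne'
  rw [h, map_neg, zero_sub]

/-- Descending induction on the distance from `r` to `n + 1`: up to a multiple of `p`, which is
absorbed by a longer period, the coefficient is a power realised by one word in coordinate `r`. -/
theorem inImage_orbitSum (hψ : ∀ x, (p : Λ) ∣ x ^ p - ψ x)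
    {r : ℕ} (hr : r ≤ n + 1) (c : Λ)
    {w : ℕ → Module.Basis.ofVectorSpaceIndex k V}
    (hw : Function.IsPeriodicPt seqShift (p ^ r) w) :
    ρ.InImage (orbitSum (ρ.liftBasis V) (n + 1) r c w) := by
  obtain ⟨d, hd⟩ := Nat.exists_eq_add_of_le hr
  induction d generalizing r c with
  | zero =>
    obtain rfl : n + 1 = r := hd
    have h := orbitSum_rotInv (ρ.liftBasis V) le_rfl c hw
    rw [← cycTr_word (ρ.liftBasis V) c hw] at h ⊢
    exact ρ.inImage_cycTr _ h
  | succ d ih =>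
    have hrn : r < n + 1 := by omega
    -- Perfectness of `k` enters here: `c` is a `p^(n+1-r)`-th power modulo `p`.
    obtain ⟨e, he⟩ := (bijective_iterateFrobenius k p (n := n + 1 - r)).2 (ρ.hom c)
    obtain ⟨f, rfl⟩ := ρ.surjective e
    obtain ⟨c', hc'⟩ := (ρ.dvd_sub_iff c (f ^ p ^ (n + 1 - r))).2 (by
      rw [← he, iterateFrobenius_def, map_pow])
    have hwr := isPeriodicPt_pow_le r.le_succ hw
    have h₁ : c = f ^ p ^ (n + 1 - r) + p ^ (r + 1 - r) * c' := by
      rw [Nat.add_sub_cancel_left, pow_one, ← hc']; ring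
    rw [h₁, orbitSum_add _ _ _ (isPeriodicPt_pow_le hr hw),
      ← orbitSum_of_le (ρ.liftBasis V) r.le_succ hrn c' hw]
    refine InImage.add ρ hψ ?_ (ih hrn c' hwr (by omega))
    refine ⟨orbitSum_rotInv _ hr _ hw, Function.update 0 ⟨r, hrn⟩ (word (ρ.liftBasis V) _ f w),
      (cycClass_eq_iff _ _ _).2 ⟨0, ?_⟩⟩
    rw [map_zero, ghost_single_word (ρ.liftBasis V) hrn f hw, sub_self]

theorem wittClass_surjective (hψ : ∀ x, (p : Λ) ∣ x ^ p - ψ x) :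
    Function.Surjective (ρ.wittClass hψ (V := V) (n := n)) := by
  intro q
  obtain ⟨x, hx, rfl⟩ := cycClass_surjective (ρ.liftBasis V) q
  suffices ρ.InImage x by
    obtain ⟨_, a, ha⟩ := this
    exact ⟨_, (ρ.wittClass_mk hψ a).trans ha⟩
  obtain ⟨S, hS, hx'⟩ := exists_eq_sum_orbits (ρ.liftBasis V) isConnecting_circle x
  rw [hx']
  refine Finset.sum_induction _ _ (fun _ _ => InImage.add ρ hψ) ?_ fun w hw => ?_
  · have h := ρ.inImage_cycTr (V := V) (n := n) 0
    rw [map_zero] at h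
    exact h fun w _ => by rw [map_zero, map_zero]
  · obtain ⟨r, hr, hr', hwr⟩ := exists_minimalPeriod_eq (hS w hw)
    have h := ρ.inImage_orbitSum hψ hr (coef (ρ.liftBasis V) w x) hwr
    rw [hr', Finset.sum_congr rfl fun s _ => by rw [hx.iterate _ (hS w hw)]]
    exact h

end

end ModPReduction

/-! ### ### Changing a coordinate by a tensor minus its rotation -/

namespace RBimod

noncomputable section

variable {p n : ℕ} [Fact p.Prime]

theorem tensZMap_surjective {B : RBimod.{u, v}} {B' : RBimod} (f : Hom B B')
    (hf : Function.Surjective f.onMod) (L : ℕ) [NeZero L] :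
    Function.Surjective (tensZMap f L) := by
  intro y
  induction y using tensZ_induction with
  | add a b ha hb =>
    obtain ⟨x, rfl⟩ := ha
    obtain ⟨y, rfl⟩ := hb
    exact ⟨x + y, map_add _ _ _⟩
  | tprod m =>
    choose g hg using hf
    refine ⟨tprod ℤ fun i => g (m i), ?_⟩
    rw [tensZMap, PiTensorProduct.map_tprod]
    exact congrArg _ (funext fun i => hg (m i))

theorem tensZMap_rotZ {B : RBimod.{u, v}} {B' : RBimod} (f : Hom B B') {L : ℕ} [NeZero L]
    (c : Fin L) (x : TensorPower ℤ L B.M) :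
    tensZMap f L (rotZ B.M L c x) = rotZ B'.M L c (tensZMap f L x) := by
  induction x using tensZ_induction with
  | add a b ha hb => simp only [map_add, ha, hb]
  | tprod m =>
    simp only [rotZ, reindex_tprod, tensZMap, PiTensorProduct.map_tprod]

/-- The coordinate of index `m` of a Witt vector may be changed by the difference of a tensor and
its rotation, at the expense of changing the subsequent coordinates. -/
theorem exists_mk_eq_of_sub_rotZ {B : RBimod.{u, v}} (a : Coords p n B) {m : ℕ} (hm : m < n)
    (t : TensorPower ℤ (p ^ m) B.M) :
    ∃ a' : Coords p n B, Witt.mk p n a' = Witt.mk p n a ∧ (∀ i : Fin n, (i : ℕ) < m → a' i = a i) ∧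
      a' ⟨m, hm⟩ = a ⟨m, hm⟩ +
        Submodule.Quotient.mk (t - rotZ B.M (p ^ m) (Fin.ofNat _ 1) t) := by
  obtain ⟨q, rfl⟩ := Coords.map_surjective p n _ (intLift_surjective B) a
  obtain ⟨t, rfl⟩ := tensZMap_surjective _ (intLift_surjective B) _ t
  let b : Module.Basis B.M ℤ (B.M →₀ ℤ) := Finsupp.basisSingleOne
  let d : TensorPower ℤ (p ^ m) (B.M →₀ ℤ) := t - rotZ (B.M →₀ ℤ) (p ^ m) (Fin.ofNat _ 1) t
  -- Since the transfer kills `d`, adding it to coordinate `m` keeps `w_0, …, w_m`. Dwork's lemma,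
  -- started after index `m`, restores the later components.
  let q₀ : Coords p n (ofModule ℤ (B.M →₀ ℤ)) :=
    Function.update q ⟨m, hm⟩ (q ⟨m, hm⟩ + Submodule.Quotient.mk d)
  have h₀ : ∀ j < m + 1, ghost p n q₀ j = ghost p n q j := by
    intro j hj
    obtain hj | rfl := (Nat.lt_succ_iff.1 hj).lt_or_eq
    · refine ghost_congr fun i hi => Function.update_of_ne (fun h => ?_) _ _
      subst h
      exact absurd hi (by simpa using hj)
    · rw [ghost_update_add b q hm _ (Submodule.Quotient.mk d)
        (fun w => (coef_mk b w d).trans (coef_mk b w d).symm), cycTr_sub_rotZ b, add_zero]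
  obtain ⟨q₁, hq₁, hg⟩ := exists_ghost_eq b int_dvd_pow_sub (fun j => ghost p n q j)
    (fun j _ => rotInv_ghost b q) (fun j _ => dworkCong_ghost b int_dvd_pow_sub q) hm q₀ h₀
  refine ⟨Coords.map p n (intLift B fun m => m) q₁, mk_intLift_eq_of_ghost_eq B hg,
    fun i hi => ?_, ?_⟩
  · refine congrArg (Tens.map _ _) ((hq₁ i (Nat.lt_succ_of_lt hi)).trans ?_)
    exact Function.update_of_ne (fun h => by subst h; exact absurd hi (lt_irrefl _)) _ _
  · have h : q₁ ⟨m, hm⟩ = q ⟨m, hm⟩ + Submodule.Quotient.mk d :=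
      (hq₁ ⟨m, hm⟩ m.lt_succ_self).trans (Function.update_self _ _ _)
    refine (congrArg (Tens.map (intLift B fun m => m) _) h).trans ((map_add _ _ _).trans ?_)
    refine congrArg (_ + ·) (congrArg Submodule.Quotient.mk ?_)
    rw [map_sub, ← tensZMap_rotZ]

end

end RBimod

namespace ModPReduction

noncomputable section

open RBimod

universe u₁ u₂ w

variable {p : ℕ} [Fact p.Prime] {Λ : Type u₁} {k : Type u₂} [CommRing Λ] [Field k]
  (ρ : ModPReduction p Λ k) {V : Type w} [AddCommGroup V] [Module k V] {n : ℕ}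
  {ψ : Λ →+* Λ}

/-! ### Injectivity of the comparison map -/

/-- At a word of period `p^r`, every contribution to the difference of ghost components other than
coordinate `m` vanishes modulo `p^(m-r+1)`. Coordinate `m` gives `p^(m-r)` times a sum of
differences of powers; `hflat` replaces torsion-freeness in cancelling this factor. -/
theorem sum_coef_eq_zero [CharP k p]
    (hflat : ∀ j ≤ n, ∀ x : Λ, (p : Λ) ^ (j + 1) ∣ p ^ j * x → (p : Λ) ∣ x)
    {a c : Coords p (n + 1) (ofModule Λ (FreeLift ρ V))} {m : ℕ} (hm : m < n + 1)
    (hac : ∀ i : Fin (n + 1), (i : ℕ) < m → a i = c i)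
    (h : ghostClass (ρ.liftBasis V) a = ghostClass (ρ.liftBasis V) c) {r : ℕ} (hr : r ≤ m)
    {w : ℕ → Module.Basis.ofVectorSpaceIndex k V}
    (hw : Function.IsPeriodicPt seqShift (p ^ r) w) :
    ∑ s ∈ Finset.range (p ^ r), coef (Module.Basis.ofVectorSpace k V) (seqShift^[s] w)
      (Tens.map (ρ.redHom V) _ (a ⟨m, hm⟩) - Tens.map (ρ.redHom V) _ (c ⟨m, hm⟩)) = 0 := by
  let b := ρ.liftBasis V
  have hwn : Function.IsPeriodicPt seqShift (p ^ (n + 1)) w :=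
    isPeriodicPt_pow_le (by omega) hw
  obtain ⟨z, hz⟩ := (cycClass_eq_iff b _ _).1 h
  have h₁ := congrArg (coef b w) hz
  rw [coef_cycTr b hwn, map_sub, coef_ghost b a hwn, coef_ghost b c hwn,
    ← Finset.sum_sub_distrib, ← Finset.add_sum_erase _ _ (Finset.mem_univ ⟨m, hm⟩)] at h₁
  have e : p ^ (n + 1) = p ^ (n + 1 - r) * p ^ r := by
    rw [← pow_add, Nat.sub_add_cancel (by omega)]
  -- The transfer goes `p^(n+1-r)` times around the orbit, and `n + 1 - r ≥ m - r + 1`.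
  have e' := (congrArg (fun N => ∑ s ∈ Finset.range N, coef b (seqShift^[s] w) z) e).trans
    (sum_range_mul_of_periodic (periodic_coef b hw z) _)
  rw [nsmul_eq_mul, Nat.cast_pow] at e'
  rw [e'] at h₁
  have h₂ : (p : Λ) ^ (m - r + 1) ∣ ∑ i ∈ Finset.univ.erase (⟨m, hm⟩ : Fin (n + 1)),
      ((if (i : ℕ) ≤ n + 1 then cosetNorm p (fun s => coef b (seqShift^[s] w) (a i)) i (n + 1)
        else 0) - if (i : ℕ) ≤ n + 1 then
          cosetNorm p (fun s => coef b (seqShift^[s] w) (c i)) i (n + 1) else 0) := by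
    refine Finset.dvd_sum fun i hi => ?_
    rw [if_pos i.2.le, if_pos i.2.le]
    obtain him | him | him := lt_trichotomy (i : ℕ) m
    · rw [hac i him, sub_self]
      exact dvd_zero _
    · exact absurd (Fin.ext him) (Finset.ne_of_mem_erase hi)
    · refine (pow_dvd_pow _ (by omega : m - r + 1 ≤ i - r)).trans (dvd_sub ?_ ?_) <;>
        exact pow_dvd_cosetNorm (periodic_coef b hw _) (by omega)
  have h₃ := (dvd_add_left h₂).1 (h₁ ▸
    (pow_dvd_pow (p : Λ) (by omega : m - r + 1 ≤ n + 1 - r)).mul_right _)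
  rw [if_pos hm.le, if_pos hm.le, cosetNorm_eq_of_le (periodic_coef b hw _) hr,
    cosetNorm_eq_of_le (periodic_coef b hw _) hr, ← mul_sub, ← Finset.sum_sub_distrib] at h₃
  have h₄ := (ρ.dvd_iff _).1 (hflat _ (by omega) _ h₃)
  have : ExpChar k p := ExpChar.prime Fact.out
  rw [map_sum] at h₄
  -- The orbit sum is known to vanish only after the Frobenius power `p^(n+1-m)`, which is additive
  -- on `k` and has zero kernel.
  refine eq_zero_of_pow_eq_zero (n := p ^ (n + 1 - m)) ?_
  rw [sum_pow_char_pow, ← h₄]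
  refine Finset.sum_congr rfl fun s _ => ?_
  rw [map_sub, coef_redHom, coef_redHom, sub_pow_char_pow, map_sub, map_pow, map_pow]

theorem wittClass_injective [CharP k p] (hψ : ∀ x, (p : Λ) ∣ x ^ p - ψ x)
    (hflat : ∀ j ≤ n, ∀ x : Λ, (p : Λ) ^ (j + 1) ∣ p ^ j * x → (p : Λ) ∣ x) :
    Function.Injective (ρ.wittClass hψ (V := V) (n := n)) := by
  have key : ∀ d m : ℕ, m + d = n + 1 → ∀ a c : Coords p (n + 1) (ofModule k V),
      (∀ i : Fin (n + 1), (i : ℕ) < m → a i = c i) →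
      ρ.wittClass hψ (Witt.mk p (n + 1) a) = ρ.wittClass hψ (Witt.mk p (n + 1) c) →
      Witt.mk p (n + 1) a = Witt.mk p (n + 1) c := by
    intro d
    induction d with
    | zero => exact fun m hm a c hac _ => congrArg _ (funext fun i => hac i (by omega))
    | succ d ih =>
      intro m hmd a c hac h
      have hm : m < n + 1 := by omega
      obtain ⟨xa', rfl⟩ := ρ.coordsMap_redHom_surjective V a
      obtain ⟨xc, rfl⟩ := ρ.coordsMap_redHom_surjective V c
      -- The lifts are chosen equal over `Λ`, not just modulo `p`, below index `m`, so that those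
      -- terms cancel exactly.
      let xa : Coords p (n + 1) (ofModule Λ (FreeLift ρ V)) :=
        fun i => if (i : ℕ) < m then xc i else xa' i
      have hxa : Coords.map p (n + 1) (ρ.redHom V) xa' = Coords.map p (n + 1) (ρ.redHom V) xa := by
        funext i
        by_cases hi : (i : ℕ) < m
        · refine (hac i hi).trans (congrArg (Tens.map (ρ.redHom V) _) ?_)
          exact (if_pos hi).symm
        · refine congrArg (Tens.map (ρ.redHom V) _) ?_
          exact (if_neg hi).symm
      rw [hxa] at h hac ⊢
      rw [wittClass_mk, wittClass_mk] at h
      obtain ⟨t, ht⟩ := exists_eq_sub_rotZ (Module.Basis.ofVectorSpace k V)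
        (Tens.map (ρ.redHom V) _ (xc ⟨m, hm⟩) - Tens.map (ρ.redHom V) _ (xa ⟨m, hm⟩))
        (fun r hr w hw => ρ.sum_coef_eq_zero hflat hm (fun i hi => (if_pos hi).symm) h.symm hr hw)
      obtain ⟨a', ha', hlt, heq⟩ :=
        exists_mk_eq_of_sub_rotZ (Coords.map p (n + 1) (ρ.redHom V) xa) hm t
      rw [← ha']
      refine ih (m + 1) (by omega) a' _ (fun i hi => ?_) ?_
      · obtain hi | hi := (Nat.lt_succ_iff.1 hi).lt_or_eq
        · exact (hlt i hi).trans (hac i hi)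
        · obtain rfl : i = ⟨m, hm⟩ := Fin.ext hi
          refine heq.trans ((congrArg (_ + ·) ht.symm).trans ?_)
          exact add_sub_cancel _ _
      · rw [ha', wittClass_mk, wittClass_mk, h]
  intro x y hxy
  obtain ⟨a, rfl⟩ := Quot.exists_rep x
  obtain ⟨c, rfl⟩ := Quot.exists_rep y
  exact key (n + 1) 0 (by omega) a c (fun i hi => absurd hi (by omega)) hxy

/-! ### ### The comparison bijection and the transported structure -/

section Equiv

variable {p : ℕ} [Fact p.Prime] {Λ : Type u₁} {k : Type u₂} [CommRing Λ] [Field k]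
  [CharP k p] [PerfectRing k p]
  (ρ : ModPReduction p Λ k) {V : Type w} [AddCommGroup V] [Module k V] {n : ℕ}
  {ψ : Λ →+* Λ}

/-- The comparison of Witt vectors with coefficients and polynomial Witt vectors. -/
def wittEquiv (hψ : ∀ x, (p : Λ) ∣ x ^ p - ψ x)
    (hflat : ∀ j ≤ n, ∀ x : Λ, (p : Λ) ^ (j + 1) ∣ p ^ j * x → (p : Λ) ∣ x)
    (V : Type w) [AddCommGroup V] [Module k V] :
    Witt p (n + 1) (ofModule k V) ≃ ρ.PolyWitt (n + 1) V :=
  Equiv.ofBijective (ρ.wittClass hψ (V := V) (n := n))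
    ⟨ρ.wittClass_injective hψ hflat, ρ.wittClass_surjective hψ⟩

variable (hψ : ∀ x, (p : Λ) ∣ x ^ p - ψ x)
  (hflat : ∀ j ≤ n, ∀ x : Λ, (p : Λ) ^ (j + 1) ∣ p ^ j * x → (p : Λ) ∣ x)

/-- For the forward direction, some sum exists, has the same image as `z`, and hence equals `z` by
injectivity. -/
theorem wittEquiv_add_eq_iff (x y z : Witt p (n + 1) (ofModule k V)) :
    ρ.wittEquiv hψ hflat V x + ρ.wittEquiv hψ hflat V y = ρ.wittEquiv hψ hflat V z ↔
      Witt.IsSum p (n + 1) x y z := by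
  refine ⟨fun h => ?_, fun h => ρ.wittClass_of_isSum hψ h⟩
  obtain ⟨z', hz'⟩ := Witt.exists_isSum x y
  obtain rfl : z' = z := (ρ.wittEquiv hψ hflat V).injective
    ((ρ.wittClass_of_isSum hψ hz').symm.trans h)
  exact hz'

theorem wittEquiv_smul_eq_of_isSMul {a : TruncatedWittVector p (n + 1) k}
    {x y : Witt p (n + 1) (ofModule k V)} (h : Witt.IsSMul p (n + 1) a x y) :
    a • ρ.wittEquiv hψ hflat V x = ρ.wittEquiv hψ hflat V y := by
  obtain ⟨c, hc, hy⟩ := ρ.wittClass_of_isSMul hψ h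
  exact (PolyWitt.smul_def ρ (n + 1) V a c hc _).trans hy.symm

theorem wittEquiv_smul_eq_iff (a : TruncatedWittVector p (n + 1) k)
    (x y : Witt p (n + 1) (ofModule k V)) :
    a • ρ.wittEquiv hψ hflat V x = ρ.wittEquiv hψ hflat V y ↔ Witt.IsSMul p (n + 1) a x y := by
  refine ⟨fun h => ?_, ρ.wittEquiv_smul_eq_of_isSMul hψ hflat⟩
  obtain ⟨y', hy'⟩ := Witt.exists_isSMul a x
  obtain rfl : y' = y := (ρ.wittEquiv hψ hflat V).injective
    ((ρ.wittEquiv_smul_eq_of_isSMul hψ hflat hy').symm.trans h)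
  exact hy'

end Equiv

end

end ModPReduction

/-! ### ### Frobenius lift and divisibility in `W_m(k)` -/

namespace TruncatedWittVector

variable {p : ℕ} [Fact p.Prime] {k : Type u} [CommRing k] [CharP k p] [PerfectRing k p] {m : ℕ}

/-- In characteristic `p` the Witt vector Frobenius acts on coordinates by `p`-th powers, so it
descends to the truncation; it agrees with the `p`-th power in coordinate `0`, hence modulo `p` as
`k` is perfect. -/
theorem exists_frobenius_lift :
    ∃ ψ : TruncatedWittVector p m k →+* TruncatedWittVector p m k,
      ∀ x, (p : TruncatedWittVector p m k) ∣ x ^ p - ψ x := by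
  have hker : RingHom.ker (WittVector.truncate m : WittVector p k →+* _) ≤
      RingHom.ker ((WittVector.truncate m).comp
        (WittVector.frobenius : WittVector p k →+* WittVector p k)) := by
    intro x hx
    rw [WittVector.mem_ker_truncate] at hx
    rw [RingHom.mem_ker, RingHom.comp_apply, ← RingHom.mem_ker, WittVector.mem_ker_truncate]
    intro i hi
    rw [WittVector.coeff_frobenius_charP, hx i hi, zero_pow (Fact.out : p.Prime).ne_zero]
  refine ⟨RingHom.liftOfSurjective (WittVector.truncate m)
    (WittVector.truncate_surjective p m k) ⟨_, hker⟩, fun x => ?_⟩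
  obtain ⟨x, rfl⟩ := WittVector.truncate_surjective p m k x
  have h : x ^ p - WittVector.frobenius x ∈ Ideal.span {(p : WittVector p k)} := by
    rw [WittVector.mem_span_p_iff_coeff_zero_eq_zero]
    refine (map_sub (WittVector.constantCoeff : WittVector p k →+* k) (x ^ p) _).trans ?_
    rw [map_pow, sub_eq_zero]
    exact (WittVector.coeff_frobenius_charP _ x 0).symm
  obtain ⟨y, hy⟩ := Ideal.mem_span_singleton.1 h
  refine ⟨WittVector.truncate m y, ?_⟩
  rw [← map_natCast (WittVector.truncate m), ← map_mul, ← hy, map_sub, map_pow]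
  congr 1
  exact RingHom.liftOfSurjective_comp_apply ..

/-- Coordinate `j` of `p^j z` is `z_0^(p^j)`, and the truncation retains it when `j < m`. For `z = x
- p y` it vanishes, so `z_0 = 0` and `p` divides `z`. -/
theorem dvd_of_pow_succ_dvd {j : ℕ} (hj : j < m)
    {x : TruncatedWittVector p m k} (h : (p : TruncatedWittVector p m k) ^ (j + 1) ∣ p ^ j * x) :
    (p : TruncatedWittVector p m k) ∣ x := by
  obtain ⟨y, hy⟩ := h
  obtain ⟨x, rfl⟩ := WittVector.truncate_surjective p m k x
  obtain ⟨y, rfl⟩ := WittVector.truncate_surjective p m k y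
  have h₀ : (x - p * y) * p ^ j ∈
      RingHom.ker (WittVector.truncate m : WittVector p k →+* TruncatedWittVector p m k) := by
    rw [RingHom.mem_ker, map_mul, map_sub, map_mul, map_pow, map_natCast, sub_mul, mul_comm, hy]
    ring
  have h₁ := (WittVector.mem_ker_truncate m _).1 h₀ j hj
  have h₂ := WittVector.mul_pow_charP_coeff_succ (x - (p : WittVector p k) * y) (m := 0) (n := j)
  rw [zero_add, h₁] at h₂
  have h₃ : (x - p * y).coeff 0 = 0 := (bijective_iterateFrobenius k p (n := j)).1 (by
    rw [iterateFrobenius_def, ← h₂, map_zero])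
  obtain ⟨z, hz⟩ := Ideal.mem_span_singleton.1
    ((WittVector.mem_span_p_iff_coeff_zero_eq_zero _).2 h₃)
  rw [sub_eq_iff_eq_add.1 hz, map_add, map_mul, map_mul, map_natCast]
  exact dvd_add (Dvd.intro _ rfl) (Dvd.intro _ rfl)

end TruncatedWittVector

theorem mainTheorem4 (p : ℕ) [Fact p.Prime] :
    (∀ (k : Type u) [Field k] [CharP k p] [PerfectRing k p] (n m : ℕ) (hn : 1 ≤ n)
      (hm : n ≤ m),
      ∃ (_ : ∀ V : ModuleCat.{v} k, AddCommGroup (RBimod.Witt p n (RBimod.ofModule k V)))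
        (_ : ∀ V : ModuleCat.{v} k,
          Module (TruncatedWittVector p n k) (RBimod.Witt p n (RBimod.ofModule k V))),
        (∀ (V : ModuleCat.{v} k) (x y z : RBimod.Witt p n (RBimod.ofModule k V)),
          x + y = z ↔ RBimod.Witt.IsSum p n x y z) ∧
        (∀ (V : ModuleCat.{v} k) (a : TruncatedWittVector p n k)
          (x y : RBimod.Witt p n (RBimod.ofModule k V)), a • x = y ↔ RBimod.Witt.IsSMul p n a x y) ∧
        ∃ e : ∀ V : ModuleCat.{v} k, RBimod.Witt p n (RBimod.ofModule k V) ≃ₗ[TruncatedWittVector p n k]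
            ((ModPReduction.witt p k m (hn.trans hm)).polyWitt n).obj V,
          ∀ (V V' : ModuleCat.{v} k) (f : V ⟶ V') (x : RBimod.Witt p n (RBimod.ofModule k V)),
            e V' (RBimod.Witt.map p n (RBimod.ofLinearMap f.hom) x) =
              (((ModPReduction.witt p k m (hn.trans hm)).polyWitt n).map f).hom (e V x)) ∧
    (∀ n : ℕ, 1 ≤ n →
      ∃ (_ : ∀ V : ModuleCat.{v} (ZMod p), AddCommGroup (RBimod.Witt p n (RBimod.ofModule (ZMod p) V))),
        (∀ (V : ModuleCat.{v} (ZMod p)) (x y z : RBimod.Witt p n (RBimod.ofModule (ZMod p) V)),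
          x + y = z ↔ RBimod.Witt.IsSum p n x y z) ∧
        ∃ e : ∀ V : ModuleCat.{v} (ZMod p), RBimod.Witt p n (RBimod.ofModule (ZMod p) V) ≃+
            ((ModPReduction.int p).polyWitt n).obj V,
          ∀ (V V' : ModuleCat.{v} (ZMod p)) (f : V ⟶ V') (x : RBimod.Witt p n (RBimod.ofModule (ZMod p) V)),
            e V' (RBimod.Witt.map p n (RBimod.ofLinearMap f.hom) x) =
              (((ModPReduction.int p).polyWitt n).map f).hom (e V x)) := by
  constructor
  · intro k _ _ _ n m hn hm
    obtain ⟨n, rfl⟩ := Nat.exists_eq_add_of_le' hn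
    let ρ := ModPReduction.witt p k m (hn.trans hm)
    obtain ⟨ψ, hψ⟩ := TruncatedWittVector.exists_frobenius_lift (p := p) (k := k) (m := m)
    let e (V : ModuleCat.{v} k) := ρ.wittEquiv (n := n) hψ
      (fun j hj x => TruncatedWittVector.dvd_of_pow_succ_dvd (by omega)) V
    -- The module structure is pulled back along `e`; the graph descriptions identify it with the
    -- prescribed operations.
    refine ⟨fun V => (e V).addCommGroup, fun V => (e V).module _, fun V x y z => ?_,
      fun V a x y => ?_, fun V => (e V).linearEquiv _, fun V V' f x => ?_⟩
    · exact (e V).symm_apply_eq.trans (ρ.wittEquiv_add_eq_iff hψ _ x y z)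
    · exact (e V).symm_apply_eq.trans (ρ.wittEquiv_smul_eq_iff hψ _ a x y)
    · exact ρ.wittClass_map hψ f.hom x
  · intro n hn
    obtain ⟨n, rfl⟩ := Nat.exists_eq_add_of_le' hn
    let ρ := ModPReduction.int p
    have hψ := RBimod.int_dvd_pow_sub (p := p)
    let e (V : ModuleCat.{v} (ZMod p)) := ρ.wittEquiv (n := n) hψ
      (fun j _ x h => by
        rw [pow_succ] at h
        exact (mul_dvd_mul_iff_left
          (pow_ne_zero j (Nat.cast_ne_zero.2 (Fact.out : p.Prime).ne_zero))).1 h) V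
    refine ⟨fun V => (e V).addCommGroup, fun V x y z => ?_, fun V => (e V).addEquiv,
      fun V V' f x => ?_⟩
    · exact (e V).symm_apply_eq.trans (ρ.wittEquiv_add_eq_iff hψ _ x y z)
    · exact ρ.wittClass_map hψ f.hom x
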